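/- Let $k$ be an algebraically closed field of characteristic $2$. Let $\mathrm{Ver}_4^+$ be the symmetric tensor category of finite-dimensional $k[d]/d^2$-modules ($d$ primitive; write $x'=dx$) with commutativity constraint $x\otimes y\mapsto y\otimes x+y'\otimes x'$; let $\mathbb 1$ be its unit and $P=k[d]/d^2$. The Lie algebra $\mathfrak{gl}(P)=P\otimes P^*=\operatorname{End}(P)$ has bracket $[X,Y]=XY-YX-Y'X'$ and, in the basis $(1,d)$ of $P$ with dual basis $(1^*,d^*)$, the basis $x=1\otimes d^*$, $x'=e=1\otimes 1^*+d\otimes d^*$, $y=1\otimes 1^*$, $y'=d\otimes 1^*$. For $a,b\in k$ let $L(1,a,b)$ be the representation on $P$ with $$y\mapsto\begin{pmatrix}b&0\\0&b+1\end{pmatrix},\quad x\mapsto\begin{pmatrix}0&1\\a&0\end{pmatrix},\quad y'\mapsto\begin{pmatrix}0&0\\1&0\end{pmatrix},\quad e\mapsto 1;$$ for $a\neq0$ let $L(0,a,b)$ be the representation on $\mathbb 1^2$ with the same $x,y$ and $y',e\mapsto0$; and let $L(0,0,b)$ be the representation on $\mathbb 1$ with $y\mapsto b$ and $x,y',e\mapsto0$.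 The group scheme $\mathrm{GL}(P)$ has coordinate algebra $\mathcal O=k[A,A^{-1},B,A',B']$, the commutative algebra in $\mathrm{Ind}(\mathrm{Ver}_4^+)$ freely generated by $A,B$ with $A$ inverted, where $\begin{pmatrix}A&A'\\B&A+B'\end{pmatrix}$ is the universal element of $\operatorname{End}(P)$; the counit is $A\mapsto1$, $B\mapsto0$, and $\Delta(A)=A\otimes A+B\otimes A'$, $\Delta(B)=A\otimes B+B\otimes(A+B')$. Its representations are the finite-dimensional left $\mathcal O$-comodules $(V,\rho)$ in $\mathrm{Ver}_4^+$. Let $I=\ker\varepsilon$, and let $\mu_{A-1},\mu_B,\mu_{A'},\mu_{B'}$ be the basis of $\mathrm{Lie}(\mathrm{GL}(P))=(I/I^2)^*$ dual to $A-1,B,A',B'$. It acts on $V$ by $\mu v=(\mu\otimes1)\rho(v)$, and it is identified with $\mathfrak{gl}(P)$ by $x\mapsto\mu_{A'}$, $e\mapsto\mu_{A-1}$, $y\mapsto\mu_{B'}$, $y'\mapsto\mu_B$; this defines the restriction of $V$ to $\mathfrak{gl}(P)$. Consider the following representations of $\mathrm{GL}(P)$: the characters $\chi=A^4$ and $\xi=A^4+A^3B'+A^2BA'$;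 $T_1=P$ with the tautological coaction $v\mapsto A\otimes v+B\otimes v'$; $T_2$ on $\mathbb 1^2=\langle v,w\rangle$ with $v\mapsto A^2\otimes v+(AA'+A'B')\otimes w$, $w\mapsto AA'\otimes v+(A^2+AB'+BA')\otimes w$; and $T_3$ on $P=\langle v,v'\rangle$ with $v\mapsto A^3\otimes v+(A^2B+AA'B'+A^2A')\otimes v'$. Then: 1. The irreducible representations of $\mathrm{GL}(P)$ are, up to isomorphism, exactly $\chi^n$, $T_1\otimes\chi^n$, $T_2\otimes\chi^n$, $T_3\otimes\chi^n$, $\xi\otimes\chi^n$, $\xi\otimes T_1\otimes\chi^n$, $\xi\otimes T_3\otimes\chi^n$ with $n\in\mathbb Z$. 2. For every $n\in\mathbb Z$ their restrictions to $\mathfrak{gl}(P)$ are, respectively, $L(0,0,0)$, $L(1,0,0)$, $L(0,1,0)\cong L(0,1,1)$, $L(1,1,0)$, $L(0,0,1)$, $L(1,0,1)$, $L(1,1,1)$. 3. All $L(\varepsilon,a,b)$ with $\varepsilon\in\{0,1\}$, $a,b\in k$ are irreducible. A representation of $\mathfrak{gl}(P)$ is isomorphic to the restriction of an irreducible representation of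 $\mathrm{GL}(P)$ if and only if it is isomorphic to some $L(\varepsilon,a,b)$ with $\varepsilon\in\{0,1\}$ and $a,b\in\mathbb F_2$. In particular $L(\varepsilon,a,b)$ is such a restriction if and only if $a,b\in\mathbb F_2$. -/

import Mathlib

open scoped TensorProduct

set_option linter.unusedSectionVars false
set_option linter.unusedSimpArgs false
set_option linter.unnecessarySeqFocus false

namespace Ver4

universe u v w

/-- An object of the ind-completion of `Ver_4^+`: a module over `k[d]/d²`, that is, a vector space
with a square-zero endomorphism `d`.  Objects of `Ver_4^+` itself are the finite-dimensional ones. -/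
class VerObj (k : Type u) (V : Type v) [Field k] [AddCommGroup V] [Module k V] where
  d : V →ₗ[k] V
  d_d : ∀ x, d (d x) = 0

/-- The structure map `x ↦ x'` of an object of `Ind(Ver_4^+)`. -/
abbrev dd (k : Type u) {V : Type v} [Field k] [AddCommGroup V] [Module k V] [VerObj k V] :
    V →ₗ[k] V := VerObj.d

section Basic

variable (k : Type u) [Field k] {V : Type v} {W : Type w} [AddCommGroup V] [Module k V]
  [AddCommGroup W] [Module k W]

@[simp] theorem dd_dd [VerObj k V] (x : V) : dd k (dd k x) = 0 := VerObj.d_d x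

theorem add_self_zero [CharP k 2] (x : V) : x + x = 0 := by
  rw [← two_smul k x, CharTwo.two_eq_zero, zero_smul]

theorem neg_self_eq [CharP k 2] (x : V) : -x = x :=
  neg_eq_of_add_eq_zero_left (add_self_zero k x)

/-- The unit object. -/
instance unitObj : VerObj k k where
  d := 0
  d_d _ := rfl

/-- Since `d` is primitive, it acts on a tensor product by `d ⊗ 1 + 1 ⊗ d`. -/
instance tensorObj [CharP k 2] [VerObj k V] [VerObj k W] : VerObj k (V ⊗[k] W) where
  d := (dd k).rTensor W + (dd k).lTensor V
  d_d x := by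
    induction x with
    | zero => simp
    | tmul x y => simp [add_self_zero k]
    | add x y hx hy => rw [map_add, map_add, hx, hy, add_zero]

@[simp] theorem dd_tmul [CharP k 2] [VerObj k V] [VerObj k W] (x : V) (y : W) :
    dd k (x ⊗ₜ[k] y) = dd k x ⊗ₜ y + x ⊗ₜ dd k y := by
  simp [dd, VerObj.d]

/-- The commutativity constraint given by the `R`-matrix `1 ⊗ 1 + d ⊗ d`. -/
def braid [VerObj k V] [VerObj k W] : V ⊗[k] W →ₗ[k] W ⊗[k] V :=
  (TensorProduct.comm k V W).toLinearMap ∘ₗ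
    (LinearMap.id + TensorProduct.map (dd k) (dd k))

@[simp] theorem braid_tmul [VerObj k V] [VerObj k W] (x : V) (y : W) :
    braid k (x ⊗ₜ[k] y) = y ⊗ₜ x + dd k y ⊗ₜ dd k x := by
  simp [braid]

end Basic

/-- An associative unital algebra in `Ind(Ver_4^+)`: `d` is a derivation. -/
class VerAlg (k : Type u) (R : Type v) [Field k] [Ring R] [Algebra k R] extends VerObj k R where
  d_mul : ∀ x y : R, d (x * y) = d x * y + x * d y

/-- A commutative algebra in `Ind(Ver_4^+)`: the multiplication is unchanged by precomposing it
with the commutativity constraint `x ⊗ y ↦ y ⊗ x + y' ⊗ x'`. -/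
class VerCommAlg (k : Type u) (R : Type v) [Field k] [Ring R] [Algebra k R]
    extends VerAlg k R where
  mul_braid : ∀ t : R ⊗[k] R, LinearMap.mul' k R (braid k t) = LinearMap.mul' k R t

section Alg

variable (k : Type u) [Field k] {R : Type v} [Ring R] [Algebra k R]

theorem dd_mul [VerAlg k R] (x y : R) : dd k (x * y) = dd k x * y + x * dd k y :=
  VerAlg.d_mul x y

@[simp] theorem dd_one [VerAlg k R] : dd k (1 : R) = 0 := by
  have h := dd_mul k (1 : R) 1
  simpa using h

@[simp] theorem dd_algebraMap [VerAlg k R] (c : k) : dd k (algebraMap k R c) = 0 := by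
  rw [Algebra.algebraMap_eq_smul_one, map_smul, dd_one, smul_zero]

theorem mul_comm_d [VerCommAlg k R] (x y : R) : x * y = y * x + dd k y * dd k x := by
  have h := VerCommAlg.mul_braid (k := k) (x ⊗ₜ[k] y)
  rw [braid_tmul] at h
  simpa using h.symm

theorem dd_central [VerCommAlg k R] (x y : R) : dd k x * y = y * dd k x := by
  have h := mul_comm_d k (dd k x) y
  simpa using h

theorem dd_sq [VerCommAlg k R] (x : R) : dd k x * dd k x = 0 := by
  have h := mul_comm_d k x x
  simpa using h

/-- The tensor square of an algebra `R` in `Ind(Ver_4^+)`, with the multiplication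
`(μ ⊗ μ) ∘ (1 ⊗ c ⊗ 1)`, `c` the commutativity constraint. -/
def BraidedSq (k : Type u) (R : Type v) [Field k] [Ring R] [Algebra k R] : Type v :=
  R ⊗[k] R

namespace BraidedSq

instance : AddCommGroup (BraidedSq k R) := inferInstanceAs (AddCommGroup (R ⊗[k] R))
instance : Module k (BraidedSq k R) := inferInstanceAs (Module k (R ⊗[k] R))
instance [CharP k 2] [VerObj k R] : VerObj k (BraidedSq k R) :=
  inferInstanceAs (VerObj k (R ⊗[k] R))

/-- The pure tensor `x ⊗ y`. -/
def tm (x y : R) : BraidedSq k R := x ⊗ₜ[k] y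

variable {k}

/-- The underlying element of `R ⊗ R`. -/
def toTensor : BraidedSq k R →ₗ[k] R ⊗[k] R := LinearMap.id

@[simp] theorem toTensor_tm (x y : R) : toTensor (tm k x y) = x ⊗ₜ[k] y := rfl

theorem ind {p : BraidedSq k R → Prop} (h0 : p 0) (ht : ∀ x y, p (tm k x y))
    (ha : ∀ x y, p x → p y → p (x + y)) (x : BraidedSq k R) : p x :=
  TensorProduct.induction_on x h0 ht ha

theorem add_tm (x x' y : R) : tm k (x + x') y = tm k x y + tm k x' y := TensorProduct.add_tmul ..
theorem tm_add (x y y' : R) : tm k x (y + y') = tm k x y + tm k x y' := TensorProduct.tmul_add ..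
@[simp] theorem zero_tm (y : R) : tm k 0 y = 0 := TensorProduct.zero_tmul ..
@[simp] theorem tm_zero (y : R) : tm k y 0 = 0 := TensorProduct.tmul_zero ..
theorem smul_tm (c : k) (x y : R) : tm k (c • x) y = c • tm k x y := rfl
theorem tm_smul (c : k) (x y : R) : tm k x (c • y) = c • tm k x y := TensorProduct.tmul_smul ..
@[simp] theorem dd_tm [CharP k 2] [VerObj k R] (x y : R) :
    dd k (tm k x y) = tm k (dd k x) y + tm k x (dd k y) := dd_tmul k x y

/-- The multiplication of the braided tensor square. -/
def bmul [VerObj k R] : BraidedSq k R →ₗ[k] BraidedSq k R →ₗ[k] BraidedSq k R :=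
  LinearMap.mul k (R ⊗[k] R) +
    (LinearMap.mul k (R ⊗[k] R)).compl₁₂ ((dd k).lTensor R) ((dd k).rTensor R)

theorem bmul_tm [VerObj k R] (a b c e : R) :
    bmul (tm k a b) (tm k c e) = tm k (a * c) (b * e) + tm k (a * dd k c) (dd k b * e) := by
  have h : (LinearMap.mul k (R ⊗[k] R) + (LinearMap.mul k (R ⊗[k] R)).compl₁₂
      ((dd k).lTensor R) ((dd k).rTensor R)) (a ⊗ₜ[k] b) (c ⊗ₜ[k] e) =
      (a * c) ⊗ₜ[k] (b * e) + (a * dd k c) ⊗ₜ[k] (dd k b * e) := by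
    simp [LinearMap.compl₁₂_apply]
  exact h

instance [VerObj k R] : Mul (BraidedSq k R) := ⟨fun x y => bmul x y⟩
instance : One (BraidedSq k R) := ⟨tm k 1 1⟩

theorem mul_def [VerObj k R] (x y : BraidedSq k R) : x * y = bmul x y := rfl
theorem one_def : (1 : BraidedSq k R) = tm k 1 1 := rfl

@[simp] theorem tm_mul_tm [VerObj k R] (a b c e : R) :
    tm k a b * tm k c e = tm k (a * c) (b * e) + tm k (a * dd k c) (dd k b * e) :=
  bmul_tm a b c e

protected theorem left_distrib [VerObj k R] (x y z : BraidedSq k R) :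
    x * (y + z) = x * y + x * z := map_add _ _ _
protected theorem right_distrib [VerObj k R] (x y z : BraidedSq k R) :
    (x + y) * z = x * z + y * z := by
  simp only [mul_def, map_add, LinearMap.add_apply]

protected theorem mul_assoc [VerAlg k R] (x y z : BraidedSq k R) : x * y * z = x * (y * z) := by
  induction x using ind with
  | h0 => simp [mul_def]
  | ha x x' hx hx' => simp only [BraidedSq.right_distrib, hx, hx']
  | ht a b =>
    induction y using ind with
    | h0 => simp [mul_def]
    | ha x x' hx hx' => simp only [BraidedSq.right_distrib, BraidedSq.left_distrib, hx, hx']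
    | ht c e =>
      induction z using ind with
      | h0 => simp [mul_def]
      | ha x x' hx hx' => simp only [BraidedSq.left_distrib, hx, hx']
      | ht f g =>
        simp only [tm_mul_tm, BraidedSq.right_distrib, BraidedSq.left_distrib, dd_mul, mul_add,
          add_mul, add_tm, tm_add, dd_dd, mul_zero, zero_mul, zero_tm, tm_zero, mul_assoc]
        abel

instance [VerAlg k R] : Ring (BraidedSq k R) :=
  { (inferInstance : AddCommGroup (BraidedSq k R)) with
    mul := (· * ·)
    one := 1
    left_distrib := BraidedSq.left_distrib
    right_distrib := BraidedSq.right_distrib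
    zero_mul := fun x => by simp [mul_def]
    mul_zero := fun x => by simp [mul_def]
    mul_assoc := BraidedSq.mul_assoc
    one_mul := fun x => by
      induction x using ind with
      | h0 => simp [mul_def]
      | ht x y => simp [one_def]
      | ha x y hx hy => rw [BraidedSq.left_distrib, hx, hy]
    mul_one := fun x => by
      induction x using ind with
      | h0 => simp [mul_def]
      | ht x y => simp [one_def]
      | ha x y hx hy => rw [BraidedSq.right_distrib, hx, hy] }

instance [VerAlg k R] : Algebra k (BraidedSq k R) :=
  Algebra.ofModule (fun r x y => by simp [mul_def]) (fun r x y => by simp [mul_def])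

instance [CharP k 2] [VerAlg k R] : VerAlg k (BraidedSq k R) where
  d_mul x y := by
    change dd k (x * y) = dd k x * y + x * dd k y
    induction x using ind with
    | h0 => simp
    | ha x x' hx hx' => simp only [map_add, add_mul, hx, hx']; abel
    | ht a b =>
      induction y using ind with
      | h0 => simp
      | ha x x' hx hx' => simp only [map_add, mul_add, hx, hx']; abel
      | ht c e =>
        simp only [tm_mul_tm, dd_tm, map_add, dd_mul, mul_add, add_mul, add_tm, tm_add, dd_dd,
          mul_zero, zero_mul, zero_tm, tm_zero]
        abel

instance [CharP k 2] [VerCommAlg k R] : VerCommAlg k (BraidedSq k R) where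
  mul_braid t := by
    induction t with
    | zero => simp
    | add x y hx hy => rw [map_add, map_add, map_add, hx, hy]
    | tmul x y =>
      simp only [braid_tmul, map_add, LinearMap.mul'_apply]
      induction x using ind with
      | h0 => simp
      | ha x x' hx hx' => simp only [map_add, mul_add, add_mul, ← hx, ← hx']; abel
      | ht a b =>
        induction y using ind with
        | h0 => simp
        | ha x x' hx hx' => simp only [map_add, mul_add, add_mul, ← hx, ← hx']; abel
        | ht c e =>
          have h1 : tm k (a * c) (b * e) =
              tm k (c * a + dd k c * dd k a) (e * b + dd k e * dd k b) := by
            rw [mul_comm_d k a c, mul_comm_d k b e]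
          have h2 : tm k (a * dd k c) (dd k b * e) = tm k (dd k c * a) (e * dd k b) := by
            rw [dd_central k c a, dd_central k b e]
          have h3 := add_self_zero k (tm k (c * dd k a) (dd k e * b))
          rw [tm_mul_tm a b c e, h1, h2]
          simp only [tm_mul_tm, dd_tm, mul_add, add_mul, add_tm, tm_add, dd_dd,
            mul_zero, zero_mul, zero_tm, tm_zero, add_zero]
          rw [← sub_eq_zero]
          abel_nf
          rw [← two_smul ℤ] at h3
          simpa using h3

theorem tm_add_isUnit [CharP k 2] [VerCommAlg k R] (a : Rˣ) (b c : R) :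
   IsUnit (tm k (a : R) (a : R) + tm k b (dd k c)) := by
  have hu : tm k (a : R) (a : R) = tm k (a:R) 1 * tm k 1 (a:R) := by simp
  have h1 : IsUnit (tm k (a : R) 1) :=
    ⟨⟨tm k (a : R) 1, tm k ((a⁻¹ : Rˣ) : R) 1, by simp [one_def], by simp [one_def]⟩, rfl⟩
  have h2 : IsUnit (tm k 1 (a : R)) :=
    ⟨⟨tm k 1 (a : R), tm k 1 ((a⁻¹ : Rˣ) : R), by simp [one_def], by simp [one_def]⟩, rfl⟩
  obtain ⟨U, hU⟩ := h1.mul h2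
  have hN : tm k b (dd k c) = tm k b 1 * tm k 1 (dd k c) := by simp
  have hz : tm k 1 (dd k c) = dd k (tm k 1 c) := by simp
  rw [hu, ← hU, hN, hz]
  generalize tm k 1 c = z
  generalize tm k b 1 = y
  have hc : ∀ w, dd k z * w = w * dd k z := dd_central k z
  have hs : dd k z * dd k z = 0 := dd_sq k z
  have : (U : BraidedSq k R) + y * dd k z = U * (1 + (↑U⁻¹ * y) * dd k z) := by
    rw [mul_add, mul_one, ← mul_assoc, ← mul_assoc, Units.mul_inv, one_mul]
  rw [this]
  refine U.isUnit.mul (IsNilpotent.isUnit_one_add ⟨2, ?_⟩)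
  rw [pow_two, mul_assoc, ← mul_assoc (dd k z), hc, mul_assoc _ (dd k z), hs, mul_zero, mul_zero]

end BraidedSq
end Alg

/-- The four coordinate functions on `End(P) = P ⊗ P^*`: in the basis `(1, d)` of `P` a general
element is the matrix `(A  A' ; B  A + B')`. -/
inductive Coord
  | A | B | dA | dB

section OGL

variable (k : Type u) [Field k]

/-- The generators of the free algebra: the four coordinates and (`none`) an inverse of `A`. -/
abbrev GLFree : Type u := FreeAlgebra k (Option Coord)

/-- The derivation on coordinates. -/
def Coord.diff : Coord → GLFree k
  | .A => FreeAlgebra.ι k (some .dA)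
  | .B => FreeAlgebra.ι k (some .dB)
  | .dA => 0
  | .dB => 0

/-- The relations of `𝒪(GL(P)) = Sym(2P)[A⁻¹]`: commutativity `xy = yx + y'x'` in the sense of
`Ver_4^+` between the coordinates, and invertibility of `A`. -/
inductive GLRel : GLFree k → GLFree k → Prop
  | comm (x y : Coord) : GLRel
      (FreeAlgebra.ι k (some x) * FreeAlgebra.ι k (some y))
      (FreeAlgebra.ι k (some y) * FreeAlgebra.ι k (some x) + y.diff k * x.diff k)
  | mul_inv : GLRel (FreeAlgebra.ι k (some .A) * FreeAlgebra.ι k none) 1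
  | inv_mul : GLRel (FreeAlgebra.ι k none * FreeAlgebra.ι k (some .A)) 1

/-- The coordinate algebra `𝒪(GL(P)) = k[A, A⁻¹, B, A', B']`. -/
def OGL : Type u := RingQuot (GLRel k)

namespace OGL

instance : Ring (OGL k) := inferInstanceAs (Ring (RingQuot (GLRel k)))
instance : Algebra k (OGL k) := inferInstanceAs (Algebra k (RingQuot (GLRel k)))

/-- The quotient map. -/
def mk : GLFree k →ₐ[k] OGL k := RingQuot.mkAlgHom k (GLRel k)

/-- The generators of `𝒪(GL(P))`. -/
def gen (x : Option Coord) : OGL k := mk k (FreeAlgebra.ι k x)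

/-- The derivatives of the coordinates in `𝒪(GL(P))`. -/
def dgen (x : Coord) : OGL k := mk k (x.diff k)

/-- The coordinate `A`. -/
abbrev A : OGL k := gen k (some .A)
/-- The coordinate `B`. -/
abbrev B : OGL k := gen k (some .B)
/-- The coordinate `dA`. -/
abbrev dA : OGL k := gen k (some .dA)
/-- The coordinate `dB`. -/
abbrev dB : OGL k := gen k (some .dB)
/-- The inverse of `A`. -/
abbrev Ai : OGL k := gen k none

@[simp] theorem dgen_A : dgen k .A = dA k := rfl
@[simp] theorem dgen_B : dgen k .B = dB k := rfl
@[simp] theorem dgen_dA : dgen k .dA = 0 := map_zero (mk k)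
@[simp] theorem dgen_dB : dgen k .dB = 0 := map_zero (mk k)

theorem mk_rel {x y : GLFree k} (h : GLRel k x y) : mk k x = mk k y :=
  RingQuot.mkAlgHom_rel k h

theorem gen_comm (x y : Coord) :
    gen k (some x) * gen k (some y) = gen k (some y) * gen k (some x) + dgen k y * dgen k x := by
  have h := mk_rel k (GLRel.comm (k := k) x y)
  rw [map_mul, map_add, map_mul, map_mul] at h
  exact h

@[simp] theorem A_mul_Ai : A k * Ai k = 1 := by
  have h := mk_rel k (GLRel.mul_inv (k := k))
  rw [map_mul, map_one] at h
  exact h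

@[simp] theorem Ai_mul_A : Ai k * A k = 1 := by
  have h := mk_rel k (GLRel.inv_mul (k := k))
  rw [map_mul, map_one] at h
  exact h

/-- `A` as a unit. -/
def unitA : (OGL k)ˣ := ⟨A k, Ai k, A_mul_Ai k, Ai_mul_A k⟩

theorem dgen_comm (x y : Coord) :
    dgen k x * gen k (some y) = gen k (some y) * dgen k x := by
  cases x
  · have h := gen_comm k .dA y; simpa using h
  · have h := gen_comm k .dB y; simpa using h
  · simp
  · simp

variable {k}

theorem ind {p : OGL k → Prop} (hc : ∀ c, p (algebraMap k _ c)) (hg : ∀ x, p (gen k x))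
    (hm : ∀ x y, p x → p y → p (x * y)) (ha : ∀ x y, p x → p y → p (x + y)) (x : OGL k) :
    p x := by
  obtain ⟨y, rfl⟩ := RingQuot.mkAlgHom_surjective k (GLRel k) x
  induction y using FreeAlgebra.induction with
  | grade0 r => rw [AlgHom.commutes]; exact hc r
  | grade1 x => exact hg x
  | mul a b h1 h2 => rw [map_mul]; exact hm _ _ h1 h2
  | add a b h1 h2 => rw [map_add]; exact ha _ _ h1 h2

/-- Algebra homomorphisms out of `𝒪(GL(P))`, by generators and relations. -/
def rawLift {S : Type v} [Ring S] [Algebra k S] (f : Option Coord → S) (g : Coord → S)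
    (hA : g .A = f (some .dA)) (hB : g .B = f (some .dB)) (hA' : g .dA = 0) (hB' : g .dB = 0)
    (hcomm : ∀ x y, f (some x) * f (some y) = f (some y) * f (some x) + g y * g x)
    (h1 : f (some .A) * f none = 1) (h2 : f none * f (some .A) = 1) : OGL k →ₐ[k] S :=
  RingQuot.liftAlgHom k ⟨FreeAlgebra.lift k f, by
    have hd : ∀ x : Coord, FreeAlgebra.lift k f (x.diff k) = g x := by
      intro x
      cases x <;> simp [Coord.diff, hA, hB, hA', hB']
    intro x y h
    cases h with
    | comm x y => simpa [hd] using hcomm x y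
    | mul_inv => simpa using h1
    | inv_mul => simpa using h2⟩

@[simp] theorem rawLift_gen {S : Type v} [Ring S] [Algebra k S] (f : Option Coord → S)
    (g : Coord → S) (hA hB hA' hB' hcomm h1 h2) (x : Option Coord) :
    rawLift (k := k) f g hA hB hA' hB' hcomm h1 h2 (gen k x) = f x :=
  (RingQuot.liftAlgHom_mkAlgHom_apply ..).trans (FreeAlgebra.lift_ι_apply f x)

variable (k)

theorem gen_comm_dgen (x : Coord) (y : Coord) :
    gen k (some x) * dgen k y = dgen k y * gen k (some x) := (dgen_comm k y x).symm

theorem commute_Ai {x : OGL k} (h : x * A k = A k * x) : Ai k * x = x * Ai k := by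
  calc Ai k * x = Ai k * (x * A k) * Ai k := by
        rw [mul_assoc, mul_assoc, A_mul_Ai, mul_one]
    _ = x * Ai k := by rw [h, ← mul_assoc, Ai_mul_A, one_mul]

/-- The algebra map `f ↦ f + f'ε` that encodes the derivation of `𝒪(GL(P))`. -/
def dualLift : OGL k →ₐ[k] TrivSqZeroExt (OGL k) (OGL k) :=
  rawLift
    (fun x => match x with
      | some y => .inl (gen k (some y)) + .inr (dgen k y)
      | none => .inl (Ai k) + .inr (-(Ai k * dA k * Ai k)))
    (fun y => .inl (dgen k y)) (by simp) (by simp) (by simp) (by simp)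
    (fun x y => by
      ext
      · simpa using gen_comm k x y
      · simp [gen_comm_dgen k, add_comm])
    (by
      ext
      · simp
      · simp [← mul_assoc])
    (by
      ext
      · simp
      · simp [mul_assoc])

@[simp] theorem dualLift_fst (f : OGL k) : (dualLift k f).fst = f := by
  induction f using ind with
  | hc c => rw [AlgHom.commutes]; rfl
  | hg x => cases x <;> simp [dualLift]
  | hm x y hx hy => rw [map_mul, TrivSqZeroExt.fst_mul, hx, hy]
  | ha x y hx hy => rw [map_add, TrivSqZeroExt.fst_add, hx, hy]

/-- The derivation of `𝒪(GL(P))`. -/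
def diff : OGL k →ₗ[k] OGL k where
  toFun f := (dualLift k f).snd
  map_add' x y := by simp
  map_smul' c x := by simp

theorem diff_mul (x y : OGL k) : diff k (x * y) = diff k x * y + x * diff k y := by
  simp [diff, add_comm]

theorem diff_gen (x : Coord) : diff k (gen k (some x)) = dgen k x := by
  simp [diff, dualLift]

theorem diff_Ai : diff k (Ai k) = -(Ai k * dA k * Ai k) := by
  simp [diff, dualLift]

theorem diff_algebraMap (c : k) : diff k (algebraMap k _ c) = 0 := by
  simp only [diff, LinearMap.coe_mk, AddHom.coe_mk, AlgHom.commutes]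
  rfl

theorem dA_sq : dA k * dA k = 0 := by
  have h := gen_comm k .A .A; simpa using h

theorem diff_diff [CharP k 2] (x : OGL k) : diff k (diff k x) = 0 := by
  induction x using ind with
  | hc c => rw [diff_algebraMap, map_zero]
  | hg x =>
    cases x with
    | none =>
      have h1 : dA k * Ai k = Ai k * dA k := (commute_Ai k (dgen_comm k .A .A)).symm
      have h2 : dA k * (Ai k * dA k) = 0 := by rw [← mul_assoc, h1, mul_assoc, dA_sq, mul_zero]
      have h3 : diff k (dA k) = 0 := by rw [diff_gen, dgen_dA]
      simp only [diff_Ai, map_neg, diff_mul, h3, mul_assoc, neg_mul, mul_neg, zero_mul, zero_add]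
      rw [← mul_assoc (dA k) (Ai k), ← mul_assoc (dA k * Ai k), mul_assoc (dA k) (Ai k), h2]
      simp
    | some y =>
      rw [diff_gen]
      cases y
      · rw [dgen_A, diff_gen, dgen_dA]
      · rw [dgen_B, diff_gen, dgen_dB]
      · simp
      · simp
  | hm x y hx hy =>
    simp only [diff_mul, map_add, hx, hy, zero_mul, mul_zero, add_zero, zero_add]
    exact add_self_zero k _
  | ha x y hx hy => rw [map_add, map_add, hx, hy, add_zero]

instance [CharP k 2] : VerAlg k (OGL k) where
  d := diff k
  d_d := diff_diff k
  d_mul := diff_mul k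

@[simp] theorem dd_A [CharP k 2] : dd k (A k) = dA k := diff_gen k .A
@[simp] theorem dd_B [CharP k 2] : dd k (B k) = dB k := diff_gen k .B
@[simp] theorem dd_dA [CharP k 2] : dd k (dA k) = 0 := (diff_gen k .dA).trans (dgen_dA k)
@[simp] theorem dd_dB [CharP k 2] : dd k (dB k) = 0 := (diff_gen k .dB).trans (dgen_dB k)
theorem dd_gen [CharP k 2] (x : Coord) : dd k (gen k (some x)) = dgen k x := diff_gen k x

/-- `f` commutes with everything in the sense of `Ver_4^+`. -/
def VC [CharP k 2] (f : OGL k) : Prop :=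
  ∀ g, f * g = g * f + dd k g * dd k f ∧ dd k f * g = g * dd k f

theorem VC_coord [CharP k 2] (x : Coord) : VC k (gen k (some x)) := by
  have hAi : Ai k * dgen k x = dgen k x * Ai k := commute_Ai k (dgen_comm k x .A)
  have h0 : dd k (dgen k x) = 0 := by rw [← dd_gen, dd_dd]
  intro g
  rw [dd_gen]
  induction g using ind with
  | hc c => simp [Algebra.commutes]
  | ha g g' h h' =>
    rw [map_add, mul_add, add_mul, add_mul, mul_add, add_mul, h.1, h.2, h'.1, h'.2]
    exact ⟨by abel, rfl⟩
  | hm g g' h h' =>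
    refine ⟨?_, ?_⟩
    · rw [← mul_assoc, h.1, add_mul, mul_assoc, h'.1, mul_assoc (dd k g), h'.2, dd_mul]
      noncomm_ring
    · rw [← mul_assoc, h.2, mul_assoc, h'.2, mul_assoc]
  | hg y =>
    cases y with
    | some y => exact ⟨by rw [dd_gen]; exact gen_comm k x y, dgen_comm k x y⟩
    | none =>
      refine ⟨?_, hAi.symm⟩
      have hA := gen_comm k x .A
      have h1 : dd k (Ai k) = -(Ai k * dA k * Ai k) := diff_Ai k
      calc gen k (some x) * Ai k = Ai k * (A k * gen k (some x)) * Ai k := by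
            rw [← mul_assoc, Ai_mul_A, one_mul]
        _ = Ai k * (gen k (some x) * A k - dA k * dgen k x) * Ai k := by
            rw [hA, dgen_A, add_sub_cancel_right]
        _ = Ai k * gen k (some x) + dd k (Ai k) * dgen k x := by
            rw [h1, mul_sub, sub_mul, mul_assoc (Ai k), mul_assoc (gen k (some x)), A_mul_Ai,
              mul_one, sub_eq_add_neg, neg_mul, mul_assoc (Ai k * dA k), hAi]
            simp only [mul_assoc]

theorem VC_Ai [CharP k 2] : VC k (Ai k) := by
  have hA := VC_coord k .A
  have h1 : dd k (Ai k) = -(Ai k * dA k * Ai k) := diff_Ai k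
  have key : ∀ g, dd k g = 0 → Ai k * g = g * Ai k := fun g hg => by
    apply commute_Ai
    have := (hA g).1
    rw [hg, zero_mul, add_zero] at this
    exact this.symm
  have key2 : ∀ g, dA k * g = g * dA k := fun g => by simpa using (hA g).2
  have key1 : ∀ g, Ai k * g = g * Ai k + dd k g * dd k (Ai k) := fun g => by
    have h2 := (hA g).1
    have h3 : g * Ai k = Ai k * (g * A k + dd k g * dd k (A k)) * Ai k := by
      rw [← h2, ← mul_assoc, Ai_mul_A, one_mul]
    rw [h3, h1, dd_A]
    have h4 := key (dd k g) (dd_dd k g)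
    have h5 : Ai k * (g * A k + dd k g * dA k) * Ai k =
        Ai k * g * (A k * Ai k) + (Ai k * dd k g) * dA k * Ai k := by noncomm_ring
    rw [h5, h4, A_mul_Ai, mul_one]
    noncomm_ring
  intro g
  refine ⟨key1 g, ?_⟩
  have h6 : dA k * (Ai k * dA k) = 0 := by rw [key2, mul_assoc, dA_sq, mul_zero]
  have h7 : ∀ y, dA k * (Ai k * (dA k * y)) = 0 := fun y => by
    rw [← mul_assoc (Ai k), ← mul_assoc, h6, zero_mul]
  rw [h1, neg_mul, mul_neg, neg_inj]
  calc Ai k * dA k * Ai k * g = Ai k * dA k * (g * Ai k) + Ai k * (dA k * dd k g) * dd k (Ai k) := by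
        rw [mul_assoc, key1 g, mul_add]
        noncomm_ring
    _ = Ai k * g * dA k * Ai k := by
        rw [key2 (dd k g), h1]
        simp only [mul_assoc, mul_neg, h7, mul_zero, neg_zero, add_zero]
        rw [← mul_assoc (dA k) g, key2 g, mul_assoc]
    _ = g * (Ai k * dA k * Ai k) := by
        rw [key1 g, h1]
        simp only [add_mul, mul_assoc, neg_mul, mul_neg, h7, mul_zero, neg_zero, add_zero]

instance [CharP k 2] : VerCommAlg k (OGL k) where
  mul_braid t := by
    have main : ∀ f, VC k f := by
      intro f
      induction f using ind with
      | hc c => intro g; simp [Algebra.commutes]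
      | hg x =>
        cases x with
        | none => exact VC_Ai k
        | some x => exact VC_coord k x
      | ha f f' h h' =>
        intro g
        rw [map_add, mul_add, add_mul, add_mul, mul_add, mul_add, (h g).1, (h g).2, (h' g).1,
          (h' g).2]
        exact ⟨by abel, rfl⟩
      | hm f f' h h' =>
        intro g
        have e1 := (h g).1
        have e2 := (h g).2
        have e3 := (h' g).1
        have e4 := (h' g).2
        have e5 := (h (dd k g)).1
        rw [dd_dd, zero_mul, add_zero] at e5
        have e6 := (h (dd k g)).2
        refine ⟨?_, ?_⟩
        · rw [mul_assoc, e3, mul_add, ← mul_assoc, e1, ← mul_assoc, e5, dd_mul]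
          noncomm_ring
        · rw [dd_mul, add_mul, mul_assoc, e3, mul_assoc f, e4, ← mul_assoc f, e1, mul_add,
            ← mul_assoc, e2, ← mul_assoc, e6, add_mul, mul_add]
          simp only [mul_assoc]
          have := add_self_zero k (dd k g * (dd k f * dd k f'))
          rw [add_add_add_comm, this, add_zero]
    induction t with
    | zero => simp
    | add x y hx hy => rw [map_add, map_add, map_add, hx, hy]
    | tmul x y => simpa using (main x y).1.symm

end OGL
end OGL

/-- The unit object is a commutative algebra. -/
instance unitAlg (k : Type u) [Field k] : VerCommAlg k k where
  d_mul x y := by simp [VerObj.d]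
  mul_braid t := by
    induction t with
    | zero => simp
    | add x y hx hy => rw [map_add, map_add, map_add, hx, hy]
    | tmul x y => simp [dd, VerObj.d, mul_comm]

@[simp] theorem dd_unit (k : Type u) [Field k] (c : k) : dd k c = 0 := rfl

section GLP

variable (k : Type u) [Field k] [CharP k 2]

namespace OGL

section Lift

variable {k} {R : Type v} [Ring R] [Algebra k R] [VerCommAlg k R]

/-- The homomorphism `𝒪(GL(P)) → R` of commutative algebras in `Ind(Ver_4^+)` with `A ↦ a` and
`B ↦ b`, where `a` is invertible. -/
def lift (a : Rˣ) (b : R) : OGL k →ₐ[k] R :=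
  rawLift
    (fun x => match x with
      | some .A => (a : R)
      | some .B => b
      | some .dA => dd k (a : R)
      | some .dB => dd k b
      | none => ((a⁻¹ : Rˣ) : R))
    (fun x => match x with
      | .A => dd k (a : R)
      | .B => dd k b
      | .dA => 0
      | .dB => 0)
    rfl rfl rfl rfl
    (fun x y => by
      cases x <;> cases y <;> 
        first
        | exact mul_comm_d k _ _
        | exact (mul_comm_d k _ _).trans (by simp))
    (by simp) (by simp)

@[simp] theorem lift_A (a : Rˣ) (b : R) : lift a b (A k) = a := rawLift_gen ..
@[simp] theorem lift_B (a : Rˣ) (b : R) : lift a b (B k) = b := rawLift_gen ..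
@[simp] theorem lift_dA (a : Rˣ) (b : R) : lift a b (dA k) = dd k (a : R) := rawLift_gen ..
@[simp] theorem lift_dB (a : Rˣ) (b : R) : lift a b (dB k) = dd k b := rawLift_gen ..

theorem hom_dd (φ : OGL k →ₐ[k] R) (hA : φ (dA k) = dd k (φ (A k)))
    (hB : φ (dB k) = dd k (φ (B k))) (f : OGL k) : φ (dd k f) = dd k (φ f) := by
  have hA0 : dd k (φ (dA k)) = 0 := by rw [hA, dd_dd]
  have hB0 : dd k (φ (dB k)) = 0 := by rw [hB, dd_dd]
  induction f using ind with
  | hc c => simp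
  | ha x y hx hy => simp only [map_add, hx, hy]
  | hm x y hx hy => simp only [dd_mul, map_add, map_mul, hx, hy]
  | hg x =>
    cases x with
    | some x =>
      cases x
      · simpa using hA
      · simpa using hB
      · simpa using hA0.symm
      · simpa using hB0.symm
    | none =>
      have h1 : φ (A k) * φ (Ai k) = 1 := by rw [← map_mul, A_mul_Ai, map_one]
      have h2 : φ (Ai k) * φ (A k) = 1 := by rw [← map_mul, Ai_mul_A, map_one]
      have h3 := congrArg (dd k) h1
      rw [dd_mul, dd_one] at h3
      have h4 : dd k (Ai k) = -(Ai k * dA k * Ai k) := diff_Ai k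
      have h5 : dd k (φ (Ai k)) = φ (Ai k) * (φ (A k) * dd k (φ (Ai k))) := by
        rw [← mul_assoc, h2, one_mul]
      rw [h4, h5, eq_neg_of_add_eq_zero_right h3, map_neg, map_mul, map_mul, hA, mul_neg, mul_assoc]

theorem hom_ext {S : Type v} [Ring S] [Algebra k S] {φ ψ : OGL k →ₐ[k] S}
    (h : ∀ x : Coord, φ (gen k (some x)) = ψ (gen k (some x))) : φ = ψ := by
  ext f
  induction f using ind with
  | hc c => simp
  | ha x y hx hy => simp only [map_add, hx, hy]
  | hm x y hx hy => simp only [map_mul, hx, hy]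
  | hg x =>
    cases x with
    | some x => exact h x
    | none =>
      have h1 : φ (Ai k) * φ (A k) = 1 := by rw [← map_mul, Ai_mul_A, map_one]
      have h2 : ψ (A k) * ψ (Ai k) = 1 := by rw [← map_mul, A_mul_Ai, map_one]
      rw [← h] at h2
      exact left_inv_eq_right_inv h1 h2

/-- The universal property of `𝒪(GL(P))`: morphisms to a commutative algebra `R` are the same as
elements `(a  a' ; b  a + b')` of `End(P) ⊗ R` with `a` invertible. -/
theorem existsUnique_hom (a : Rˣ) (b : R) :
    ∃! φ : OGL k →ₐ[k] R, (∀ f, φ (dd k f) = dd k (φ f)) ∧ φ (A k) = a ∧ φ (B k) = b := by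
  refine ⟨lift a b, ⟨hom_dd _ (by simp) (by simp), by simp, by simp⟩, ?_⟩
  rintro φ ⟨h, h1, h2⟩
  apply hom_ext
  intro x
  cases x
  · rw [h1, lift_A]
  · rw [h2, lift_B]
  · rw [lift_dA, ← h1, ← h, dd_A]
  · rw [lift_dB, ← h2, ← h, dd_B]

end Lift

/-- The counit: evaluation at the identity matrix. -/
def counit : OGL k →ₐ[k] k := lift 1 0

/-- The comultiplication, as a homomorphism to the braided tensor square: it is determined by
`A ↦ A ⊗ A + B ⊗ A'` and `B ↦ A ⊗ B + B ⊗ (A + B')`. -/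
noncomputable def comulHom : OGL k →ₐ[k] BraidedSq k (OGL k) :=
  lift (BraidedSq.tm_add_isUnit (unitA k) (B k) (A k)).unit
    (BraidedSq.tm k (A k) (B k) + BraidedSq.tm k (B k) (A k + dB k))

/-- The comultiplication of `𝒪(GL(P))`. -/
noncomputable def comul : OGL k →ₗ[k] OGL k ⊗[k] OGL k := (comulHom k).toLinearMap

@[simp] theorem counit_A : counit k (A k) = 1 := by simp [counit]
@[simp] theorem counit_B : counit k (B k) = 0 := by simp [counit]
@[simp] theorem counit_dd (f : OGL k) : counit k (dd k f) = 0 := by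
  rw [counit, hom_dd _ (by simp) (by simp), dd_unit]
@[simp] theorem counit_dA : counit k (dA k) = 0 := by rw [← dd_A, counit_dd]
@[simp] theorem counit_dB : counit k (dB k) = 0 := by rw [← dd_B, counit_dd]
@[simp] theorem counit_Ai : counit k (Ai k) = 1 := by
  have h : counit k (A k * Ai k) = 1 := by rw [A_mul_Ai, map_one]
  rwa [map_mul, counit_A, one_mul] at h

@[simp] theorem comulHom_A : comulHom k (A k) =
    BraidedSq.tm k (A k) (A k) + BraidedSq.tm k (B k) (dA k) := by
  rw [comulHom, lift_A, IsUnit.unit_spec, dd_A]; rfl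

@[simp] theorem comulHom_B : comulHom k (B k) =
    BraidedSq.tm k (A k) (B k) + BraidedSq.tm k (B k) (A k + dB k) := by
  rw [comulHom, lift_B]

theorem comulHom_dd (f : OGL k) : comulHom k (dd k f) = dd k (comulHom k f) :=
  hom_dd _ (by simp [comulHom]) (by simp [comulHom]) f

@[simp] theorem comulHom_dA : comulHom k (dA k) = BraidedSq.tm k (dA k) (A k) +
    BraidedSq.tm k (A k) (dA k) + BraidedSq.tm k (dB k) (dA k) := by
  rw [← dd_A, comulHom_dd, comulHom_A]
  simp

@[simp] theorem comulHom_dB : comulHom k (dB k) = BraidedSq.tm k (dA k) (B k) +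
    BraidedSq.tm k (A k) (dB k) + BraidedSq.tm k (dB k) (A k + dB k) +
      BraidedSq.tm k (B k) (dA k) := by
  rw [← dd_B, comulHom_dd, comulHom_B]
  simp [add_assoc]

theorem dd_comul (f : OGL k) : comul k (dd k f) = dd k (comul k f) := comulHom_dd k f

end OGL

/-- A representation of `GL(P)` in `Ver_4^+`: a finite-dimensional (left) comodule over
`𝒪(GL(P))`. -/
structure GLRep where
  carrier : Type u
  [addCommGroup : AddCommGroup carrier]
  [module : Module k carrier]
  [finite : FiniteDimensional k carrier]
  [verObj : VerObj k carrier]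
  coact : carrier →ₗ[k] OGL k ⊗[k] carrier
  coact_d : ∀ v, coact (dd k v) = dd k (coact v)
  counit_coact : ∀ v,
    TensorProduct.lid k carrier ((OGL.counit k).toLinearMap.rTensor carrier (coact v)) = v
  coassoc : ∀ v,
    TensorProduct.assoc k (OGL k) (OGL k) carrier ((OGL.comul k).rTensor carrier (coact v)) =
      coact.lTensor (OGL k) (coact v)

namespace GLRep

attribute [instance] addCommGroup module finite verObj

variable {k}

/-- A subobject of `V` is a `d`-stable subspace; it is a subrepresentation if the coaction maps it
to `𝒪(GL(P)) ⊗ W`. -/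
def IsSub (V : GLRep k) (W : Submodule k V.carrier) : Prop :=
  (∀ x ∈ W, dd k x ∈ W) ∧
    ∀ x ∈ W, V.coact x ∈ LinearMap.range (W.subtype.lTensor (OGL k))

/-- An irreducible representation. -/
def Irreducible (V : GLRep k) : Prop :=
  Nontrivial V.carrier ∧ ∀ W : Submodule k V.carrier, V.IsSub W → W = ⊥ ∨ W = ⊤

/-- Isomorphism of representations. -/
def Iso (V W : GLRep k) : Prop :=
  ∃ e : V.carrier ≃ₗ[k] W.carrier, (∀ x, e (dd k x) = dd k (e x)) ∧
    ∀ x, W.coact (e x) = e.toLinearMap.lTensor (OGL k) (V.coact x)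

end GLRep

section Tensor

variable {X : Type v} {Y : Type w} [AddCommGroup X] [Module k X] [VerObj k X] [AddCommGroup Y]
  [Module k Y] [VerObj k Y]

/-- The map `𝒪 ⊗ X ⊗ 𝒪 ⊗ Y → 𝒪 ⊗ 𝒪 ⊗ X ⊗ Y → 𝒪 ⊗ X ⊗ Y`, first the commutativity constraint
of the two middle factors and then the multiplication of `𝒪 = 𝒪(GL(P))`. -/
def coMul : (OGL k ⊗[k] X) ⊗[k] (OGL k ⊗[k] Y) →ₗ[k] OGL k ⊗[k] (X ⊗[k] Y) :=
  (LinearMap.mul' k (OGL k)).rTensor (X ⊗[k] Y) ∘ₗ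
  (TensorProduct.assoc k (OGL k) (OGL k) (X ⊗[k] Y)).symm.toLinearMap ∘ₗ
  ((TensorProduct.assoc k (OGL k) X Y).toLinearMap ∘ₗ (braid k).rTensor Y ∘ₗ
    (TensorProduct.assoc k X (OGL k) Y).symm.toLinearMap).lTensor (OGL k) ∘ₗ
  (TensorProduct.assoc k (OGL k) X (OGL k ⊗[k] Y)).toLinearMap

@[simp] theorem coMul_tmul (f g : OGL k) (x : X) (y : Y) :
    coMul k ((f ⊗ₜ[k] x) ⊗ₜ[k] (g ⊗ₜ[k] y)) =
      (f * g) ⊗ₜ (x ⊗ₜ y) + (f * dd k g) ⊗ₜ (dd k x ⊗ₜ y) := by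
  simp [coMul, TensorProduct.add_tmul, TensorProduct.tmul_add]

theorem coMul_dd (t : (OGL k ⊗[k] X) ⊗[k] (OGL k ⊗[k] Y)) :
    coMul k (dd k t) = dd k (coMul k t) := by
  induction t with
  | zero => simp
  | add x y hx hy => simp only [map_add, hx, hy]
  | tmul p q =>
    induction p with
    | zero => simp
    | add x y hx hy =>
      simp only [TensorProduct.add_tmul, map_add] at hx hy ⊢
      rw [hx, hy]
    | tmul f x =>
      induction q with
      | zero => simp
      | add x y hx hy =>
        simp only [TensorProduct.tmul_add, map_add] at hx hy ⊢
        rw [hx, hy]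
      | tmul g y =>
        simp only [dd_tmul, coMul_tmul, map_add, TensorProduct.tmul_add, TensorProduct.add_tmul,
          dd_mul, dd_dd, mul_zero, zero_mul, TensorProduct.zero_tmul, TensorProduct.tmul_zero]
        abel

theorem coMul_counit (p : OGL k ⊗[k] X) (q : OGL k ⊗[k] Y) :
    TensorProduct.lid k _ ((OGL.counit k).toLinearMap.rTensor _ (coMul k (p ⊗ₜ q))) =
      (TensorProduct.lid k _ ((OGL.counit k).toLinearMap.rTensor _ p)) ⊗ₜ
        (TensorProduct.lid k _ ((OGL.counit k).toLinearMap.rTensor _ q)) := by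
  induction p with
  | zero => simp
  | add x y hx hy => simp only [TensorProduct.add_tmul, map_add, hx, hy]
  | tmul f x =>
    induction q with
    | zero => simp
    | add x y hx hy => simp only [TensorProduct.tmul_add, map_add, hx, hy]
    | tmul g y =>
      simp [mul_smul, TensorProduct.smul_tmul', smul_comm (OGL.counit k g)]

theorem coMul_assoc_aux (s t : BraidedSq k (OGL k)) (x : X) (y : Y) :
    TensorProduct.assoc k (OGL k) (OGL k) (X ⊗[k] Y)
      (BraidedSq.toTensor (s * t) ⊗ₜ (x ⊗ₜ y) + BraidedSq.toTensor (s * dd k t) ⊗ₜ (dd k x ⊗ₜ y)) =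
    (coMul k).lTensor (OGL k) (coMul k
      (TensorProduct.assoc k (OGL k) (OGL k) X (BraidedSq.toTensor s ⊗ₜ x) ⊗ₜ
       TensorProduct.assoc k (OGL k) (OGL k) Y (BraidedSq.toTensor t ⊗ₜ y))) := by
  induction s using BraidedSq.ind with
  | h0 => simp
  | ha s s' h h' =>
    simp only [add_mul, map_add, TensorProduct.add_tmul] at h h' ⊢
    rw [← h, ← h']
    abel
  | ht a b =>
    induction t using BraidedSq.ind with
    | h0 => simp
    | ha s s' h h' =>
      simp only [mul_add, map_add, TensorProduct.add_tmul, TensorProduct.tmul_add] at h h' ⊢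
      rw [← h, ← h']
      abel
    | ht c e =>
      simp only [BraidedSq.tm_mul_tm, BraidedSq.dd_tm, mul_add, map_add, BraidedSq.toTensor_tm,
        TensorProduct.add_tmul, TensorProduct.assoc_tmul, coMul_tmul, dd_tmul,
        LinearMap.lTensor_tmul, TensorProduct.tmul_add, dd_dd, mul_zero,
        TensorProduct.zero_tmul, TensorProduct.tmul_zero, add_zero, zero_add]
      abel

theorem coMul_comul (p : OGL k ⊗[k] X) (q : OGL k ⊗[k] Y) :
    TensorProduct.assoc k (OGL k) (OGL k) (X ⊗[k] Y)
      ((OGL.comul k).rTensor _ (coMul k (p ⊗ₜ q))) =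
    (coMul k).lTensor (OGL k) (coMul k
      (TensorProduct.assoc k (OGL k) (OGL k) X ((OGL.comul k).rTensor _ p) ⊗ₜ
       TensorProduct.assoc k (OGL k) (OGL k) Y ((OGL.comul k).rTensor _ q))) := by
  induction p with
  | zero => simp
  | add x y hx hy => simp only [TensorProduct.add_tmul, map_add, hx, hy]
  | tmul f x =>
    induction q with
    | zero => simp
    | add x y hx hy => simp only [TensorProduct.tmul_add, map_add, hx, hy]
    | tmul g y =>
      have h := coMul_assoc_aux k (OGL.comulHom k f) (OGL.comulHom k g) x y
      rw [← OGL.comulHom_dd, ← map_mul, ← map_mul, map_add] at h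
      rw [coMul_tmul, map_add, LinearMap.rTensor_tmul, LinearMap.rTensor_tmul]
      exact h

end Tensor

/-- The tensor product of representations. -/
noncomputable def GLRep.tensor {k : Type u} [Field k] [CharP k 2] (V W : GLRep k) : GLRep k where
  carrier := V.carrier ⊗[k] W.carrier
  coact := coMul k ∘ₗ TensorProduct.map V.coact W.coact
  coact_d t := by
    rw [LinearMap.comp_apply, LinearMap.comp_apply, ← coMul_dd]
    congr 1
    induction t with
    | zero => simp
    | add x y hx hy => simp only [map_add, hx, hy]
    | tmul x y => simp [V.coact_d, W.coact_d]
  counit_coact t := by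
    induction t with
    | zero => simp
    | add x y hx hy => simp only [map_add, hx, hy]
    | tmul x y =>
      rw [LinearMap.comp_apply, TensorProduct.map_tmul, coMul_counit, V.counit_coact,
        W.counit_coact]
  coassoc t := by
    have h : ∀ p q, (coMul k ∘ₗ TensorProduct.map V.coact W.coact).lTensor (OGL k)
        (coMul k (p ⊗ₜ q)) = (coMul k).lTensor (OGL k) (coMul k
          ((V.coact.lTensor (OGL k) p) ⊗ₜ (W.coact.lTensor (OGL k) q))) := by
      intro p q
      induction p with
      | zero => simp
      | add x y hx hy => simp only [TensorProduct.add_tmul, map_add, hx, hy]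
      | tmul f x =>
        induction q with
        | zero => simp
        | add x y hx hy => simp only [TensorProduct.tmul_add, map_add, hx, hy]
        | tmul g y => simp [V.coact_d]
    induction t with
    | zero => simp
    | add x y hx hy => simp only [map_add, hx, hy]
    | tmul x y =>
      rw [LinearMap.comp_apply, TensorProduct.map_tmul, coMul_comul, h, V.coassoc, W.coassoc]

end GLP

section GLP
variable (k : Type u) [Field k] [CharP k 2]

namespace GLRep

variable {k}

/-- The coaction `e_j ↦ ∑ i, C i j ⊗ e_i`. -/
noncomputable def matrixCoact {n : ℕ} (C : Matrix (Fin n) (Fin n) (OGL k)) :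
    (Fin n → k) →ₗ[k] OGL k ⊗[k] (Fin n → k) :=
  (Pi.basisFun k (Fin n)).constr k (fun j => ∑ i, C i j ⊗ₜ[k] (Pi.single i 1 : Fin n → k))

@[simp] theorem matrixCoact_single {n : ℕ} (C : Matrix (Fin n) (Fin n) (OGL k)) (j : Fin n) :
    matrixCoact C (Pi.single j 1) = ∑ i, C i j ⊗ₜ[k] (Pi.single i 1 : Fin n → k) := by
  rw [matrixCoact, ← Pi.basisFun_apply, Module.Basis.constr_basis]

theorem pi_hom_ext {n : ℕ} {M : Type v} [AddCommGroup M] [Module k M]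
    {f g : (Fin n → k) →ₗ[k] M} (h : ∀ j, f (Pi.single j 1) = g (Pi.single j 1)) (x : Fin n → k) :
    f x = g x := by
  have : f = g := (Pi.basisFun k (Fin n)).ext (fun j => by simpa using h j)
  rw [this]

/-- The object `kⁿ` of `Ver_4^+`, with `d` given by a matrix. -/
abbrev matrixObj {n : ℕ} (D : Matrix (Fin n) (Fin n) k) (hD : D * D = 0) :
    VerObj k (Fin n → k) where
  d := D.mulVecLin
  d_d x := by simp [Matrix.mulVec_mulVec, hD]

/-- The representation on `kⁿ`, with `d` given by the matrix `D`, and with matrix coefficients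
`C`: the coaction is `e_j ↦ ∑ i, C i j ⊗ e_i`. -/
noncomputable def ofMatrix {n : ℕ} (D : Matrix (Fin n) (Fin n) k)
    (C : Matrix (Fin n) (Fin n) (OGL k)) (hD : D * D = 0)
    (hd : ∀ i j, ∑ l, D l j • C i l = dd k (C i j) + ∑ l, D i l • C l j)
    (hc : ∀ i j, OGL.counit k (C i j) = if i = j then 1 else 0)
    (hΔ : ∀ i j, OGL.comulHom k (C i j) = ∑ l, BraidedSq.tm k (C l j) (C i l)) : GLRep k :=
  letI := matrixObj D hD
  have hds : ∀ j : Fin n, dd k (Pi.single j 1 : Fin n → k) = ∑ l, D l j • Pi.single l 1 := by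
    intro j
    ext i
    rw [Finset.sum_apply]
    simp only [Pi.smul_apply, Pi.single_apply, smul_eq_mul, mul_ite, mul_one, mul_zero,
      Finset.sum_ite_eq, Finset.mem_univ, if_true]
    exact congrFun (Matrix.mulVec_single_one D j) i
  { carrier := Fin n → k
    coact := matrixCoact C
    coact_d := by
      refine fun v => pi_hom_ext (f := matrixCoact C ∘ₗ dd k) (g := dd k ∘ₗ matrixCoact C) ?_ v
      intro j
      simp only [LinearMap.comp_apply, hds, map_sum, map_smul, matrixCoact_single, dd_tmul,
        TensorProduct.tmul_sum, Finset.smul_sum, TensorProduct.tmul_smul]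
      rw [Finset.sum_comm, Finset.sum_add_distrib]
      conv_rhs => rw [add_comm, Finset.sum_comm, add_comm]
      rw [← Finset.sum_add_distrib]
      refine Finset.sum_congr rfl fun i _ => ?_
      simp only [TensorProduct.smul_tmul', ← TensorProduct.sum_tmul, ← TensorProduct.add_tmul, hd]
    counit_coact := by
      refine fun v => pi_hom_ext (f := (TensorProduct.lid k (Fin n → k)).toLinearMap ∘ₗ
        (OGL.counit k).toLinearMap.rTensor (Fin n → k) ∘ₗ matrixCoact C) (g := LinearMap.id) ?_ v
      intro j
      simp [hc]
    coassoc := by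
      refine fun v => pi_hom_ext (f := (TensorProduct.assoc k _ _ (Fin n → k)).toLinearMap ∘ₗ
        (OGL.comul k).rTensor (Fin n → k) ∘ₗ matrixCoact C)
        (g := (matrixCoact C).lTensor (OGL k) ∘ₗ matrixCoact C) ?_ v
      intro j
      have h : ∀ i, OGL.comul k (C i j) = ∑ l, C l j ⊗ₜ[k] C i l := fun i => hΔ i j
      simp only [LinearMap.comp_apply, matrixCoact_single, map_sum, LinearMap.rTensor_tmul, h,
        TensorProduct.sum_tmul, LinearMap.lTensor_tmul, TensorProduct.tmul_sum,
        LinearEquiv.coe_coe, TensorProduct.assoc_tmul]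
      exact Finset.sum_comm }

end GLRep

section Reps

open OGL

/-- The matrix of `d` on `P = k[d]/d²` in the basis `(1, d)`. -/
def dP : Matrix (Fin 2) (Fin 2) k := !![0, 0; 1, 0]

theorem dP_sq : dP k * dP k = 0 := by
  ext i j; fin_cases i <;> fin_cases j <;> simp [dP]

theorem r1 : dA k * A k = A k * dA k := by simpa using dd_central k (A k) (A k)
theorem r1' (x : OGL k) : dA k * (A k * x) = A k * (dA k * x) := by
  rw [← mul_assoc, r1, mul_assoc]
theorem r2 : dA k * B k = B k * dA k := by simpa using dd_central k (A k) (B k)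
theorem r2' (x : OGL k) : dA k * (B k * x) = B k * (dA k * x) := by
  rw [← mul_assoc, r2, mul_assoc]
theorem r3 : dB k * A k = A k * dB k := by simpa using dd_central k (B k) (A k)
theorem r3' (x : OGL k) : dB k * (A k * x) = A k * (dB k * x) := by
  rw [← mul_assoc, r3, mul_assoc]
theorem r4 : dB k * B k = B k * dB k := by simpa using dd_central k (B k) (B k)
theorem r4' (x : OGL k) : dB k * (B k * x) = B k * (dB k * x) := by
  rw [← mul_assoc, r4, mul_assoc]
theorem r5 : dB k * dA k = dA k * dB k := by simpa using dd_central k (B k) (dA k)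
theorem r5' (x : OGL k) : dB k * (dA k * x) = dA k * (dB k * x) := by
  rw [← mul_assoc, r5, mul_assoc]
theorem r6 : dA k * dA k = 0 := by simpa using dd_sq k (A k)
theorem r6' (x : OGL k) : dA k * (dA k * x) = 0 := by
  rw [← mul_assoc, r6, zero_mul]
theorem r7 : dB k * dB k = 0 := by simpa using dd_sq k (B k)
theorem r7' (x : OGL k) : dB k * (dB k * x) = 0 := by
  rw [← mul_assoc, r7, zero_mul]
theorem r8 : B k * A k = A k * B k + dA k * dB k := by simpa using mul_comm_d k (B k) (A k)
theorem r8' (x : OGL k) : B k * (A k * x) = A k * (B k * x) + dA k * (dB k * x) := by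
  rw [← mul_assoc, r8, add_mul, mul_assoc, mul_assoc]

/-- The tautological representation `T_1 = P`. -/
noncomputable def T1 : GLRep k :=
  .ofMatrix (dP k) !![A k, dA k; B k, A k + dB k] (dP_sq k)
    (by
      intro i j
      fin_cases i <;> fin_cases j <;> simp [dP, add_self_zero k, add_comm])
    (by
      intro i j
      fin_cases i <;> fin_cases j <;> simp)
    (by
      intro i j
      fin_cases i <;> fin_cases j <;> simp [BraidedSq.tm_add, BraidedSq.add_tm]
      all_goals
        refine (one_smul k _).symm.trans (Eq.trans ?_ (one_smul k _))
        match_scalars <;> simp only [mul_one, mul_zero, CharTwo.add_self_eq_zero, add_zero, zero_add])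

/-- The representation `T_2`, on the object `2 · 𝟙`. -/
noncomputable def T2 : GLRep k :=
  .ofMatrix 0 !![A k ^ 2, A k * dA k;
      A k * dA k + dA k * dB k, A k ^ 2 + A k * dB k + B k * dA k] (by simp)
    (by
      intro i j
      fin_cases i <;> fin_cases j <;>
        simp [pow_two, dd_mul, r1, r2, r3, r4, r5, r6, r7, add_self_zero k])
    (by
      intro i j
      fin_cases i <;> fin_cases j <;> simp)
    (by
      intro i j
      fin_cases i <;> fin_cases j <;> simp [pow_two, dd_mul, BraidedSq.tm_add, BraidedSq.add_tm,
        mul_add, add_mul, mul_assoc, r1, r2, r3, r4, r5, r6, r7, r8, r1', r2', r3', r4', r5', r6',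
        r7', r8', -map_mul, map_mul (comulHom k)]
      all_goals
        refine (one_smul k _).symm.trans (Eq.trans ?_ (one_smul k _))
        match_scalars <;> simp only [mul_one, mul_zero, CharTwo.add_self_eq_zero, add_zero, zero_add])

/-- The representation `T_3`, on the object `P`. -/
noncomputable def T3 : GLRep k :=
  .ofMatrix (dP k) !![A k ^ 3, A k ^ 2 * dA k;
      A k ^ 2 * B k + A k * dA k * dB k + A k ^ 2 * dA k, A k ^ 3 + A k ^ 2 * dB k] (dP_sq k)
    (by
      intro i j
      fin_cases i <;> fin_cases j <;>
        simp [dP, pow_succ, dd_mul, mul_add, add_mul, mul_assoc, r1, r2, r3, r4, r5, r6, r7, r8, r1', r2', r3', r4', r5', r6', add_self_zero k]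
      all_goals
        refine (one_smul k _).symm.trans (Eq.trans ?_ (one_smul k _))
        match_scalars <;> simp only [mul_one, mul_zero, CharTwo.add_self_eq_zero, add_zero, zero_add])
    (by
      intro i j
      fin_cases i <;> fin_cases j <;> simp)
    (by
      intro i j
      fin_cases i <;> fin_cases j <;> simp [pow_succ, dd_mul, BraidedSq.tm_add, BraidedSq.add_tm,
        mul_add, add_mul, mul_assoc, r1, r2, r3, r4, r5, r6, r7, r8, r1', r2', r3', r4', r5', r6',
        r7', r8', -map_mul, map_mul (comulHom k)]
      all_goals
        refine (one_smul k _).symm.trans (Eq.trans ?_ (one_smul k _))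
        match_scalars <;> simp only [mul_one, mul_zero, CharTwo.add_self_eq_zero, add_zero, zero_add])

/-- The one-dimensional representation `v ↦ g ⊗ v` given by a `d`-invariant group-like element. -/
noncomputable def charRep (g : OGL k) (hd : dd k g = 0) (hc : counit k g = 1)
    (hΔ : comulHom k g = BraidedSq.tm k g g) : GLRep k :=
  .ofMatrix (n := 1) 0 (fun _ _ => g) (by simp) (by simp [hd])
    (fun i j => by rw [hc, if_pos (Subsingleton.elim i j)]) (by simp [hΔ])

/-- The invertible `d`-invariant group-like elements of `𝒪(GL(P))`. -/
def groupLike : Subgroup (OGL k)ˣ where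
  carrier := {g | dd k (g : OGL k) = 0 ∧ counit k (g : OGL k) = 1 ∧
    comulHom k (g : OGL k) = BraidedSq.tm k (g : OGL k) (g : OGL k)}
  one_mem' := by simp [BraidedSq.one_def]
  mul_mem' := by
    rintro g h ⟨g1, g2, g3⟩ ⟨h1, h2, h3⟩
    refine ⟨?_, ?_, ?_⟩
    · rw [Units.val_mul, dd_mul, g1, h1, zero_mul, mul_zero, add_zero]
    · rw [Units.val_mul, map_mul, g2, h2, one_mul]
    · rw [Units.val_mul, map_mul, g3, h3, BraidedSq.tm_mul_tm, h1]
      simp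
  inv_mem' := by
    rintro g ⟨g1, g2, g3⟩
    have hd : dd k ((g⁻¹ : (OGL k)ˣ) : OGL k) = 0 := by
      have h := congrArg (dd k) g.inv_mul
      rw [dd_mul, g1, mul_zero, add_zero, dd_one] at h
      simpa using congrArg (· * ((g⁻¹ : (OGL k)ˣ) : OGL k)) h
    refine ⟨hd, ?_, ?_⟩
    · have h := congrArg (counit k) g.inv_mul
      rwa [map_mul, g2, mul_one, map_one] at h
    · have h1 : comulHom k ((g⁻¹ : (OGL k)ˣ) : OGL k) * comulHom k (g : OGL k) = 1 := by
        rw [← map_mul, g.inv_mul, map_one]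
      have h2 : comulHom k (g : OGL k) *
          BraidedSq.tm k ((g⁻¹ : (OGL k)ˣ) : OGL k) ((g⁻¹ : (OGL k)ˣ) : OGL k) = 1 := by
        rw [g3, BraidedSq.tm_mul_tm, hd]
        simp [BraidedSq.one_def]
      exact left_inv_eq_right_inv h1 h2

theorem A_four_mem : unitA k ^ 4 ∈ groupLike k := by
  have h : ((unitA k ^ 4 : (OGL k)ˣ) : OGL k) = A k ^ 4 := rfl
  refine ⟨?_, ?_, ?_⟩
  · rw [h]
    simp only [pow_succ, pow_zero, one_mul, dd_mul, dd_A, mul_add, add_mul, mul_assoc, r1, r1']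
    refine (one_smul k _).symm.trans (Eq.trans ?_ (one_smul k _))
    match_scalars <;> simp only [mul_one, mul_zero, CharTwo.add_self_eq_zero, add_zero, zero_add]
  · rw [h]; simp
  · rw [h]
    simp [pow_succ, dd_mul, BraidedSq.tm_add, BraidedSq.add_tm,
        mul_add, add_mul, mul_assoc, r1, r2, r3, r4, r5, r6, r7, r8, r1', r2', r3', r4', r5', r6',
        r7', r8', -map_mul, map_mul (comulHom k)]
    refine (one_smul k _).symm.trans (Eq.trans ?_ (one_smul k _))
    match_scalars <;> simp only [mul_one, mul_zero, CharTwo.add_self_eq_zero, add_zero, zero_add]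

/-- The tensor powers `χⁿ`, `n ∈ ℤ`, of the character `χ = A⁴`. -/
noncomputable def chi (n : ℤ) : GLRep k :=
  have h := (groupLike k).zpow_mem (A_four_mem k) n
  charRep k (((unitA k ^ 4) ^ n : (OGL k)ˣ) : OGL k) h.1 h.2.1 h.2.2

/-- The character `ξ = A⁴ + A³B' + A²BA'`. -/
noncomputable def xi : GLRep k :=
  charRep k (A k ^ 4 + A k ^ 3 * dB k + A k ^ 2 * B k * dA k)
    (by
      simp only [map_add, pow_succ, pow_zero, one_mul, dd_mul, dd_A, dd_B, dd_dA, dd_dB, mul_add,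
        add_mul, mul_assoc, r1, r2, r3, r4, r5, r6, r7, r8, r1', r2', r3', r4', r5', r6', r7', r8',
        mul_zero, add_zero, zero_mul]
      refine (one_smul k _).symm.trans (Eq.trans ?_ (one_smul k _))
      match_scalars <;> simp only [mul_one, mul_zero, CharTwo.add_self_eq_zero, add_zero, zero_add])
    (by simp)
    (by
      simp [pow_succ, dd_mul, BraidedSq.tm_add, BraidedSq.add_tm,
        mul_add, add_mul, mul_assoc, r1, r2, r3, r4, r5, r6, r7, r8, r1', r2', r3', r4', r5', r6',
        r7', r8', -map_mul, map_mul (comulHom k)]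
      refine (one_smul k _).symm.trans (Eq.trans ?_ (one_smul k _))
      match_scalars <;> simp only [mul_one, mul_zero, CharTwo.add_self_eq_zero, add_zero, zero_add])

end Reps

end GLP

section GLP
variable (k : Type u) [Field k] [CharP k 2]

/-- `gl(P) = P ⊗ P^* = End(P)`, as matrices in the basis `(1, d)` of `P`. -/
abbrev GlP : Type u := Matrix (Fin 2) (Fin 2) k

/-- The `d`-action on `gl(P)` is the commutator with the endomorphism `d` of `P`. -/
instance glObj : VerObj k (GlP k) where
  d := LinearMap.mulLeft k (dP k) + LinearMap.mulRight k (dP k)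
  d_d X := by
    simp only [LinearMap.add_apply, LinearMap.mulLeft_apply, LinearMap.mulRight_apply, mul_add,
      add_mul, ← mul_assoc, dP_sq, zero_mul, zero_add]
    rw [mul_assoc _ (dP k), dP_sq, mul_zero, add_zero]
    exact add_self_zero k _

theorem dd_gl (X : GlP k) : dd k X = dP k * X + X * dP k := rfl

theorem dd_gl_mk (p q r s : k) : dd k (!![p, q; r, s] : GlP k) = !![q, 0; p + s, q] := by
  rw [dd_gl, dP, Matrix.mul_fin_two, Matrix.mul_fin_two]
  ext i j; fin_cases i <;> fin_cases j <;> simp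

/-- The bracket `μ ∘ (1 - c)` of `gl(P)`, where `μ` is composition and `c` is the commutativity
constraint: `[X, Y] = XY - YX - Y'X'`. -/
def glBracket (X Y : GlP k) : GlP k := X * Y - Y * X - dd k Y * dd k X

/-- A representation of `gl(P)` in `Ver_4^+`, that is, a module over its enveloping algebra. -/
structure GlRep where
  carrier : Type u
  [addCommGroup : AddCommGroup carrier]
  [module : Module k carrier]
  [finite : FiniteDimensional k carrier]
  [verObj : VerObj k carrier]
  act : GlP k →ₗ[k] carrier →ₗ[k] carrier
  act_d : ∀ X v, dd k (act X v) = act (dd k X) v + act X (dd k v)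
  act_bracket : ∀ X Y v, act (glBracket k X Y) v =
    act X (act Y v) - act Y (act X v) - act (dd k Y) (act (dd k X) v)

namespace GlRep

attribute [instance] addCommGroup module finite verObj

variable {k}

/-- A subrepresentation: a subspace stable under `d` and `gl(P)`. -/
def IsSub (V : GlRep k) (W : Submodule k V.carrier) : Prop :=
  (∀ x ∈ W, dd k x ∈ W) ∧ ∀ X, ∀ x ∈ W, V.act X x ∈ W

/-- An irreducible representation. -/
def Irreducible (V : GlRep k) : Prop :=
  Nontrivial V.carrier ∧ ∀ W : Submodule k V.carrier, V.IsSub W → W = ⊥ ∨ W = ⊤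

/-- Isomorphism of representations. -/
def Iso (V W : GlRep k) : Prop :=
  ∃ e : V.carrier ≃ₗ[k] W.carrier, (∀ x, e (dd k x) = dd k (e x)) ∧
    ∀ X x, e (V.act X x) = W.act X (e x)

end GlRep

section Basis

/-- `x = 1 ⊗ d^*`. -/
def gx : GlP k := !![0, 1; 0, 0]
/-- `e = x' = 1 ⊗ 1^* + d ⊗ d^*`. -/
def ge : GlP k := !![1, 0; 0, 1]
/-- `y = 1 ⊗ 1^*`. -/
def gy : GlP k := !![1, 0; 0, 0]
/-- `y' = d ⊗ 1^*`. -/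
def gdy : GlP k := !![0, 0; 1, 0]

theorem dd_gx : dd k (gx k) = ge k := by
  ext i j; fin_cases i <;> fin_cases j <;> simp [dd_gl, dP, gx, ge]
theorem dd_gy : dd k (gy k) = gdy k := by
  ext i j; fin_cases i <;> fin_cases j <;> simp [dd_gl, dP, gy, gdy]

/-- The coordinates of an element of `gl(P)` in the basis `x, e, y, y'`. -/
theorem gl_decomp (X : GlP k) :
    X = X 0 1 • gx k + X 1 1 • ge k + (X 0 0 - X 1 1) • gy k + X 1 0 • gdy k := by
  ext i j; fin_cases i <;> fin_cases j <;> simp [gx, ge, gy, gdy]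

end Basis

section Irr

variable {k}

/-- The linear map on `gl(P)` with values `mx, me, my, mdy` at the basis `x, e, y, y'`. -/
def glLin {M : Type v} [AddCommGroup M] [Module k M] (mx me my mdy : M) : GlP k →ₗ[k] M where
  toFun X := X 0 1 • mx + X 1 1 • me + (X 0 0 - X 1 1) • my + X 1 0 • mdy
  map_add' X Y := by
    simp only [Matrix.add_apply]
    module
  map_smul' c X := by
    simp only [Matrix.smul_apply, RingHom.id_apply, smul_eq_mul]
    module

/-- The `gl(P)`-representation on `kⁿ` with `d, x, x' = e, y, y'` acting by the given matrices. -/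
def GlRep.ofMatrices {n : ℕ} (D mx me my mdy : Matrix (Fin n) (Fin n) k) (hD : D * D = 0)
    (hd : ∀ X : GlP k, D * glLin mx me my mdy X =
      glLin mx me my mdy (dd k X) + glLin mx me my mdy X * D)
    (hb : ∀ X Y : GlP k, glLin mx me my mdy (glBracket k X Y) =
      glLin mx me my mdy X * glLin mx me my mdy Y - glLin mx me my mdy Y * glLin mx me my mdy X
        - glLin mx me my mdy (dd k Y) * glLin mx me my mdy (dd k X)) : GlRep k :=
  letI := GLRep.matrixObj D hD
  { carrier := Fin n → k
    act := Matrix.mulVecBilin k k ∘ₗ glLin mx me my mdy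
    act_d := fun X v => by
      change D.mulVec ((glLin mx me my mdy X).mulVec v) = (glLin mx me my mdy (dd k X)).mulVec v +
        (glLin mx me my mdy X).mulVec (D.mulVec v)
      rw [Matrix.mulVec_mulVec, Matrix.mulVec_mulVec, ← Matrix.add_mulVec, hd]
    act_bracket := fun X Y v => by
      change (glLin mx me my mdy (glBracket k X Y)).mulVec v =
        (glLin mx me my mdy X).mulVec ((glLin mx me my mdy Y).mulVec v) -
        (glLin mx me my mdy Y).mulVec ((glLin mx me my mdy X).mulVec v) -
        (glLin mx me my mdy (dd k Y)).mulVec ((glLin mx me my mdy (dd k X)).mulVec v)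
      simp only [Matrix.mulVec_mulVec, ← Matrix.sub_mulVec, hb] }

end Irr

theorem glLin_mk {M : Type v} [AddCommGroup M] [Module k M] (mx me my mdy : M) (p q r s : k) :
    glLin mx me my mdy (!![p, q; r, s] : GlP k) = q • mx + s • me + (p - s) • my + r • mdy := rfl

theorem gl_eta (X : GlP k) : ∃ p q r s : k, X = !![p, q; r, s] :=
  ⟨_, _, _, _, Matrix.eta_fin_two X⟩

theorem glBracket_mk (p q r s p' q' r' s' : k) :
    glBracket k !![p, q; r, s] !![p', q'; r', s'] =
      !![q * r' - q' * r - q' * q, p * q' + q * s' - p' * q - q' * s;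
         r * p' + s * r' - r' * p - s' * r - (p' + s') * q - q' * (p + s),
         r * q' - r' * q - q' * q] := by
  rw [glBracket, dd_gl_mk, dd_gl_mk, Matrix.mul_fin_two, Matrix.mul_fin_two, Matrix.mul_fin_two]
  ext i j; fin_cases i <;> fin_cases j <;> simp <;> ring

/-- `L(1, a, b)`, with underlying object `P`. -/
def L1 (a b : k) : GlRep k :=
  .ofMatrices (dP k) !![0, 1; a, 0] 1 !![b, 0; 0, b + 1] !![0, 0; 1, 0] (dP_sq k)
    (fun X => by
      obtain ⟨p, q, r, s, rfl⟩ := gl_eta k X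
      rw [dd_gl_mk, glLin_mk, glLin_mk]
      ext i j; fin_cases i <;> fin_cases j <;> simp [dP, Matrix.mul_apply, Fin.sum_univ_two, Matrix.one_apply] <;> grind)
    (fun X Y => by
      obtain ⟨p, q, r, s, rfl⟩ := gl_eta k X
      obtain ⟨p', q', r', s', rfl⟩ := gl_eta k Y
      rw [glBracket_mk, dd_gl_mk, dd_gl_mk]
      simp only [glLin_mk]
      ext i j; fin_cases i <;> fin_cases j <;> simp [dP, Matrix.mul_apply, Fin.sum_univ_two, Matrix.one_apply] <;> grind)

/-- `L(0, a, b)` for `a ≠ 0`, with underlying object `2 · 𝟙`. -/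
def L0two (a b : k) : GlRep k :=
  .ofMatrices 0 !![0, 1; a, 0] 0 !![b, 0; 0, b + 1] 0 (by simp)
    (fun X => by
      obtain ⟨p, q, r, s, rfl⟩ := gl_eta k X
      rw [dd_gl_mk, glLin_mk, glLin_mk]
      ext i j; fin_cases i <;> fin_cases j <;> simp [Matrix.mul_apply, Fin.sum_univ_two, Matrix.one_apply])
    (fun X Y => by
      obtain ⟨p, q, r, s, rfl⟩ := gl_eta k X
      obtain ⟨p', q', r', s', rfl⟩ := gl_eta k Y
      rw [glBracket_mk, dd_gl_mk, dd_gl_mk]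
      simp only [glLin_mk]
      ext i j; fin_cases i <;> fin_cases j <;> simp [dP, Matrix.mul_apply, Fin.sum_univ_two, Matrix.one_apply] <;> grind)

/-- `L(0, 0, b)`, with underlying object `𝟙`. -/
def L0one (b : k) : GlRep k :=
  .ofMatrices 0 0 0 !![b] 0 (by simp)
    (fun X => by
      obtain ⟨p, q, r, s, rfl⟩ := gl_eta k X
      rw [dd_gl_mk, glLin_mk, glLin_mk]
      ext i j; fin_cases i; fin_cases j; simp [Matrix.mul_apply])
    (fun X Y => by
      obtain ⟨p, q, r, s, rfl⟩ := gl_eta k X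
      obtain ⟨p', q', r', s', rfl⟩ := gl_eta k Y
      rw [glBracket_mk, dd_gl_mk, dd_gl_mk]
      simp only [glLin_mk]
      ext i j; fin_cases i; fin_cases j; simp [Matrix.mul_apply]; grind)

open Classical in
/-- The family `L(ε, a, b)` of irreducible representations of `gl(P)`, `ε ∈ {0, 1}`, `a, b ∈ k`. -/
noncomputable def L (ε : Fin 2) (a b : k) : GlRep k :=
  if ε = 1 then L1 k a b else if a = 0 then L0one k b else L0two k a b

end GLP

section GLP
variable (k : Type u) [Field k] [CharP k 2]

section Lie

open OGL

/-- The product `(μν)(f) = ∑ ν(f₁) μ(f₂)` of distributions, the one for which a left comodule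
is a left module by `μ v = (μ ⊗ 1)(ρ(v))`. -/
noncomputable def conv (μ ν : Module.Dual k (OGL k)) : Module.Dual k (OGL k) :=
  LinearMap.mul' k k ∘ₗ TensorProduct.map ν μ ∘ₗ comul k

/-- The `d`-action on the dual of `𝒪(GL(P))`. -/
def dualD (μ : Module.Dual k (OGL k)) : Module.Dual k (OGL k) := μ ∘ₗ dd k

/-- The commutator `μν - νμ - ν'μ'` of distributions. -/
noncomputable def distBracket (μ ν : Module.Dual k (OGL k)) : Module.Dual k (OGL k) :=
  conv k μ ν - conv k ν μ - conv k (dualD k ν) (dualD k μ)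

/-- The Lie algebra `(I/I²)^*` of `GL(P)`, `I` the augmentation ideal of `𝒪(GL(P))`: the
functionals that vanish on `1` and on `I²`. -/
def lieGL : Submodule k (Module.Dual k (OGL k)) where
  carrier := {μ | μ 1 = 0 ∧ ∀ f g, counit k f = 0 → counit k g = 0 → μ (f * g) = 0}
  zero_mem' := by simp
  add_mem' := by
    rintro μ ν ⟨h1, h2⟩ ⟨h3, h4⟩
    refine ⟨by simp [h1, h3], fun f g hf hg => ?_⟩
    rw [LinearMap.add_apply, h2 f g hf hg, h4 f g hf hg, add_zero]
  smul_mem' := by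
    rintro c μ ⟨h1, h2⟩
    refine ⟨by simp [h1], fun f g hf hg => ?_⟩
    rw [LinearMap.smul_apply, h2 f g hf hg, smul_zero]

variable {k}

theorem mem_lieGL {μ : Module.Dual k (OGL k)} :
    μ ∈ lieGL k ↔ ∀ f g, μ (f * g) = μ f * counit k g + counit k f * μ g := by
  constructor
  · rintro ⟨h1, h2⟩ f g
    have h := h2 (f - algebraMap k _ (counit k f)) (g - algebraMap k _ (counit k g))
      (by simp) (by simp)
    simp only [sub_mul, mul_sub, map_sub, ← map_mul, Algebra.algebraMap_eq_smul_one, map_smul, h1,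
      smul_mul_assoc, mul_smul_comm, one_mul, mul_one, smul_eq_mul] at h
    linear_combination h
  · intro h
    refine ⟨?_, fun f g hf hg => by rw [h, hf, hg, mul_zero, zero_mul, add_zero]⟩
    have := h 1 1
    simpa using this

theorem lieGL_ext {μ ν : Module.Dual k (OGL k)} (hμ : μ ∈ lieGL k) (hν : ν ∈ lieGL k)
    (h : ∀ x : Coord, μ (gen k (some x)) = ν (gen k (some x))) : μ = ν := by
  have hμ1 := hμ.1
  have hν1 := hν.1
  rw [mem_lieGL] at hμ hν
  ext f
  induction f using OGL.ind with
  | hc c => rw [Algebra.algebraMap_eq_smul_one, map_smul, map_smul, hμ1, hν1]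
  | ha x y hx hy => rw [map_add, map_add, hx, hy]
  | hm x y hx hy => rw [hμ, hν, hx, hy]
  | hg x =>
    cases x with
    | some x => exact h x
    | none =>
      have h1 := hμ (A k) (Ai k)
      have h2 := hν (A k) (Ai k)
      rw [A_mul_Ai, hμ1] at h1
      rw [A_mul_Ai, hν1] at h2
      have h3 := h .A
      simp only [counit_A, counit_Ai, mul_one, one_mul] at h1 h2
      linear_combination h2 - h1 - h3

theorem dualD_mem {μ : Module.Dual k (OGL k)} (hμ : μ ∈ lieGL k) : dualD k μ ∈ lieGL k := by
  rw [mem_lieGL] at hμ ⊢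
  intro f g
  simp only [dualD, LinearMap.comp_apply, dd_mul, map_add, hμ, counit_dd]
  ring

/-- The algebra map `ε ⊗ 1`. -/
def counitL : BraidedSq k (OGL k) →ₐ[k] OGL k :=
  AlgHom.ofLinearMap ((TensorProduct.lid k (OGL k)).toLinearMap ∘ₗ
    (counit k).toLinearMap.rTensor (OGL k) ∘ₗ BraidedSq.toTensor)
    (by simp [BraidedSq.one_def])
    (fun s t => by
      induction s using BraidedSq.ind with
      | h0 => simp
      | ha s s' h h' => rw [add_mul, map_add, h, h', map_add, add_mul]
      | ht a b =>
        induction t using BraidedSq.ind with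
        | h0 => simp
        | ha s s' h h' => rw [mul_add, map_add, h, h', map_add, mul_add]
        | ht c e => simp [mul_smul, smul_comm (counit k a)])

/-- The algebra map `1 ⊗ ε`. -/
def counitR : BraidedSq k (OGL k) →ₐ[k] OGL k :=
  AlgHom.ofLinearMap ((TensorProduct.rid k (OGL k)).toLinearMap ∘ₗ
    (counit k).toLinearMap.lTensor (OGL k) ∘ₗ BraidedSq.toTensor)
    (by simp [BraidedSq.one_def])
    (fun s t => by
      induction s using BraidedSq.ind with
      | h0 => simp
      | ha s s' h h' => rw [add_mul, map_add, h, h', map_add, add_mul]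
      | ht a b =>
        induction t using BraidedSq.ind with
        | h0 => simp
        | ha s s' h h' => rw [mul_add, map_add, h, h', map_add, mul_add]
        | ht c e => simp [mul_smul, smul_comm (counit k b)])

@[simp] theorem counitL_tm (f g : OGL k) : counitL (BraidedSq.tm k f g) = counit k f • g := by
  simp [counitL]
@[simp] theorem counitR_tm (f g : OGL k) : counitR (BraidedSq.tm k f g) = counit k g • f := by
  simp [counitR]

theorem counitL_comul (f : OGL k) : counitL (comulHom k f) = f := by
  have h : counitL.comp (comulHom k) = AlgHom.id k (OGL k) := by
    apply hom_ext
    intro x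
    cases x <;> simp
  exact DFunLike.congr_fun h f

theorem counitR_comul (f : OGL k) : counitR (comulHom k f) = f := by
  have h : counitR.comp (comulHom k) = AlgHom.id k (OGL k) := by
    apply hom_ext
    intro x
    cases x <;> simp
  exact DFunLike.congr_fun h f

/-- The functional `ν ⊗ μ`. -/
noncomputable def ev (ν μ : Module.Dual k (OGL k)) : BraidedSq k (OGL k) →ₗ[k] k :=
  LinearMap.mul' k k ∘ₗ TensorProduct.map ν μ ∘ₗ BraidedSq.toTensor

@[simp] theorem ev_tm (ν μ : Module.Dual k (OGL k)) (f g : OGL k) :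
    ev ν μ (BraidedSq.tm k f g) = ν f * μ g := by
  simp [ev]

theorem conv_apply (μ ν : Module.Dual k (OGL k)) (f : OGL k) :
    conv k μ ν f = ev ν μ (comulHom k f) := rfl

theorem ev_counit_left (μ : Module.Dual k (OGL k)) (s : BraidedSq k (OGL k)) :
    ev (counit k).toLinearMap μ s = μ (counitL s) := by
  induction s using BraidedSq.ind with
  | h0 => simp
  | ha s s' h h' => simp only [map_add, h, h']
  | ht a b => simp

theorem ev_counit_right (μ : Module.Dual k (OGL k)) (s : BraidedSq k (OGL k)) :
    ev μ (counit k).toLinearMap s = μ (counitR s) := by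
  induction s using BraidedSq.ind with
  | h0 => simp
  | ha s s' h h' => simp only [map_add, h, h']
  | ht a b => simp [mul_comm]

theorem ev_mul {μ ν : Module.Dual k (OGL k)} (hμ : μ ∈ lieGL k) (hν : ν ∈ lieGL k)
    (s t : BraidedSq k (OGL k)) :
    ev ν μ (s * t) = ev ν μ s * counit k (counitL t) + counit k (counitL s) * ev ν μ t +
      ν (counitR s) * μ (counitL t) + μ (counitL s) * ν (counitR t) +
      dualD k μ (counitL s) * dualD k ν (counitR t) := by
  rw [mem_lieGL] at hμ hν
  induction s using BraidedSq.ind with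
  | h0 => simp
  | ha s s' h h' => simp only [add_mul, map_add, h, h']; ring
  | ht a b =>
    induction t using BraidedSq.ind with
    | h0 => simp
    | ha s s' h h' => simp only [mul_add, map_add, h, h']; ring
    | ht c e =>
      simp only [BraidedSq.tm_mul_tm, map_add, ev_tm, hμ, hν, counitL_tm, counitR_tm, map_smul,
        counit_dd, dualD, LinearMap.comp_apply, smul_eq_mul]
      ring

theorem conv_mul {μ ν : Module.Dual k (OGL k)} (hμ : μ ∈ lieGL k) (hν : ν ∈ lieGL k)
    (f g : OGL k) : conv k μ ν (f * g) = conv k μ ν f * counit k g + counit k f * conv k μ ν g +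
      ν f * μ g + μ f * ν g + dualD k μ f * dualD k ν g := by
  simp only [conv_apply, map_mul, ev_mul hμ hν, counitL_comul, counitR_comul]

theorem distBracket_mem {μ ν : Module.Dual k (OGL k)} (hμ : μ ∈ lieGL k) (hν : ν ∈ lieGL k) :
    distBracket k μ ν ∈ lieGL k := by
  have h0 : ∀ ξ : Module.Dual k (OGL k), dualD k (dualD k ξ) = 0 := fun ξ => by
    ext f; simp [dualD]
  rw [mem_lieGL]
  intro f g
  simp only [distBracket, LinearMap.sub_apply, conv_mul hμ hν, conv_mul hν hμ,
    conv_mul (dualD_mem hν) (dualD_mem hμ), h0, LinearMap.zero_apply]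
  linear_combination (-(dualD k ν f * dualD k μ g)) * (CharTwo.two_eq_zero (R := k))

variable (k)

/-- The algebra map `f ↦ (f mod I²)` to `k ⊕ I/I²`, in the basis `A - 1, B, A', B'` of `I/I²`. -/
def linearPart : OGL k →ₐ[k] TrivSqZeroExt k (Fin 4 → k) :=
  rawLift
    (fun x => match x with
      | some .A => .inl 1 + .inr ![1, 0, 0, 0]
      | some .B => .inr ![0, 1, 0, 0]
      | some .dA => .inr ![0, 0, 1, 0]
      | some .dB => .inr ![0, 0, 0, 1]
      | none => .inl 1 - .inr ![1, 0, 0, 0])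
    (fun x => match x with
      | .A => .inr ![0, 0, 1, 0]
      | .B => .inr ![0, 0, 0, 1]
      | .dA => 0
      | .dB => 0)
    rfl rfl rfl rfl
    (fun x y => by
      rw [mul_comm]
      cases x <;> cases y <;> simp)
    (by
      ext i
      · simp
      · fin_cases i <;> simp)
    (by
      ext i
      · simp
      · fin_cases i <;> simp)

theorem linearPart_fst (f : OGL k) : (linearPart k f).fst = counit k f := by
  induction f using OGL.ind with
  | hc c => rw [AlgHom.commutes, AlgHom.commutes]; rfl
  | ha x y hx hy => rw [map_add, map_add, TrivSqZeroExt.fst_add, hx, hy]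
  | hm x y hx hy => rw [map_mul, map_mul, TrivSqZeroExt.fst_mul, hx, hy]
  | hg x =>
    cases x with
    | none => rw [counit_Ai]; simp [linearPart]
    | some x => cases x <;> simp [linearPart]

/-- The basis `μ_{A-1}, μ_B, μ_{A'}, μ_{B'}` of the Lie algebra of `GL(P)` that is dual to the
basis `A - 1, B, A', B'` of `I/I²`. -/
def mu (i : Fin 4) : lieGL k :=
  ⟨LinearMap.proj i ∘ₗ (TrivSqZeroExt.sndHom k (Fin 4 → k)) ∘ₗ (linearPart k).toLinearMap, by
    rw [mem_lieGL]
    intro f g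
    simp [← linearPart_fst, mul_comm, add_comm]⟩

theorem mu_gen (i : Fin 4) : (mu k i).1 (A k) = (![1, 0, 0, 0] : Fin 4 → k) i ∧
    (mu k i).1 (B k) = (![0, 1, 0, 0] : Fin 4 → k) i ∧
    (mu k i).1 (dA k) = (![0, 0, 1, 0] : Fin 4 → k) i ∧
    (mu k i).1 (dB k) = (![0, 0, 0, 1] : Fin 4 → k) i := by
  simp [mu, linearPart]

/-- The isomorphism of `gl(P)` with the Lie algebra of `GL(P)`:
`x ↦ μ_{A'}`, `x' = e ↦ μ_{A-1}`, `y ↦ μ_{B'}`, `y' ↦ μ_B`. -/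
def glToLie : GlP k ≃ₗ[k] lieGL k :=
  LinearEquiv.ofLinearMap
    (glLin (mu k 2) (mu k 0) (mu k 3) (mu k 1))
    { toFun := fun μ => !![μ.1 (A k) + μ.1 (dB k), μ.1 (dA k); μ.1 (B k), μ.1 (A k)]
      map_add' := fun μ ν => by
        ext i j; fin_cases i <;> fin_cases j <;> simp <;> ring
      map_smul' := fun c μ => by
        ext i j; fin_cases i <;> fin_cases j <;> simp <;> ring }
    (by
      ext1 μ
      apply Subtype.ext
      refine lieGL_ext (Subtype.property _) μ.2 fun x => ?_
      cases x <;> simp [glLin, mu_gen])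
    (by
      ext1 X
      obtain ⟨p, q, r, s, rfl⟩ := gl_eta k X
      ext i j; fin_cases i <;> fin_cases j <;> simp [glLin, mu_gen])

theorem glToLie_mk_gen (p q r s : k) : (glToLie k !![p, q; r, s]).1 (A k) = s ∧
    (glToLie k !![p, q; r, s]).1 (B k) = r ∧ (glToLie k !![p, q; r, s]).1 (dA k) = q ∧
    (glToLie k !![p, q; r, s]).1 (dB k) = p - s := by
  simp [glToLie, glLin, mu_gen]

theorem glToLie_dd (X : GlP k) : (glToLie k (dd k X)).1 = dualD k (glToLie k X).1 := by
  obtain ⟨p, q, r, s, rfl⟩ := gl_eta k X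
  rw [dd_gl_mk]
  refine lieGL_ext (Subtype.property _) (dualD_mem (Subtype.property _)) fun x => ?_
  obtain ⟨h1, h2, h3, h4⟩ := glToLie_mk_gen k q 0 (p + s) q
  obtain ⟨g1, g2, g3, g4⟩ := glToLie_mk_gen k p q r s
  have := CharTwo.two_eq_zero (R := k)
  cases x <;> simp only [h1, h2, h3, h4, dualD, LinearMap.comp_apply, dd_A, dd_B, dd_dA, dd_dB,
    g3, g4, map_zero]
  · grind
  · grind

theorem glToLie_bracket (X Y : GlP k) : (glToLie k (glBracket k X Y)).1 =
    distBracket k (glToLie k X).1 (glToLie k Y).1 := by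
  refine lieGL_ext (Subtype.property _)
    (distBracket_mem (Subtype.property _) (Subtype.property _)) fun x => ?_
  rw [distBracket, ← glToLie_dd, ← glToLie_dd]
  obtain ⟨p, q, r, s, rfl⟩ := gl_eta k X
  obtain ⟨p', q', r', s', rfl⟩ := gl_eta k Y
  rw [glBracket_mk, dd_gl_mk, dd_gl_mk]
  cases x <;> simp only [LinearMap.sub_apply, conv_apply, comulHom_A, comulHom_B, comulHom_dA,
    comulHom_dB, map_add, ev_tm, (glToLie_mk_gen k _ _ _ _).1, (glToLie_mk_gen k _ _ _ _).2.1,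
    (glToLie_mk_gen k _ _ _ _).2.2.1, (glToLie_mk_gen k _ _ _ _).2.2.2] <;> grind

end Lie

/-- The action `μ v = (μ ⊗ 1)(ρ(v))` of a distribution on a representation of `GL(P)`. -/
noncomputable def distAct {k : Type u} [Field k] [CharP k 2] (V : GLRep k)
    (μ : Module.Dual k (OGL k)) : V.carrier →ₗ[k] V.carrier :=
  (TensorProduct.lid k V.carrier).toLinearMap ∘ₗ μ.rTensor V.carrier ∘ₗ V.coact

section

variable {k}

theorem distAct_conv (V : GLRep k) (μ ν : Module.Dual k (OGL k)) (v : V.carrier) :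
    distAct V (conv k μ ν) v = distAct V μ (distAct V ν v) := by
  have h1 : ∀ t : OGL k ⊗[k] V.carrier, V.coact (TensorProduct.lid k _ (ν.rTensor _ t)) =
      TensorProduct.lid k _ (ν.rTensor _ (V.coact.lTensor (OGL k) t)) := fun t => by
    induction t with
    | zero => simp
    | add x y hx hy => simp only [map_add, hx, hy]
    | tmul f x => simp
  have h2 : ∀ t : OGL k ⊗[k] V.carrier,
      TensorProduct.lid k _ ((conv k μ ν).rTensor _ t) =
      TensorProduct.lid k _ (μ.rTensor _ (TensorProduct.lid k _ (ν.rTensor _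
        (TensorProduct.assoc k _ _ _ ((OGL.comul k).rTensor _ t))))) := fun t => by
    induction t with
    | zero => simp
    | add x y hx hy => simp only [map_add, hx, hy]
    | tmul f x =>
      simp only [LinearMap.rTensor_tmul, conv, LinearMap.comp_apply]
      generalize OGL.comul k f = s
      induction s with
      | zero => simp
      | add x y hx hy => simp only [map_add, TensorProduct.add_tmul, hx, hy]
      | tmul f g => simp [mul_smul]
  simp only [distAct, LinearMap.comp_apply, LinearEquiv.coe_coe]
  rw [h1, h2, V.coassoc]

theorem distAct_dd (V : GLRep k) (μ : Module.Dual k (OGL k)) (v : V.carrier) :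
    dd k (distAct V μ v) = distAct V (dualD k μ) v + distAct V μ (dd k v) := by
  have h : ∀ t : OGL k ⊗[k] V.carrier, dd k (TensorProduct.lid k _ (μ.rTensor _ t)) =
      TensorProduct.lid k _ ((dualD k μ).rTensor _ t) +
        TensorProduct.lid k _ (μ.rTensor _ (dd k t)) := fun t => by
    induction t with
    | zero => simp
    | add x y hx hy => simp only [map_add, hx, hy]; abel
    | tmul f x =>
      simp only [LinearMap.rTensor_tmul, dd_tmul, map_add, TensorProduct.lid_tmul, dualD,
        LinearMap.comp_apply, map_smul]
      rw [← add_assoc, add_self_zero k, zero_add]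
  simp only [distAct, LinearMap.comp_apply, LinearEquiv.coe_coe]
  rw [h, V.coact_d]

/-- The restriction of a representation of `GL(P)` to `gl(P)`, identified with the Lie algebra of
`GL(P)` by `x ↦ μ_{A'}`, `e ↦ μ_{A-1}`, `y ↦ μ_{B'}`, `y' ↦ μ_B`. -/
noncomputable def GLRep.restrict (V : GLRep k) : GlRep k where
  carrier := V.carrier
  act :=
    { toFun := fun X => distAct V (glToLie k X).1
      map_add' := fun X Y => by
        simp only [map_add, Submodule.coe_add, distAct, LinearMap.rTensor_add, LinearMap.add_comp,
          LinearMap.comp_add]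
      map_smul' := fun c X => by
        simp only [map_smul, Submodule.coe_smul, distAct, LinearMap.rTensor_smul,
          LinearMap.smul_comp, LinearMap.comp_smul, RingHom.id_apply] }
  act_d X v := by
    change dd k (distAct V _ v) = distAct V _ v + distAct V _ (dd k v)
    rw [glToLie_dd, distAct_dd]
  act_bracket X Y v := by
    change distAct V _ v = distAct V _ (distAct V _ v) - distAct V _ (distAct V _ v) -
      distAct V _ (distAct V _ v)
    rw [glToLie_bracket, glToLie_dd, glToLie_dd, ← distAct_conv, ← distAct_conv, ← distAct_conv,
      distBracket]
    simp only [distAct, LinearMap.rTensor_sub, LinearMap.sub_comp, LinearMap.comp_sub,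
      LinearMap.sub_apply]

end

end GLP

end Ver4

/-! Write G for GL(P). The functions A' and B' are central of square zero, and modulo them 𝒪(G)
becomes the coordinate ring of the ordinary commutative group of matrices (a 0; b a), the product of
the central torus of scalars and the additive group of the matrices u_c = (1 0; c 1). The theorem
rests on the principle that a representation is controlled by this ordinary group together with the
Lie algebra.

In detail, every function of torus weight n has the form Aⁿp + Aⁿ⁻¹qA' + Aⁿ⁻¹rB' + Aⁿ⁻²sA'B' with p,
q, r, s polynomials in A⁻¹B. The values at all points u_c of the function and of its derivatives by
x, y and xy recover these four polynomials, since k is infinite (`eq_zero_of_unip`). Applied to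
matrix coefficients, this shows that in fixed weight a subspace or a linear isomorphism respects the
coaction once it respects d, gl(P) and the operators u_c (`HasWeight.isSub`, `HasWeight.iso`).

Let V be irreducible. The torus is central, so V has a single weight n (`exists_hasWeight`). The
product rule for distributions has an extra term from the braiding. In characteristic 2 the usual
cross terms of a square cancel and only that term survives. As x' = e, the square x² therefore
behaves like the second divided power of e, and as dy = y', the operator y² + y is the second
divided power of y'. Hence e = n, x² = n(n-1)/2, and y² + y is the coefficient of c² in u_c
(`conv_dist_gx`, `conv_dist_gy`).

The main device is that an operator of square zero on an irreducible representation vanishes if its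
kernel is stable (`eq_zero_of_ker_stable`). It gives y' = 0 for even n, and then u_c = 1 + c y' for
every n (`distAct_unip_eq`). Three things follow: y² = y, the restriction to gl(P) stays
irreducible, and V is determined by its weight and its restriction.

It remains to find the irreducible gl(P)-modules with these scalars. The same device gives d = y' if
e = 1, and d = 0 if e = y' = 0. If v is an eigenvector of y, taken in the kernel of y' when e = 1,
then v and xv span the module. So the restriction is L(ε, a, b) with ε and a the residues of n and
n(n-1)/2, and b in 𝔽₂. The pair (ε, a) depends only on n modulo 4 and takes all four values. The
representations T_1, T_2, T_3 have weights 1, 2, 3. Both χ and ξ have weight 4, where χ restricts to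
the trivial representation and ξ realizes b = 1. This exhausts the list, the two values of b giving
isomorphic modules when n is 2 modulo 4. No other L(ε, a, b) occurs, because x² = a and y² + y = b²
+ b are isomorphism invariants (`L_iso_invariants`). -/

namespace Ver4

universe u v

open OGL BraidedSq

/-! ### Distributions on GL(P) and their product rules. -/

section Functionals

variable {k : Type u} [Field k] [CharP k 2]

section Points

variable {S : Type v} [CommRing S] [Algebra k S]

/-- An algebra map to a commutative algebra that kills `A'` and `B'` kills all derivatives. -/
theorem map_dd_eq_zero (φ : OGL k →ₐ[k] S) (hA : φ (dA k) = 0) (hB : φ (dB k) = 0) (f : OGL k) :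
    φ (dd k f) = 0 := by
  induction f using OGL.ind with
  | hc c => simp
  | ha x y hx hy => rw [map_add, map_add, hx, hy, add_zero]
  | hm x y hx hy => rw [dd_mul, map_add, map_mul, map_mul, hx, hy, zero_mul, mul_zero, add_zero]
  | hg x =>
    cases x with
    | none =>
      have h : dd k (Ai k) = -(Ai k * dA k * Ai k) := diff_Ai k
      rw [h, map_neg, map_mul, map_mul, hA, mul_zero, zero_mul, neg_zero]
    | some x => cases x <;> simp [hA, hB]

/-- The algebra map `f ⊗ g ↦ φ(f) ⊗ g`. -/
def pointL (φ : OGL k →ₐ[k] S) (hφ : ∀ f, φ (dd k f) = 0) :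
    BraidedSq k (OGL k) →ₐ[k] S ⊗[k] OGL k :=
  AlgHom.ofLinearMap (φ.toLinearMap.rTensor (OGL k) ∘ₗ toTensor)
    (by simp [BraidedSq.one_def, Algebra.TensorProduct.one_def])
    (fun s t => by
      induction s using BraidedSq.ind with
      | h0 => simp
      | ha s s' h h' => rw [add_mul, map_add, h, h', map_add, add_mul]
      | ht a b =>
        induction t using BraidedSq.ind with
        | h0 => simp
        | ha s s' h h' => rw [mul_add, map_add, h, h', map_add, mul_add]
        -- The braided product adds a term whose first factor is a multiple of c'; it dies because φ
        -- kills derivatives. So S ⊗ 𝒪 may carry the ordinary tensor product structure.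
        | ht c e => simp [hφ])

@[simp] theorem pointL_tm (φ : OGL k →ₐ[k] S) (hφ : ∀ f, φ (dd k f) = 0) (f g : OGL k) :
    pointL φ hφ (tm k f g) = φ f ⊗ₜ g := by
  simp [pointL]

/-- The algebra map `f ⊗ g ↦ φ(g) ⊗ f`. -/
def pointR (φ : OGL k →ₐ[k] S) (hφ : ∀ f, φ (dd k f) = 0) :
    BraidedSq k (OGL k) →ₐ[k] S ⊗[k] OGL k :=
  AlgHom.ofLinearMap (φ.toLinearMap.rTensor (OGL k) ∘ₗ
      (TensorProduct.comm k (OGL k) (OGL k)).toLinearMap ∘ₗ toTensor)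
    (by simp [BraidedSq.one_def, Algebra.TensorProduct.one_def])
    (fun s t => by
      induction s using BraidedSq.ind with
      | h0 => simp
      | ha s s' h h' => rw [add_mul, map_add, h, h', map_add, add_mul]
      | ht a b =>
        induction t using BraidedSq.ind with
        | h0 => simp
        | ha s s' h h' => rw [mul_add, map_add, h, h', map_add, mul_add]
        | ht c e => simp [hφ])

@[simp] theorem pointR_tm (φ : OGL k →ₐ[k] S) (hφ : ∀ f, φ (dd k f) = 0) (f g : OGL k) :
    pointR φ hφ (tm k f g) = φ g ⊗ₜ f := by
  simp [pointR]

end Points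

/-- The linear map `f ⊗ g ↦ ν(f) g`. -/
noncomputable def evL (ν : Module.Dual k (OGL k)) : BraidedSq k (OGL k) →ₗ[k] OGL k :=
  (TensorProduct.lid k (OGL k)).toLinearMap ∘ₗ ν.rTensor (OGL k) ∘ₗ toTensor

@[simp] theorem evL_tm (ν : Module.Dual k (OGL k)) (f g : OGL k) :
    evL ν (tm k f g) = ν f • g := by
  simp [evL]

/-- The action `f ↦ ∑ ν(f₁) f₂` of a functional on `𝒪(GL(P))`. -/
noncomputable def ltrans (ν : Module.Dual k (OGL k)) : OGL k →ₗ[k] OGL k :=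
  evL ν ∘ₗ (comulHom k).toLinearMap

theorem ltrans_apply (ν : Module.Dual k (OGL k)) (f : OGL k) :
    ltrans ν f = evL ν (comulHom k f) := rfl

theorem apply_evL (μ ν : Module.Dual k (OGL k)) (s : BraidedSq k (OGL k)) :
    μ (evL ν s) = ev ν μ s := by
  induction s using BraidedSq.ind with
  | h0 => simp
  | ha s s' h h' => simp only [map_add, h, h']
  | ht a b => simp

/-- Reduces the evaluation of a product of distributions on a generator to one translation followed
by one functional. -/
theorem apply_ltrans (μ ν : Module.Dual k (OGL k)) (f : OGL k) :
    μ (ltrans ν f) = conv k μ ν f := apply_evL μ ν _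

theorem counit_ltrans (ν : Module.Dual k (OGL k)) (f : OGL k) : counit k (ltrans ν f) = ν f := by
  have h := apply_ltrans (counit k).toLinearMap ν f
  rw [conv_apply, ev_counit_right, counitR_comul] at h
  exact h

/-- A Lie algebra element is a derivation over the counit. The last term is the contribution of the
braiding: of μ(a c') only ε(a)μ(c') is left, because ε kills derivatives. -/
theorem evL_mul {μ : Module.Dual k (OGL k)} (hμ : μ ∈ lieGL k) (s t : BraidedSq k (OGL k)) :
    evL μ (s * t) = evL μ s * counitL t + counitL s * evL μ t +
      dd k (counitL s) * evL (dualD k μ) t := by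
  rw [mem_lieGL] at hμ
  induction s using BraidedSq.ind with
  | h0 => simp
  | ha s s' h h' => simp only [add_mul, map_add, h, h']; abel
  | ht a b =>
    induction t using BraidedSq.ind with
    | h0 => simp
    | ha s s' h h' => simp only [mul_add, map_add, h, h']; abel
    | ht c e =>
      simp only [BraidedSq.tm_mul_tm, map_add, evL_tm, hμ, counitL_tm, map_smul, counit_dd, dualD,
        LinearMap.comp_apply, mul_zero, zero_add, smul_mul_assoc, mul_smul_comm]
      module

/-- The product rule for the action of the Lie algebra on `𝒪(GL(P))`. -/
theorem ltrans_mul {μ : Module.Dual k (OGL k)} (hμ : μ ∈ lieGL k) (f g : OGL k) :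
    ltrans μ (f * g) = ltrans μ f * g + f * ltrans μ g + dd k f * ltrans (dualD k μ) g := by
  simp only [ltrans_apply, map_mul, evL_mul hμ, counitL_comul]

/-- Translation by an ordinary point of the group is multiplicative: the braiding term contains a
derivative in the slot evaluated by φ. -/
theorem evL_mul_of_hom (φ : OGL k →ₐ[k] k) (hφ : ∀ f, φ (dd k f) = 0)
    (s t : BraidedSq k (OGL k)) :
    evL φ.toLinearMap (s * t) = evL φ.toLinearMap s * evL φ.toLinearMap t := by
  induction s using BraidedSq.ind with
  | h0 => simp
  | ha s s' h h' => simp only [add_mul, map_add, h, h']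
  | ht a b =>
    induction t using BraidedSq.ind with
    | h0 => simp
    | ha s s' h h' => simp only [mul_add, map_add, h, h']
    | ht c e => simp [hφ, smul_smul, mul_comm]

theorem ltrans_mul_of_hom (φ : OGL k →ₐ[k] k) (hφ : ∀ f, φ (dd k f) = 0) (f g : OGL k) :
    ltrans φ.toLinearMap (f * g) = ltrans φ.toLinearMap f * ltrans φ.toLinearMap g := by
  simp only [ltrans_apply, map_mul, evL_mul_of_hom φ hφ]

/-- Two functionals with the same product rule over a character agree if they agree on the
generators. -/
theorem derivation_ext (φ : OGL k →ₐ[k] k) {μ ν : Module.Dual k (OGL k)}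
    {β : OGL k → OGL k → k}
    (hμ : ∀ f g, μ (f * g) = μ f * φ g + φ f * μ g + β f g)
    (hν : ∀ f g, ν (f * g) = ν f * φ g + φ f * ν g + β f g)
    (h : ∀ x : Coord, μ (gen k (some x)) = ν (gen k (some x))) (f : OGL k) : μ f = ν f := by
  -- The common defect β cancels, so the difference is a derivation over φ. Its value at the inverse
  -- of A is then forced by its value at A.
  have hδ : ∀ f g, (μ - ν) (f * g) = (μ - ν) f * φ g + φ f * (μ - ν) g := fun f g => by
    simp only [LinearMap.sub_apply, hμ, hν]; ring
  have h1 : (μ - ν) 1 = 0 := by simpa using hδ 1 1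
  have main : (μ - ν) f = 0 := by
    induction f using OGL.ind with
    | hc c => rw [Algebra.algebraMap_eq_smul_one, map_smul, h1, smul_zero]
    | ha x y hx hy => rw [map_add, hx, hy, add_zero]
    | hm x y hx hy => rw [hδ, hx, hy, zero_mul, mul_zero, add_zero]
    | hg x =>
      cases x with
      | some x => rw [LinearMap.sub_apply, h x, sub_self]
      | none =>
        have h2 := hδ (Ai k) (A k)
        have h3 : φ (Ai k) * φ (A k) = 1 := by rw [← map_mul, Ai_mul_A, map_one]
        have h4 : (μ - ν) (A k) = 0 := by rw [LinearMap.sub_apply, h .A, sub_self]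
        rw [Ai_mul_A, h1, h4, mul_zero, add_zero] at h2
        exact (mul_eq_zero.mp h2.symm).resolve_right (right_ne_zero_of_mul_eq_one h3)
  exact sub_eq_zero.mp main

end Functionals

/-! ### Matrix coefficients detect subrepresentations and isomorphisms. -/

section Coefficients

variable {k : Type u} [Field k] [CharP k 2]

/-- The matrix coefficient `(1 ⊗ ψ)(ρ(v))`. -/
noncomputable def coef (V : GLRep k) (ψ : Module.Dual k V.carrier) : V.carrier →ₗ[k] OGL k :=
  (TensorProduct.rid k (OGL k)).toLinearMap ∘ₗ ψ.lTensor (OGL k) ∘ₗ V.coact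

theorem apply_coef (V : GLRep k) (ψ : Module.Dual k V.carrier) (v : V.carrier)
    (μ : Module.Dual k (OGL k)) : μ (coef V ψ v) = ψ (distAct V μ v) := by
  have h : ∀ t : OGL k ⊗[k] V.carrier, μ (TensorProduct.rid k _ (ψ.lTensor _ t)) =
      ψ (TensorProduct.lid k _ (μ.rTensor _ t)) := fun t => by
    induction t with
    | zero => simp
    | add x y hx hy => simp only [map_add, hx, hy]
    | tmul f x => simp [mul_comm]
  exact h _

theorem counit_coef (V : GLRep k) (ψ : Module.Dual k V.carrier) (v : V.carrier) :
    counit k (coef V ψ v) = ψ v :=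
  (apply_coef V ψ v (counit k).toLinearMap).trans (congrArg ψ (V.counit_coact v))

theorem distAct_counit (V : GLRep k) (v : V.carrier) :
    distAct V (counit k).toLinearMap v = v := V.counit_coact v

/-- Functionals separate the points of 𝒪, and both sides pair with ν to the action of the product of
ν and μ. Thus derivatives of a coefficient of v are coefficients of derivatives of v, which turns
stability of a subspace into vanishing of functions. -/
theorem coef_distAct (V : GLRep k) (ψ : Module.Dual k V.carrier) (v : V.carrier)
    (μ : Module.Dual k (OGL k)) : coef V ψ (distAct V μ v) = ltrans μ (coef V ψ v) := by
  refine sub_eq_zero.mp ((Module.forall_dual_apply_eq_zero_iff k _).mp fun ν => ?_)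
  rw [map_sub, apply_coef, apply_ltrans, apply_coef, distAct_conv, sub_self]

/-- An element of `𝒪 ⊗ V` is determined by its contractions with functionals on `V`. -/
theorem tensor_ext_dual {M : Type v} {N : Type*} [AddCommGroup M] [Module k M] [AddCommGroup N]
    [Module k N] {s t : M ⊗[k] N}
    (h : ∀ ψ : Module.Dual k N, ψ.lTensor M s = ψ.lTensor M t) : s = t := by
  let b := Module.Free.chooseBasis k N
  refine (TensorProduct.equivFinsuppOfBasisRight (M := M) b).injective ?_
  ext i
  have e : ∀ t : M ⊗[k] N, TensorProduct.equivFinsuppOfBasisRight b t i =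
      TensorProduct.rid k M ((b.coord i).lTensor M t) := fun t => by
    induction t with
    | zero => simp
    | add x y hx hy => simp only [map_add, Finsupp.add_apply, hx, hy]
    | tmul f x => simp
  rw [e, e, h]

theorem coact_ext {V : GLRep k} {s t : OGL k ⊗[k] V.carrier}
    (h : ∀ ψ : Module.Dual k V.carrier, TensorProduct.rid k _ (ψ.lTensor (OGL k) s) =
      TensorProduct.rid k _ (ψ.lTensor (OGL k) t)) : s = t :=
  tensor_ext_dual fun ψ => (TensorProduct.rid k _).injective (h ψ)

/-- An element of `M ⊗ N` lies in `M ⊗ W` if all functionals that vanish on `W` contract it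
to zero. -/
theorem mem_range_lTensor {M : Type v} {N : Type*} [AddCommGroup M] [Module k M] [AddCommGroup N]
    [Module k N] (W : Submodule k N) (t : M ⊗[k] N)
    (h : ∀ ψ : Module.Dual k N, (∀ w ∈ W, ψ w = 0) → ψ.lTensor M t = 0) :
    t ∈ LinearMap.range (W.subtype.lTensor M) := by
  -- By right exactness it is enough that t dies in M ⊗ N/W, and functionals on N/W pull back to
  -- functionals on N that vanish on W.
  have hex := lTensor_exact M (LinearMap.exact_subtype_mkQ W) W.mkQ_surjective
  refine (hex t).mp (tensor_ext_dual fun ψ => ?_)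
  rw [map_zero, ← LinearMap.lTensor_comp_apply]
  exact h _ fun w hw => by simp [(Submodule.Quotient.mk_eq_zero W).mpr hw]

/-- A `d`-stable subspace is a subrepresentation if the coefficients of its elements against
functionals that vanish on it are zero. -/
theorem isSub_of_coef {V : GLRep k} {W : Submodule k V.carrier} (hd : ∀ x ∈ W, dd k x ∈ W)
    (h : ∀ ψ : Module.Dual k V.carrier, (∀ w ∈ W, ψ w = 0) → ∀ w ∈ W, coef V ψ w = 0) :
    V.IsSub W :=
  ⟨hd, fun w hw => mem_range_lTensor W _ fun ψ hψ =>
    (TensorProduct.rid k _).injective ((h ψ hψ w hw).trans (map_zero _).symm)⟩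

/-- A subspace that is stable under `d` and all functionals is a subrepresentation. -/
theorem isSub_of_distAct {V : GLRep k} {W : Submodule k V.carrier} (hd : ∀ x ∈ W, dd k x ∈ W)
    (h : ∀ μ, ∀ w ∈ W, distAct V μ w ∈ W) : V.IsSub W :=
  isSub_of_coef hd fun ψ hψ w hw => (Module.forall_dual_apply_eq_zero_iff k _).mp fun μ => by
    rw [apply_coef, hψ _ (h μ w hw)]

/-- Converse to `isSub_of_distAct`. It transfers irreducibility from the restriction to the
representation. -/
theorem GLRep.IsSub.distAct_mem {V : GLRep k} {W : Submodule k V.carrier} (hW : V.IsSub W)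
    (μ : Module.Dual k (OGL k)) {w : V.carrier} (hw : w ∈ W) : distAct V μ w ∈ W := by
  obtain ⟨t, ht⟩ := hW.2 w hw
  have h : ∀ t : OGL k ⊗[k] W,
      TensorProduct.lid k _ (μ.rTensor _ (W.subtype.lTensor (OGL k) t)) ∈ W := fun t => by
    induction t with
    | zero => simp
    | add x y hx hy => simp only [map_add]; exact W.add_mem hx hy
    | tmul f x => simpa using W.smul_mem _ x.2
  have h2 := h t
  rw [ht] at h2
  exact h2

/-- A linear isomorphism that is compatible with `d` and with all matrix coefficients is an
isomorphism of representations. -/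
theorem iso_of_coef {V V' : GLRep k} (e : V.carrier ≃ₗ[k] V'.carrier)
    (hd : ∀ x, e (dd k x) = dd k (e x))
    (h : ∀ (ψ : Module.Dual k V'.carrier) (v : V.carrier),
      coef V (ψ ∘ₗ e.toLinearMap) v = coef V' ψ (e v)) : V.Iso V' :=
  ⟨e, hd, fun v => coact_ext fun ψ => by
    rw [← LinearMap.lTensor_comp_apply]
    exact (h ψ v).symm⟩

end Coefficients

end Ver4

namespace Ver4

universe u v

open OGL BraidedSq LaurentPolynomial

/-! ### Weights of the central torus. -/

section Weights

variable (k : Type u) [Field k] [CharP k 2]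

/-- Restriction of functions to the central torus of scalar matrices. -/
noncomputable def torus : OGL k →ₐ[k] k[T;T⁻¹] :=
  rawLift
    (fun x => match x with
      | some .A => T 1
      | none => T (-1)
      | _ => 0)
    (fun _ => 0) rfl rfl rfl rfl
    (fun x y => by rw [mul_comm]; simp)
    (by rw [← T_add]; simp) (by rw [← T_add]; simp)

@[simp] theorem torus_A : torus k (A k) = T 1 := rawLift_gen ..
@[simp] theorem torus_Ai : torus k (Ai k) = T (-1) := rawLift_gen ..
@[simp] theorem torus_B : torus k (B k) = 0 := rawLift_gen ..
@[simp] theorem torus_dA : torus k (dA k) = 0 := rawLift_gen ..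
@[simp] theorem torus_dB : torus k (dB k) = 0 := rawLift_gen ..

variable {k}

theorem torus_dd (f : OGL k) : torus k (dd k f) = 0 := map_dd_eq_zero _ (by simp) (by simp) f

variable (k) in
/-- The grading `f ↦ ∑ Tⁿ ⊗ fₙ` of `𝒪(GL(P))`. -/
noncomputable def grading : OGL k →ₐ[k] k[T;T⁻¹] ⊗[k] OGL k :=
  (pointL (torus k) torus_dd).comp (comulHom k)

theorem grading_gen (x : Coord) : grading k (gen k (some x)) = T 1 ⊗ₜ gen k (some x) := by
  cases x <;> simp [grading, TensorProduct.add_tmul]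

/-- The torus of scalar matrices is central. -/
theorem grading_eq_pointR : grading k = (pointR (torus k) torus_dd).comp (comulHom k) := by
  refine hom_ext fun x => ?_
  rw [grading_gen]
  cases x <;> simp [TensorProduct.tmul_add]

variable (k) in
/-- The coefficient of `Tⁿ`. -/
noncomputable def coeffT (n : ℤ) : k[T;T⁻¹] →ₗ[k] k where
  toFun p := p.coeff n
  map_add' _ _ := by simp
  map_smul' _ _ := by simp

@[simp] theorem coeffT_T (n m : ℤ) : coeffT k n (T m) = if m = n then 1 else 0 := by
  exact T_apply n m

/-- A linear map from Laurent polynomials is determined by its values on monomials. -/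
theorem laurent_hom_ext {M : Type v} [AddCommGroup M] [Module k M] {α β : k[T;T⁻¹] →ₗ[k] M}
    (h : ∀ n, α (T n) = β (T n)) (p : k[T;T⁻¹]) : α p = β p := by
  induction p using LaurentPolynomial.induction_on' with
  | add p q hp hq => rw [map_add, map_add, hp, hq]
  | C_mul_T n a => rw [← smul_eq_C_mul, map_smul, map_smul, h]

theorem laurent_ext {p q : k[T;T⁻¹]} (h : ∀ n, coeffT k n p = coeffT k n q) : p = q :=
  LaurentPolynomial.ext h

/-- The functional that projects to the weight `n`. -/
noncomputable def weightProj (n : ℤ) : Module.Dual k (OGL k) :=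
  coeffT k n ∘ₗ (torus k).toLinearMap

/-- Centrality of the torus: restricting the left or the right factor of the comultiplication to it
gives the same map. Hence weight projections commute with all distributions. -/
theorem conv_weightProj (n : ℤ) (μ : Module.Dual k (OGL k)) :
    conv k (weightProj n) μ = conv k μ (weightProj n) := by
  ext f
  have h1 : ∀ s, ev μ (weightProj n) s = LinearMap.mul' k k
      (TensorProduct.map (coeffT k n) μ (pointR (torus k) torus_dd s)) := fun s => by
    induction s using BraidedSq.ind with
    | h0 => simp
    | ha s s' h h' => simp only [map_add, h, h']
    | ht a b => simp [weightProj, mul_comm]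
  have h2 : ∀ s, ev (weightProj n) μ s = LinearMap.mul' k k
      (TensorProduct.map (coeffT k n) μ (pointL (torus k) torus_dd s)) := fun s => by
    induction s using BraidedSq.ind with
    | h0 => simp
    | ha s s' h h' => simp only [map_add, h, h']
    | ht a b => simp [weightProj]
  have h3 := DFunLike.congr_fun (@grading_eq_pointR k _ _) f
  rw [conv_apply, conv_apply, h1, h2]
  exact congrArg _ (congrArg _ h3.symm)

/-- Restriction to the torus is compatible with comultiplication and Tⁿ is group-like, so the
coefficient functionals are orthogonal idempotents. -/
theorem conv_weightProj_weightProj (n m : ℤ) :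
    conv k (weightProj n) (weightProj m) = if m = n then weightProj n else 0 := by
  ext f
  have h1 : ∀ s, ev (weightProj m) (weightProj n) s = LinearMap.mul' k k
      (TensorProduct.map (coeffT k m) (coeffT k n) (Algebra.TensorProduct.map
        (AlgHom.id k k[T;T⁻¹]) (torus k) (pointL (torus k) torus_dd s))) := fun s => by
    induction s using BraidedSq.ind with
    | h0 => simp
    | ha s s' h h' => simp only [map_add, h, h']
    | ht a b => simp [weightProj]
  have h2 : ((Algebra.TensorProduct.map (AlgHom.id k k[T;T⁻¹]) (torus k)).comp
      (grading k)) = (Bialgebra.comulAlgHom k k[T;T⁻¹]).comp (torus k) := by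
    refine hom_ext fun x => ?_
    rw [AlgHom.comp_apply, grading_gen]
    cases x <;> simp
  have h3 := DFunLike.congr_fun h2 f
  rw [AlgHom.comp_apply, grading, AlgHom.comp_apply, AlgHom.comp_apply] at h3
  rw [conv_apply, h1, h3]
  have h4 := laurent_hom_ext (k := k) (α := LinearMap.mul' k k ∘ₗ
    TensorProduct.map (coeffT k m) (coeffT k n) ∘ₗ
      (Bialgebra.comulAlgHom k k[T;T⁻¹]).toLinearMap)
    (β := if m = n then coeffT k n else 0) (fun l => by
      by_cases hm : m = n
      · subst hm; simp
      · by_cases hl : l = n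
        · subst hl; simp [hm, Ne.symm hm]
        · simp [hm, hl]) (torus k f)
  refine h4.trans ?_
  split_ifs <;> simp [weightProj]

/-- The scalar matrices act on `V` by the character `tⁿ`. -/
def HasWeight (V : GLRep k) (n : ℤ) : Prop :=
  ∀ v : V.carrier, (torus k).toLinearMap.rTensor V.carrier (V.coact v) = T n ⊗ₜ v

theorem rid_lTensor_rTensor {S M N : Type*} [AddCommGroup S] [Module k S] [AddCommGroup M]
    [Module k M] [AddCommGroup N] [Module k N] (φ : M →ₗ[k] S) (ψ : N →ₗ[k] k) (t : M ⊗[k] N) :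
    TensorProduct.rid k S (ψ.lTensor S (φ.rTensor N t)) =
      φ (TensorProduct.rid k M (ψ.lTensor M t)) := by
  induction t with
  | zero => simp
  | add x y hx hy => simp only [map_add, hx, hy]
  | tmul f x => simp

theorem HasWeight.torus_coef {V : GLRep k} {n : ℤ} (h : HasWeight V n)
    (ψ : Module.Dual k V.carrier) (v : V.carrier) : torus k (coef V ψ v) = ψ v • T n := by
  have h1 := rid_lTensor_rTensor (torus k).toLinearMap ψ (V.coact v)
  rw [h v] at h1
  refine h1.symm.trans ?_
  simp

theorem hasWeight_of_torus_coef {V : GLRep k} {n : ℤ}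
    (h : ∀ ψ v, torus k (coef V ψ v) = ψ v • T n) : HasWeight V n := fun v => by
  refine tensor_ext_dual fun ψ => (TensorProduct.rid k _).injective ?_
  rw [rid_lTensor_rTensor]
  refine (h ψ v).trans ?_
  simp

/-- The braiding correction in the tensor product coaction involves a derivative, which restricts to
zero on the torus; what is left is multiplication of characters. -/
theorem HasWeight.tensor {V W : GLRep k} {n m : ℤ} (hV : HasWeight V n) (hW : HasWeight W m) :
    HasWeight (V.tensor W) (n + m) := by
  have h : ∀ p q, (torus k).toLinearMap.rTensor _ (coMul k (p ⊗ₜ q)) =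
      (LinearMap.mul' k k[T;T⁻¹]).rTensor _ (TensorProduct.tensorTensorTensorComm k _ _ _ _
        ((torus k).toLinearMap.rTensor V.carrier p ⊗ₜ
          (torus k).toLinearMap.rTensor W.carrier q)) := by
    intro p q
    induction p with
    | zero => simp
    | add x y hx hy => simp only [TensorProduct.add_tmul, map_add, hx, hy]
    | tmul f x =>
      induction q with
      | zero => simp
      | add x y hx hy => simp only [TensorProduct.tmul_add, map_add, hx, hy]
      | tmul g y => simp [torus_dd]
  have key : ∀ t : V.carrier ⊗[k] W.carrier, (torus k).toLinearMap.rTensor _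
      (coMul k (TensorProduct.map V.coact W.coact t)) = T (n + m) ⊗ₜ t := fun t => by
    induction t with
    | zero => simp
    | add x y hx hy => rw [map_add, map_add, map_add, hx, hy, TensorProduct.tmul_add]
    | tmul x y =>
      rw [TensorProduct.map_tmul, h, hV x, hW y, T_add,
        TensorProduct.tensorTensorTensorComm_tmul, LinearMap.rTensor_tmul, LinearMap.mul'_apply]
  exact key

theorem dualD_weightProj (n : ℤ) : dualD k (weightProj n) = 0 := by
  ext f; simp [dualD, weightProj, torus_dd]

/-- An irreducible representation has a weight. -/
theorem exists_hasWeight {V : GLRep k} (hV : V.Irreducible) : ∃ n, HasWeight V n := by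
  obtain ⟨v, hv⟩ := @exists_ne _ hV.1 (0 : V.carrier)
  have hex : ∃ n, distAct V (weightProj n) v ≠ 0 := by
    by_contra hcon
    push Not at hcon
    refine hv ((Module.forall_dual_apply_eq_zero_iff k v).mp fun ψ => ?_)
    -- If all weight components of v vanished, its coefficients would vanish on the torus, hence at
    -- the identity, where the coefficient against ψ is ψ(v).
    have h0 : torus k (coef V ψ v) = 0 := laurent_ext fun n => by
      have h := apply_coef V ψ v (weightProj n)
      rw [hcon n, map_zero] at h
      simpa [weightProj] using h
    have hc : counit k = (Bialgebra.counitAlgHom k k[T;T⁻¹]).comp (torus k) :=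
      hom_ext fun x => by cases x <;> simp
    rw [← counit_coef, hc, AlgHom.comp_apply, h0, map_zero]
  obtain ⟨n, hn⟩ := hex
  refine ⟨n, hasWeight_of_torus_coef fun ψ w => laurent_ext fun m => ?_⟩
  have hcomm : ∀ (m : ℤ) (μ : Module.Dual k (OGL k)) (w : V.carrier),
      distAct V (weightProj m) (distAct V μ w) = distAct V μ (distAct V (weightProj m) w) :=
    fun m μ w => by rw [← distAct_conv, conv_weightProj, distAct_conv]
  -- The weight space is stable because the projection commutes with d and with every distribution.
  -- By irreducibility it is everything.
  have hsub : V.IsSub (LinearMap.range (distAct V (weightProj n))) := by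
    refine isSub_of_distAct ?_ ?_
    · rintro _ ⟨x, rfl⟩
      refine ⟨dd k x, ?_⟩
      rw [distAct_dd, dualD_weightProj]
      simp [distAct]
    · rintro μ _ ⟨x, rfl⟩
      exact ⟨distAct V μ x, hcomm n μ x⟩
  have htop := (hV.2 _ hsub).resolve_left fun h => hn ((Submodule.mem_bot k).mp
    (h ▸ LinearMap.mem_range_self _ v))
  have hm : ∀ m, distAct V (weightProj m) w = if m = n then w else 0 := fun m => by
    obtain ⟨x, rfl⟩ : w ∈ LinearMap.range (distAct V (weightProj n)) := htop ▸ Submodule.mem_top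
    rw [← distAct_conv, conv_weightProj_weightProj]
    by_cases hmn : m = n
    · simp [hmn]
    · simp [hmn, Ne.symm hmn, distAct]
  have h := apply_coef V ψ w (weightProj m)
  rw [hm] at h
  refine h.trans ?_
  split_ifs with hmn
  · simp [hmn]
  · simp [Ne.symm hmn]

end Weights

end Ver4

namespace Ver4

universe u v

open OGL BraidedSq

/-! ### Normal forms of functions on GL(P). -/

section NormalForm

variable {k : Type u} [Field k] [CharP k 2]

theorem dA_mul (f : OGL k) : dA k * f = f * dA k := by simpa using dd_central k (A k) f

theorem dB_mul (f : OGL k) : dB k * f = f * dB k := by simpa using dd_central k (B k) f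

theorem dA_dB_mul (f : OGL k) : dA k * dB k * f = f * (dA k * dB k) := by
  rw [mul_assoc, dB_mul f, ← mul_assoc, dA_mul f, mul_assoc]

/-- Derivatives lie in the ideal generated by the central square-zero elements A' and B', and this
ideal annihilates A'B'. -/
theorem dd_mul_dA_dB (f : OGL k) : dd k f * (dA k * dB k) = 0 := by
  have hc := dA_dB_mul (k := k)
  have hA : dA k * (dA k * dB k) = 0 := r6' k _
  induction f using OGL.ind with
  | hc c => simp
  | ha x y hx hy => rw [map_add, add_mul, hx, hy, add_zero]
  | hm x y hx hy => rw [dd_mul, add_mul, mul_assoc, ← hc y, ← mul_assoc, hx, mul_assoc, hy]; simp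
  | hg x =>
    cases x with
    | none =>
      have h : dd k (Ai k) = -(Ai k * dA k * Ai k) := diff_Ai k
      rw [h, neg_mul, mul_assoc, ← hc, mul_assoc, ← mul_assoc (dA k), hA]; simp
    | some x => cases x <;> simp [hA, r5, r7, r5', r7']

/-- After multiplication with `A'B'` all functions commute. -/
theorem mul_comm_dA_dB (f g : OGL k) : f * g * (dA k * dB k) = g * f * (dA k * dB k) := by
  rw [mul_comm_d k f g, add_mul, mul_assoc (dd k g), dd_mul_dA_dB, mul_zero, add_zero]

variable (k) in
/-- The function `A⁻¹B`. -/
def slope : OGL k := Ai k * B k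

/-- The functions `Aᵐ h(A⁻¹B)`. -/
noncomputable def basicFun (m : ℤ) : Polynomial k →ₗ[k] OGL k :=
  LinearMap.mulLeft k ((unitA k ^ m : (OGL k)ˣ) : OGL k) ∘ₗ
    (Polynomial.aeval (slope k)).toLinearMap

theorem basicFun_apply (m : ℤ) (h : Polynomial k) :
    basicFun m h = ((unitA k ^ m : (OGL k)ˣ) : OGL k) * Polynomial.aeval (slope k) h := rfl

theorem zpow_mul_A (m : ℤ) : ((unitA k ^ m : (OGL k)ˣ) : OGL k) * A k =
    ((unitA k ^ (m + 1) : (OGL k)ˣ) : OGL k) := by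
  rw [zpow_add_one, Units.val_mul]; rfl

theorem zpow_mul_Ai (m : ℤ) : ((unitA k ^ m : (OGL k)ˣ) : OGL k) * Ai k =
    ((unitA k ^ (m - 1) : (OGL k)ˣ) : OGL k) := by
  rw [zpow_sub_one, Units.val_mul]; rfl

theorem basicFun_mul_slope (m : ℤ) (h : Polynomial k) :
    basicFun m h * slope k = basicFun m (h * Polynomial.X) := by
  rw [basicFun_apply, basicFun_apply, map_mul, Polynomial.aeval_X, mul_assoc]

/-- A and A⁻¹B commute up to A⁻¹A'B', and multiples of A'B' commute with everything, so only a
first-order correction appears. The g built by the induction is the derivative of h. -/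
theorem aeval_slope_mul_A (h : Polynomial k) : ∃ g : Polynomial k,
    Polynomial.aeval (slope k) h * A k = A k * Polynomial.aeval (slope k) h +
      Ai k * Polynomial.aeval (slope k) g * (dA k * dB k) := by
  have hb : slope k * A k = A k * slope k + Ai k * (dA k * dB k) := by
    rw [slope, mul_assoc, r8, mul_add, ← mul_assoc, Ai_mul_A, ← mul_assoc (A k), A_mul_Ai]
  induction h using Polynomial.induction_on' with
  | add p q hp hq =>
    obtain ⟨g, hg⟩ := hp
    obtain ⟨g', hg'⟩ := hq
    refine ⟨g + g', ?_⟩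
    simp only [map_add, add_mul, mul_add, hg, hg']
    abel
  | monomial n a =>
    induction n with
    | zero =>
      refine ⟨0, ?_⟩
      rw [Polynomial.monomial_zero_left, Polynomial.aeval_C, Algebra.commutes]; simp
    | succ n ih =>
      obtain ⟨g, hg⟩ := ih
      refine ⟨g * Polynomial.X + Polynomial.monomial n a, ?_⟩
      rw [← Polynomial.monomial_mul_X, map_mul, Polynomial.aeval_X, mul_assoc, hb, mul_add,
        ← mul_assoc, hg, add_mul, map_add, map_mul, Polynomial.aeval_X, mul_add (Ai k), add_mul,
        mul_assoc (A k), ← mul_assoc _ (Ai k), mul_comm_dA_dB _ (Ai k), add_assoc]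
      congr 2
      rw [mul_assoc, dA_dB_mul]
      simp only [mul_assoc]

theorem basicFun_mul_A (m : ℤ) (h : Polynomial k) : ∃ g : Polynomial k,
    basicFun m h * A k = basicFun (m + 1) h + basicFun (m - 1) g * (dA k * dB k) := by
  obtain ⟨g, hg⟩ := aeval_slope_mul_A h
  refine ⟨g, ?_⟩
  rw [basicFun_apply, mul_assoc, hg, mul_add, ← mul_assoc, zpow_mul_A, mul_assoc (Ai k),
    ← mul_assoc _ (Ai k), zpow_mul_Ai, ← mul_assoc _ _ (dA k * dB k)]
  rfl

theorem basicFun_mul_Ai (m : ℤ) (h : Polynomial k) : ∃ g : Polynomial k,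
    basicFun m h * Ai k = basicFun (m - 1) h + basicFun (m - 3) g * (dA k * dB k) := by
  obtain ⟨g, hg⟩ := aeval_slope_mul_A h
  refine ⟨g, ?_⟩
  have h0 : Polynomial.aeval (slope k) h * Ai k = Ai k * Polynomial.aeval (slope k) h +
      Ai k * Ai k * Ai k * Polynomial.aeval (slope k) g * (dA k * dB k) := by
    -- Conjugating the relation for A by A⁻¹ gives the relation for A⁻¹. The correction picks up two
    -- more factors A⁻¹, whence the shift m - 3, and its sign is irrelevant in characteristic 2.
    have h1 := congrArg (fun t => Ai k * t * Ai k) hg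
    simp only [mul_add, add_mul] at h1
    rw [mul_assoc, mul_assoc _ (A k), A_mul_Ai, mul_one, ← mul_assoc (Ai k) (A k), Ai_mul_A,
      one_mul] at h1
    rw [h1, add_assoc]
    refine (add_eq_left.mpr ?_).symm
    rw [mul_assoc (Ai k), mul_assoc (Ai k * _), dA_dB_mul, ← mul_assoc (Ai k * _) (Ai k),
      mul_comm_dA_dB _ (Ai k)]
    simp only [mul_assoc]
    exact add_self_zero k _
  rw [basicFun_apply, mul_assoc, h0, mul_add]
  simp only [← mul_assoc]
  rw [zpow_mul_Ai, zpow_mul_Ai, zpow_mul_Ai, sub_sub, sub_sub]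
  rfl

/-- The functions of weight `m` in normal form. -/
noncomputable def normalForm (m : ℤ) : Submodule k (OGL k) :=
  LinearMap.range (basicFun (k := k) m) ⊔
  LinearMap.range (LinearMap.mulRight k (dA k) ∘ₗ basicFun (m - 1)) ⊔
  LinearMap.range (LinearMap.mulRight k (dB k) ∘ₗ basicFun (m - 1)) ⊔
  LinearMap.range (LinearMap.mulRight k (dA k * dB k) ∘ₗ basicFun (m - 2))

theorem mem_normalForm {m : ℤ} {f : OGL k} : f ∈ normalForm m ↔ ∃ p q r s : Polynomial k,
    f = basicFun m p + basicFun (m - 1) q * dA k + basicFun (m - 1) r * dB k +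
      basicFun (m - 2) s * (dA k * dB k) := by
  simp only [normalForm, Submodule.mem_sup, LinearMap.mem_range]
  constructor
  · rintro ⟨_, ⟨_, ⟨_, ⟨p, rfl⟩, _, ⟨q, rfl⟩, rfl⟩, _, ⟨r, rfl⟩, rfl⟩, _, ⟨s, rfl⟩, rfl⟩
    exact ⟨p, q, r, s, rfl⟩
  · rintro ⟨p, q, r, s, rfl⟩
    exact ⟨_, ⟨_, ⟨_, ⟨p, rfl⟩, _, ⟨q, rfl⟩, rfl⟩, _, ⟨r, rfl⟩, rfl⟩, _, ⟨s, rfl⟩, rfl⟩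

theorem normalForm_mul_dA {m : ℤ} {f : OGL k} (hf : f ∈ normalForm m) :
    f * dA k ∈ normalForm (m + 1) := by
  obtain ⟨p, q, r, s, rfl⟩ := mem_normalForm.mp hf
  refine mem_normalForm.mpr ⟨0, p, 0, r, ?_⟩
  simp only [add_mul, mul_assoc, r5, r6, r6', map_zero, zero_mul, mul_zero, add_zero, zero_add]
  rw [add_sub_cancel_right, show m + 1 - 2 = m - 1 by ring]

theorem normalForm_mul_dB {m : ℤ} {f : OGL k} (hf : f ∈ normalForm m) :
    f * dB k ∈ normalForm (m + 1) := by
  obtain ⟨p, q, r, s, rfl⟩ := mem_normalForm.mp hf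
  refine mem_normalForm.mpr ⟨0, 0, p, q, ?_⟩
  simp only [add_mul, mul_assoc, r7, r7', map_zero, zero_mul, mul_zero, add_zero, zero_add]
  rw [add_sub_cancel_right, show m + 1 - 2 = m - 1 by ring]

theorem normalForm_mul_slope {m : ℤ} {f : OGL k} (hf : f ∈ normalForm m) :
    f * slope k ∈ normalForm m := by
  obtain ⟨p, q, r, s, rfl⟩ := mem_normalForm.mp hf
  refine mem_normalForm.mpr ⟨p * .X, q * .X, r * .X, s * .X, ?_⟩
  simp only [← basicFun_mul_slope, add_mul]
  rw [mul_assoc _ (dA k), mul_assoc _ (dB k), mul_assoc _ (dA k * dB k), dA_mul, dB_mul, dA_dB_mul]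
  simp only [mul_assoc]

theorem normalForm_mul_A {m : ℤ} {f : OGL k} (hf : f ∈ normalForm m) :
    f * A k ∈ normalForm (m + 1) := by
  obtain ⟨p, q, r, s, rfl⟩ := mem_normalForm.mp hf
  obtain ⟨p', hp⟩ := basicFun_mul_A m p
  obtain ⟨q', hq⟩ := basicFun_mul_A (m - 1) q
  obtain ⟨r', hr⟩ := basicFun_mul_A (m - 1) r
  obtain ⟨s', hs⟩ := basicFun_mul_A (m - 2) s
  -- Only the correction p' survives, in the A'B' component. The corrections q', r', s' carry a
  -- further factor A', B' or A'B', which annihilates A'B'.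
  refine mem_normalForm.mpr ⟨p, q, r, p' + s, ?_⟩
  rw [add_mul, add_mul, add_mul, mul_assoc _ (dA k) (A k), dA_mul (A k),
    mul_assoc _ (dB k) (A k), dB_mul (A k), mul_assoc _ (dA k * dB k) (A k), dA_dB_mul (A k),
    ← mul_assoc _ (A k), ← mul_assoc _ (A k),
    ← mul_assoc _ (A k), hp, hq, hr, hs]
  simp only [add_mul, mul_assoc, r5, r5', r6, r6', r7, r7', mul_zero, add_zero, map_add, sub_add_cancel,
    add_sub_cancel_right]
  rw [show m + 1 - 2 = m - 1 by ring, show m - 2 + 1 = m - 1 by ring]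
  abel

theorem normalForm_mul_Ai {m : ℤ} {f : OGL k} (hf : f ∈ normalForm m) :
    f * Ai k ∈ normalForm (m - 1) := by
  obtain ⟨p, q, r, s, rfl⟩ := mem_normalForm.mp hf
  obtain ⟨p', hp⟩ := basicFun_mul_Ai m p
  obtain ⟨q', hq⟩ := basicFun_mul_Ai (m - 1) q
  obtain ⟨r', hr⟩ := basicFun_mul_Ai (m - 1) r
  obtain ⟨s', hs⟩ := basicFun_mul_Ai (m - 2) s
  refine mem_normalForm.mpr ⟨p, q, r, p' + s, ?_⟩
  rw [add_mul, add_mul, add_mul, mul_assoc _ (dA k) (Ai k), dA_mul (Ai k),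
    mul_assoc _ (dB k) (Ai k), dB_mul (Ai k), mul_assoc _ (dA k * dB k) (Ai k), dA_dB_mul (Ai k),
    ← mul_assoc _ (Ai k), ← mul_assoc _ (Ai k), ← mul_assoc _ (Ai k), hp, hq, hr, hs]
  simp only [add_mul, mul_assoc, r5, r5', r6, r6', r7, r7', mul_zero, add_zero, map_add]
  rw [show m - 1 - 2 = m - 3 by ring, show m - 2 - 1 = m - 3 by ring]
  abel

/-- Every function is a sum of functions in normal form. -/
theorem iSup_normalForm (f : OGL k) : f ∈ ⨆ m, normalForm (k := k) m := by
  -- The sum of the normal forms contains 1, so stability under right multiplication by the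
  -- generators suffices. Linear independence of the normal forms is not needed.
  have step : ∀ x : OGL k, (∀ m, ∀ g ∈ normalForm m, g * x ∈ ⨆ m, normalForm (k := k) m) →
      ∀ g ∈ ⨆ m, normalForm (k := k) m, g * x ∈ ⨆ m, normalForm (k := k) m := fun x hx g hg => by
    induction hg using Submodule.iSup_induction' with
    | mem m g hg => exact hx m g hg
    | zero => rw [zero_mul]; exact Submodule.zero_mem _
    | add g g' _ _ h h' => rw [add_mul]; exact Submodule.add_mem _ h h'
  have hsub : ∀ m, normalForm (k := k) m ≤ ⨆ m, normalForm (k := k) m := le_iSup _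
  have main : ∀ g ∈ ⨆ m, normalForm (k := k) m, g * f ∈ ⨆ m, normalForm (k := k) m := by
    induction f using OGL.ind with
    | hc c =>
      intro g hg
      rw [← Algebra.commutes, ← Algebra.smul_def]
      exact Submodule.smul_mem _ _ hg
    | ha x y hx hy => intro g hg; rw [mul_add]; exact Submodule.add_mem _ (hx g hg) (hy g hg)
    | hm x y hx hy => intro g hg; rw [← mul_assoc]; exact hy _ (hx g hg)
    | hg x =>
      refine step _ fun m g hg => ?_
      cases x with
      | none => exact hsub _ (normalForm_mul_Ai hg)
      | some x =>
        cases x with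
        | A => exact hsub _ (normalForm_mul_A hg)
        | dA => exact hsub _ (normalForm_mul_dA hg)
        | dB => exact hsub _ (normalForm_mul_dB hg)
        | B =>
          -- B is the product of A and A⁻¹B.
          have h := normalForm_mul_slope (normalForm_mul_A hg)
          rw [slope, mul_assoc, ← mul_assoc (A k), A_mul_Ai, one_mul] at h
          exact hsub _ h
  have h := main 1 (hsub 0 (mem_normalForm.mpr ⟨1, 0, 0, 0, by simp [basicFun_apply]⟩))
  rwa [one_mul] at h

end NormalForm

end Ver4

namespace Ver4

universe u v

open OGL BraidedSq LaurentPolynomial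

/-! ### Functions are determined by values and Lie derivatives at unipotent points. -/

section HarishChandra

variable {k : Type u} [Field k] [CharP k 2]

theorem val_zpow_unitA_induction {p : ℤ → OGL k → Prop} (h0 : p 0 1)
    (h1 : ∀ n f, p n f → p (n + 1) (f * A k)) (h2 : ∀ n f, p n f → p (n - 1) (f * Ai k)) (n : ℤ) :
    p n ((unitA k ^ n : (OGL k)ˣ) : OGL k) := by
  induction n using Int.induction_on with
  | zero => simpa using h0
  | succ i ih => rw [← zpow_mul_A]; exact h1 _ _ ih
  | pred i ih => rw [← zpow_mul_Ai]; exact h2 _ _ ih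

theorem grading_A : grading k (A k) = T 1 ⊗ₜ A k := grading_gen .A

theorem grading_Ai : grading k (Ai k) = T (-1) ⊗ₜ Ai k := by
  have h1 : grading k (Ai k) * (T 1 ⊗ₜ A k) = 1 := by
    rw [← grading_A, ← map_mul, Ai_mul_A, map_one]
  have h2 : (T 1 ⊗ₜ A k : k[T;T⁻¹] ⊗[k] OGL k) * (T (-1) ⊗ₜ Ai k) = 1 := by
    rw [Algebra.TensorProduct.tmul_mul_tmul, ← T_add, A_mul_Ai, add_neg_cancel, T_zero]; rfl
  exact left_inv_eq_right_inv h1 h2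

theorem grading_zpow (n : ℤ) : grading k ((unitA k ^ n : (OGL k)ˣ) : OGL k) =
    T n ⊗ₜ ((unitA k ^ n : (OGL k)ˣ) : OGL k) := by
  refine val_zpow_unitA_induction (p := fun n f => grading k f = T n ⊗ₜ f) ?_ ?_ ?_ n
  · rw [map_one, T_zero]; rfl
  · intro n f h
    rw [map_mul, h, grading_A, Algebra.TensorProduct.tmul_mul_tmul, ← T_add]
  · intro n f h
    rw [map_mul, h, grading_Ai, Algebra.TensorProduct.tmul_mul_tmul, ← T_add]
    rfl

theorem grading_aeval_slope (h : Polynomial k) : grading k (Polynomial.aeval (slope k) h) =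
    1 ⊗ₜ Polynomial.aeval (slope k) h := by
  have hs : grading k (slope k) = 1 ⊗ₜ slope k := by
    have hB : grading k (B k) = T 1 ⊗ₜ B k := grading_gen .B
    rw [slope, map_mul, grading_Ai, hB, Algebra.TensorProduct.tmul_mul_tmul, ← T_add,
      neg_add_cancel, T_zero]
  rw [← Polynomial.aeval_algHom_apply, hs]
  exact Polynomial.aeval_algHom_apply (Algebra.TensorProduct.includeRight :
    OGL k →ₐ[k] k[T;T⁻¹] ⊗[k] OGL k) (slope k) h

theorem grading_normalForm {m : ℤ} {f : OGL k} (hf : f ∈ normalForm m) :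
    grading k f = T m ⊗ₜ f := by
  have hb : ∀ (m : ℤ) (h : Polynomial k), grading k (basicFun m h) = T m ⊗ₜ basicFun m h :=
    fun m h => by
      rw [basicFun_apply, map_mul, grading_zpow, grading_aeval_slope,
        Algebra.TensorProduct.tmul_mul_tmul, mul_one]
  have hA : grading k (dA k) = T 1 ⊗ₜ dA k := grading_gen .dA
  have hB : grading k (dB k) = T 1 ⊗ₜ dB k := grading_gen .dB
  obtain ⟨p, q, r, s, rfl⟩ := mem_normalForm.mp hf
  simp only [map_add, map_mul, hb, hA, hB, Algebra.TensorProduct.tmul_mul_tmul, ← T_add,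
    TensorProduct.tmul_add]
  rw [sub_add_cancel, one_add_one_eq_two, sub_add_cancel]

theorem ltrans_weightProj (n : ℤ) (f : OGL k) : ltrans (weightProj n) f =
    TensorProduct.lid k _ ((coeffT k n).rTensor _ (grading k f)) := by
  have h : ∀ s, evL (weightProj n) s =
      TensorProduct.lid k _ ((coeffT k n).rTensor _ (pointL (torus k) torus_dd s)) := fun s => by
    induction s using BraidedSq.ind with
    | h0 => simp
    | ha s s' h h' => simp only [map_add, h, h']
    | ht a b => simp [weightProj]
  exact h _

/-- A function of weight `n` can be written in normal form. -/
theorem mem_normalForm_of_weight {n : ℤ} {f : OGL k} (hf : ltrans (weightProj n) f = f) :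
    f ∈ normalForm n := by
  have h : ∀ g ∈ ⨆ m, normalForm (k := k) m, ltrans (weightProj n) g ∈ normalForm n :=
    fun g hg => by
    induction hg using Submodule.iSup_induction' with
    | zero => rw [map_zero]; exact Submodule.zero_mem _
    | add g g' _ _ h h' => rw [map_add]; exact Submodule.add_mem _ h h'
    | mem m g hg =>
      -- Normal forms are homogeneous: the projection keeps those of weight n and kills the others.
      rw [ltrans_weightProj, grading_normalForm hg]
      by_cases hm : m = n
      · subst hm; simpa using hg
      · simp [hm]
  rw [← hf]
  exact h f (iSup_normalForm f)

variable (k) in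
/-- The point `(1 0; c 1)` of `GL(P)`. -/
def unip (c : k) : OGL k →ₐ[k] k := lift 1 c

@[simp] theorem unip_A (c : k) : unip k c (A k) = 1 := lift_A ..
@[simp] theorem unip_B (c : k) : unip k c (B k) = c := lift_B ..
@[simp] theorem unip_dA (c : k) : unip k c (dA k) = 0 := lift_dA ..
@[simp] theorem unip_dB (c : k) : unip k c (dB k) = 0 := lift_dB ..
theorem unip_dd (c : k) (f : OGL k) : unip k c (dd k f) = 0 :=
  map_dd_eq_zero _ (by simp) (by simp) f

@[simp] theorem unip_Ai (c : k) : unip k c (Ai k) = 1 := by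
  have h : unip k c (A k * Ai k) = 1 := by rw [A_mul_Ai, map_one]
  rwa [map_mul, unip_A, one_mul] at h

@[simp] theorem unip_zpow (c : k) (n : ℤ) :
    unip k c ((unitA k ^ n : (OGL k)ˣ) : OGL k) = 1 := by
  refine val_zpow_unitA_induction (p := fun n f => unip k c f = 1) (map_one _) ?_ ?_ n
  · intro n f h; rw [map_mul, h, unip_A, one_mul]
  · intro n f h; rw [map_mul, h, unip_Ai, one_mul]

@[simp] theorem unip_basicFun (c : k) (m : ℤ) (h : Polynomial k) :
    unip k c (basicFun m h) = h.eval c := by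
  have hs : unip k c (slope k) = c := by rw [slope, map_mul, unip_Ai, unip_B, one_mul]
  rw [basicFun_apply, map_mul, unip_zpow, one_mul, ← Polynomial.aeval_algHom_apply, hs,
    Polynomial.coe_aeval_eq_eval]

/-- A derivation over a point of the unipotent group that kills `A` and `B`. -/
theorem derivation_basicFun {c : k} {D : OGL k →ₗ[k] k}
    (hD : ∀ f g, D (f * g) = D f * unip k c g + unip k c f * D g) (hA : D (A k) = 0)
    (hB : D (B k) = 0) (m : ℤ) (h : Polynomial k) : D (basicFun m h) = 0 := by
  have h1 : D 1 = 0 := by simpa using hD 1 1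
  have hAi : D (Ai k) = 0 := by
    have h := hD (Ai k) (A k)
    rw [Ai_mul_A, h1, hA, unip_A] at h
    simpa using h.symm
  have hs : D (slope k) = 0 := by rw [slope, hD, hAi, hB]; simp
  have hz : D ((unitA k ^ m : (OGL k)ˣ) : OGL k) = 0 := by
    refine val_zpow_unitA_induction (p := fun _ f => D f = 0) h1 ?_ ?_ m
    · intro n f h; rw [hD, h, hA]; simp
    · intro n f h; rw [hD, h, hAi]; simp
  have hp : D (Polynomial.aeval (slope k) h) = 0 := by
    induction h using Polynomial.induction_on' with
    | add p q hp hq => rw [map_add, map_add, hp, hq, add_zero]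
    | monomial n a =>
      induction n with
      | zero =>
        rw [Polynomial.monomial_zero_left, Polynomial.aeval_C, Algebra.algebraMap_eq_smul_one,
          map_smul, h1, smul_zero]
      | succ n ih =>
        rw [← Polynomial.monomial_mul_X, map_mul, Polynomial.aeval_X, hD, ih, hs]; simp
  rw [basicFun_apply, hD, hz, hp]; simp

/-- The distribution given by an element of `gl(P)`. -/
noncomputable abbrev dist (X : GlP k) : Module.Dual k (OGL k) := (glToLie k X).1

theorem dist_mem (X : GlP k) : dist X ∈ lieGL k := (glToLie k X).2

theorem dualD_dist (X : GlP k) : dualD k (dist X) = dist (dd k X) := (glToLie_dd k X).symm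

theorem ltrans_dist (p q r s : k) :
    ltrans (dist !![p, q; r, s]) (A k) = s • A k + r • dA k ∧
    ltrans (dist !![p, q; r, s]) (B k) = s • B k + r • (A k + dB k) ∧
    ltrans (dist !![p, q; r, s]) (dA k) = q • A k + s • dA k + (p - s) • dA k ∧
    ltrans (dist !![p, q; r, s]) (dB k) =
      q • B k + s • dB k + (p - s) • (A k + dB k) + r • dA k := by
  obtain ⟨h1, h2, h3, h4⟩ := glToLie_mk_gen k p q r s
  simp [ltrans_apply, h1, h2, h3, h4]

/-- The value at a point of the unipotent group of the derivative by an element of `gl(P)`. -/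
theorem unip_ltrans_mul (c : k) (X : GlP k) (f g : OGL k) :
    unip k c (ltrans (dist X) (f * g)) = unip k c (ltrans (dist X) f) * unip k c g +
      unip k c f * unip k c (ltrans (dist X) g) := by
  rw [ltrans_mul (dist_mem X), map_add, map_add, map_mul, map_mul, map_mul, unip_dd, zero_mul,
    add_zero]

/-- A function of a given weight is determined by the values at the points of the unipotent group
of its derivatives by `1`, `x`, `y` and `xy`. -/
theorem eq_zero_of_unip [Infinite k] {n : ℤ} {f : OGL k} (hf : ltrans (weightProj n) f = f)
    (h0 : ∀ c, unip k c f = 0) (hx : ∀ c, unip k c (ltrans (dist (gx k)) f) = 0)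
    (hy : ∀ c, unip k c (ltrans (dist (gy k)) f) = 0)
    (hxy : ∀ c, unip k c (ltrans (dist (gx k)) (ltrans (dist (gy k)) f)) = 0) : f = 0 := by
  obtain ⟨p, q, r, s, rfl⟩ := mem_normalForm.mp (mem_normalForm_of_weight hf)
  obtain ⟨x1, x2, x3, x4⟩ := ltrans_dist (0 : k) 1 0 0
  obtain ⟨y1, y2, y3, y4⟩ := ltrans_dist (1 : k) 0 0 0
  obtain ⟨z1, z2, z3, z4⟩ := ltrans_dist (0 : k) 0 1 0
  change ltrans (dist (gx k)) _ = _ at x1 x2 x3 x4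
  change ltrans (dist (gy k)) _ = _ at y1 y2 y3 y4
  change ltrans (dist (gdy k)) _ = _ at z1 z2 z3 z4
  have bx : ∀ c m h, unip k c (ltrans (dist (gx k)) (basicFun m h)) = 0 := fun c m h =>
    derivation_basicFun (D := (unip k c).toLinearMap ∘ₗ ltrans (dist (gx k)))
      (unip_ltrans_mul c (gx k)) (by simp [x1]) (by simp [x2]) m h
  have bY : ∀ c m h, unip k c (ltrans (dist (gy k)) (basicFun m h)) = 0 := fun c m h =>
    derivation_basicFun (D := (unip k c).toLinearMap ∘ₗ ltrans (dist (gy k)))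
      (unip_ltrans_mul c (gy k)) (by simp [y1]) (by simp [y2]) m h
  -- At the point c the functions A' and B' vanish and A⁻¹B takes the value c, so f takes the value
  -- p(c); a polynomial vanishing on the infinite field k is zero.
  have hp : p = 0 := Polynomial.funext fun c => by simpa using h0 c
  subst hp
  -- The derivative by y sends A' to A' and B' to A + B', so at a point only r remains. The
  -- coefficient q comes second, because x sends A' to A and B' to B and so sees both q and r.
  have hr : r = 0 := Polynomial.funext fun c => by
    simpa [unip_ltrans_mul, bY, y3, y4] using hy c
  subst hr
  have hq : q = 0 := Polynomial.funext fun c => by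
    simpa [unip_ltrans_mul, bx, x3, x4] using hx c
  subst hq
  have hs : s = 0 := Polynomial.funext fun c => by
    -- The two terms A'B' cancel. Applying x to A'A then gives A², with value 1 at every point, so
    -- xy reads off s.
    have h1 : ltrans (dist (gy k)) (dA k * dB k) = dA k * A k := by
      rw [ltrans_mul (dist_mem _), dd_dA, y3, y4]
      simp only [zero_smul, sub_zero, one_smul, zero_add, zero_mul, mul_add, add_zero]
      rw [add_left_comm, add_self_zero k, add_zero]
    have h2 : ltrans (dist (gdy k)) (dA k * dB k) = 0 := by
      rw [ltrans_mul (dist_mem _), dd_dA, z3, z4]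
      simp [r6]
    have h3 := hxy c
    simp only [map_zero, zero_mul, zero_add] at h3
    rw [ltrans_mul (dist_mem _), dualD_dist, dd_gy, h1, h2, mul_zero, add_zero, map_add, map_add,
      unip_ltrans_mul, unip_ltrans_mul, unip_ltrans_mul, unip_ltrans_mul, bx, x1, x3, x4] at h3
    simpa using h3
  subst hs
  simp

end HarishChandra

end Ver4

namespace Ver4

universe u v

open OGL BraidedSq LaurentPolynomial

/-! ### Relations between distributions: divided powers and the adjoint action. -/

section Relations

variable {k : Type u} [Field k] [CharP k 2]

/-- The functional `Tⁿ ↦ a n` on Laurent polynomials. -/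
noncomputable def laurentFun (a : ℤ → k) : k[T;T⁻¹] →ₗ[k] k :=
  Finsupp.linearCombination k a ∘ₗ (AddMonoidAlgebra.coeffLinearEquiv k).toLinearMap

@[simp] theorem laurentFun_T (a : ℤ → k) (n : ℤ) : laurentFun a (T n) = a n := by
  change Finsupp.linearCombination k a (Finsupp.single n 1) = _
  rw [Finsupp.linearCombination_single, one_smul]

/-- The functionals `Tⁿ ↦ a n` have the product rules of the sequences `a`. -/
theorem laurentFun_mul {a : ℤ → k} (S : k[T;T⁻¹] →ₗ[k] k[T;T⁻¹] →ₗ[k] k)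
    (h : ∀ n m, a (n + m) = S (T n) (T m)) (p q : k[T;T⁻¹]) : laurentFun a (p * q) = S p q := by
  have h1 : ∀ n, laurentFun a (T n * q) = S (T n) q := fun n =>
    laurent_hom_ext (α := laurentFun a ∘ₗ LinearMap.mulLeft k (T n)) (β := S (T n))
      (fun m => by
        rw [LinearMap.comp_apply, LinearMap.mulLeft_apply, ← T_add, laurentFun_T, h]) q
  exact laurent_hom_ext (α := laurentFun a ∘ₗ LinearMap.mulRight k q) (β := S.flip q) h1 p

theorem laurentFun_one_torus (f : OGL k) :
    laurentFun (fun _ => 1) (torus k f) = counit k f := by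
  have hc : counit k = (Bialgebra.counitAlgHom k k[T;T⁻¹]).comp (torus k) :=
    hom_ext fun x => by cases x <;> simp
  rw [hc]
  exact laurent_hom_ext (β := (Bialgebra.counitAlgHom k k[T;T⁻¹]).toLinearMap) (by simp) _

/-- The element e is tangent to the torus of scalars and differentiates Tⁿ to n at the identity. -/
theorem dist_ge (f : OGL k) : dist (ge k) f = laurentFun (fun n => (n : k)) (torus k f) := by
  obtain ⟨h1, h2, h3, h4⟩ := glToLie_mk_gen k 1 0 0 1
  change dist (ge k) _ = _ at h1 h2 h3 h4
  refine derivation_ext (counit k) (β := fun _ _ => 0)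
    (ν := laurentFun (fun n => (n : k)) ∘ₗ (torus k).toLinearMap) ?_ ?_ ?_ f
  · intro f g; rw [mem_lieGL.mp (dist_mem (ge k)), add_zero]
  · intro f g
    rw [← laurentFun_one_torus, ← laurentFun_one_torus]
    simp only [LinearMap.comp_apply, AlgHom.toLinearMap_apply, map_mul, add_zero]
    exact laurentFun_mul
      ((LinearMap.mul k k).compl₁₂ (laurentFun fun n => (n : k)) (laurentFun fun _ => 1) +
        (LinearMap.mul k k).compl₁₂ (laurentFun fun _ => 1) (laurentFun fun n => (n : k)))
      (by simp [LinearMap.compl₁₂_apply]) _ _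
  · intro x; cases x <;> simp [h1, h2, h3, h4]

/-- The binomial coefficient `n choose 2` modulo `2`. -/
def binomTwo (k : Type u) [Field k] (n : ℤ) : k := ((n * (n - 1) / 2 : ℤ) : k)

/-- The defect nm of additivity matches the braiding term e(f)e(g) in the product rule of x². -/
theorem binomTwo_add (n m : ℤ) :
    binomTwo k (n + m) = binomTwo k n + binomTwo k m + (n : k) * m := by
  have h : ∀ n : ℤ, n * (n - 1) / 2 * 2 = n * (n - 1) := fun n =>
    Int.ediv_mul_cancel (by simpa using (Int.even_mul_pred_self n).two_dvd)
  have h1 : (n + m) * (n + m - 1) / 2 = n * (n - 1) / 2 + m * (m - 1) / 2 + n * m := by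
    have := h n; have := h m; have := h (n + m)
    nlinarith
  rw [binomTwo, h1]; push_cast; rfl

/-- In the product rule of x² the two cross terms x(f)x(g) cancel and the braiding leaves e(f)e(g),
since x' = e. The second divided power of e on the torus obeys the same rule, so it is enough to
compare generators. -/
theorem conv_dist_gx (f : OGL k) : conv k (dist (gx k)) (dist (gx k)) f =
    laurentFun (binomTwo k) (torus k f) := by
  obtain ⟨h1, h2, h3, h4⟩ := glToLie_mk_gen k 0 1 0 0
  obtain ⟨x1, x2, x3, x4⟩ := ltrans_dist (0 : k) 1 0 0
  change dist (gx k) _ = _ at h1 h2 h3 h4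
  change ltrans (dist (gx k)) _ = _ at x1 x2 x3 x4
  refine derivation_ext (counit k) (β := fun f g => dist (ge k) f * dist (ge k) g)
    (ν := laurentFun (binomTwo k) ∘ₗ (torus k).toLinearMap) ?_ ?_ ?_ f
  · intro f g
    rw [conv_mul (dist_mem _) (dist_mem _), dualD_dist, dd_gx]
    linear_combination (dist (gx k) f * dist (gx k) g) * CharTwo.two_eq_zero (R := k)
  · intro f g
    rw [← laurentFun_one_torus, ← laurentFun_one_torus, dist_ge, dist_ge]
    simp only [LinearMap.comp_apply, AlgHom.toLinearMap_apply, map_mul, add_zero]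
    exact laurentFun_mul
      ((LinearMap.mul k k).compl₁₂ (laurentFun (binomTwo k)) (laurentFun fun _ => 1) +
        (LinearMap.mul k k).compl₁₂ (laurentFun fun _ => 1) (laurentFun (binomTwo k)) +
        (LinearMap.mul k k).compl₁₂ (laurentFun fun n => (n : k)) (laurentFun fun n => (n : k)))
      (by simp [LinearMap.compl₁₂_apply, binomTwo_add]) _ _
  · intro x
    rw [← apply_ltrans]
    cases x <;> simp [h1, h2, h3, h4, x1, x2, x3, x4, binomTwo]

variable (k) in
/-- Restriction of functions to the unipotent subgroup of the matrices `(1 0; c 1)`. -/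
noncomputable def unipPoly : OGL k →ₐ[k] Polynomial k :=
  rawLift
    (fun x => match x with
      | some .A => 1
      | some .B => .X
      | none => 1
      | _ => 0)
    (fun _ => 0) rfl rfl rfl rfl (fun x y => by rw [mul_comm]; simp) (by simp) (by simp)

@[simp] theorem unipPoly_A : unipPoly k (A k) = 1 := rawLift_gen ..
@[simp] theorem unipPoly_B : unipPoly k (B k) = .X := rawLift_gen ..
@[simp] theorem unipPoly_dA : unipPoly k (dA k) = 0 := rawLift_gen ..
@[simp] theorem unipPoly_dB : unipPoly k (dB k) = 0 := rawLift_gen ..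

theorem eval_unipPoly (c : k) (f : OGL k) : (unipPoly k f).eval c = unip k c f := by
  have h : (Polynomial.aeval c).comp (unipPoly k) = unip k c :=
    hom_ext fun x => by cases x <;> simp
  rw [← h, AlgHom.comp_apply, Polynomial.coe_aeval_eq_eval]

theorem coeff_zero_unipPoly (f : OGL k) : (unipPoly k f).coeff 0 = counit k f := by
  have h : unip k 0 = counit k := hom_ext fun x => by cases x <;> simp
  rw [Polynomial.coeff_zero_eq_eval_zero, eval_unipPoly, h]

/-- The element y' is the tangent vector of the unipotent group at the identity. -/
theorem coeff_one_unipPoly (f : OGL k) : (unipPoly k f).coeff 1 = dist (gdy k) f := by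
  obtain ⟨h1, h2, h3, h4⟩ := glToLie_mk_gen k 0 0 1 0
  change dist (gdy k) _ = _ at h1 h2 h3 h4
  refine derivation_ext (counit k) (β := fun _ _ => 0)
    (μ := Polynomial.lcoeff k 1 ∘ₗ (unipPoly k).toLinearMap) ?_ ?_ ?_ f
  · intro f g
    simp [Polynomial.mul_coeff_one, coeff_zero_unipPoly, add_comm]
  · intro f g; rw [mem_lieGL.mp (dist_mem _), add_zero]
  · intro x; cases x <;> simp [h1, h2, h3, h4, Polynomial.coeff_one]

/-- The analogue for y: the defect in the product rule is y'(f)y'(g), that of the coefficient of c²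
on the unipotent group. The summand y is a derivation and does not change the defect; it corrects
the value at B', where y² and y both give 1. -/
theorem conv_dist_gy (f : OGL k) : conv k (dist (gy k)) (dist (gy k)) f + dist (gy k) f =
    (unipPoly k f).coeff 2 := by
  obtain ⟨h1, h2, h3, h4⟩ := glToLie_mk_gen k 1 0 0 0
  obtain ⟨x1, x2, x3, x4⟩ := ltrans_dist (1 : k) 0 0 0
  change dist (gy k) _ = _ at h1 h2 h3 h4
  change ltrans (dist (gy k)) _ = _ at x1 x2 x3 x4
  refine derivation_ext (counit k) (β := fun f g => dist (gdy k) f * dist (gdy k) g)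
    (μ := conv k (dist (gy k)) (dist (gy k)) + dist (gy k))
    (ν := Polynomial.lcoeff k 2 ∘ₗ (unipPoly k).toLinearMap) ?_ ?_ ?_ f
  · intro f g
    simp only [LinearMap.add_apply]
    rw [conv_mul (dist_mem _) (dist_mem _), dualD_dist, dd_gy, mem_lieGL.mp (dist_mem (gy k))]
    linear_combination (dist (gy k) f * dist (gy k) g) * CharTwo.two_eq_zero (R := k)
  · intro f g
    simp only [LinearMap.comp_apply, AlgHom.toLinearMap_apply, map_mul, Polynomial.lcoeff_apply,
      Polynomial.coeff_mul, ← coeff_zero_unipPoly, ← coeff_one_unipPoly,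
      Finset.Nat.antidiagonal_succ, Finset.Nat.antidiagonal_zero]
    simp
    ring
  · intro x
    rw [LinearMap.add_apply, ← apply_ltrans]
    cases x <;> simp [h1, h2, h3, h4, x1, x2, x3, x4, Polynomial.coeff_one, Polynomial.coeff_X,
      CharTwo.add_self_eq_zero]

theorem ltrans_unip (c : k) : ltrans (unip k c).toLinearMap (A k) = A k + c • dA k ∧
    ltrans (unip k c).toLinearMap (B k) = B k + c • (A k + dB k) ∧
    ltrans (unip k c).toLinearMap (dA k) = dA k ∧
    ltrans (unip k c).toLinearMap (dB k) = dB k + c • dA k := by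
  simp [ltrans_apply]

theorem conv_unip_unip (c c' : k) : conv k (unip k c).toLinearMap (unip k c').toLinearMap =
    (unip k (c + c')).toLinearMap := by
  obtain ⟨h1, h2, h3, h4⟩ := ltrans_unip c'
  ext f
  rw [← apply_ltrans]
  have h0 : ltrans (unip k c').toLinearMap 1 = 1 := by
    simp [ltrans_apply, BraidedSq.one_def]
  let φ : OGL k →ₐ[k] k := (unip k c).comp
    (AlgHom.ofLinearMap (ltrans (unip k c').toLinearMap) h0
      (ltrans_mul_of_hom (unip k c') (unip_dd c')))
  have h : φ = unip k (c + c') := hom_ext fun x => by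
    cases x <;> simp [φ, h1, h2, h3, h4]
  exact DFunLike.congr_fun h f

/-- The adjoint action of the unipotent group on `gl(P)`. -/
theorem conv_unip_dist (c p q r s : k) :
    conv k (unip k c).toLinearMap (dist !![p, q; r, s]) =
      conv k (dist !![p + c * q, q; r + c * (p + s) + c ^ 2 * q, s + c * q])
        (unip k c).toLinearMap := by
  obtain ⟨u1, u2, u3, u4⟩ := ltrans_unip c
  obtain ⟨x1, x2, x3, x4⟩ := ltrans_dist p q r s
  obtain ⟨h1, h2, h3, h4⟩ := glToLie_mk_gen k (p + c * q) q (r + c * (p + s) + c ^ 2 * q) (s + c * q)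
  ext f
  -- Translating a Lie algebra element by the point c from either side gives a derivation over that
  -- point, so only the generators have to be compared.
  refine derivation_ext (unip k c) (β := fun _ _ => 0) ?_ ?_ ?_ f
  · intro f g
    simp only [← apply_ltrans, AlgHom.toLinearMap_apply, add_zero]
    exact unip_ltrans_mul c _ f g
  · intro f g
    simp only [← apply_ltrans, add_zero]
    rw [ltrans_mul_of_hom _ (unip_dd c), mem_lieGL.mp (dist_mem _), counit_ltrans, counit_ltrans]
    rfl
  · intro x
    have := CharTwo.two_eq_zero (R := k)
    cases x <;> simp only [← apply_ltrans, u1, u2, u3, u4, x1, x2, x3, x4, map_add, map_smul,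
      AlgHom.toLinearMap_apply, unip_A, unip_B, unip_dA, unip_dB, h1, h2, h3, h4, smul_eq_mul] <;>
      grind

end Relations

end Ver4

namespace Ver4

universe u v

open OGL BraidedSq LaurentPolynomial

/-! ### Commutation relations in representations of gl(P). -/

section GlRelations

variable {k : Type u} [Field k] [CharP k 2]

namespace GlRep

variable (M : GlRep k) (v : M.carrier)

theorem act_gy_gdy : M.act (gy k) (M.act (gdy k) v) =
    M.act (gdy k) (M.act (gy k) v) + M.act (gdy k) v := by
  have h := M.act_bracket (gy k) (gdy k) v
  have hd : dd k (gdy k) = 0 := by rw [← dd_gy, dd_dd]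
  have hb : glBracket k (gy k) (gdy k) = gdy k := by
    rw [gy, gdy, glBracket_mk]
    ext i j; fin_cases i <;> fin_cases j <;> simp [CharTwo.neg_eq]
  rw [hb, hd] at h
  simp only [map_zero, LinearMap.zero_apply, sub_zero] at h
  rw [← sub_eq_iff_eq_add', ← h]

/-- The bracket of y with itself is zero as a matrix, while the bracket relation evaluates it to yy
- yy - y'y'. -/
theorem act_gdy_gdy : M.act (gdy k) (M.act (gdy k) v) = 0 := by
  have h := M.act_bracket (gy k) (gy k) v
  have hb : glBracket k (gy k) (gy k) = 0 := by
    rw [gy, glBracket_mk]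
    ext i j; fin_cases i <;> fin_cases j <;> simp
  rw [hb, dd_gy] at h
  simpa using h

theorem act_gx_gdy : M.act (gx k) (M.act (gdy k) v) =
    M.act (gdy k) (M.act (gx k) v) + M.act (ge k) v := by
  have h := M.act_bracket (gx k) (gdy k) v
  have hd : dd k (gdy k) = 0 := by rw [← dd_gy, dd_dd]
  have hb : glBracket k (gx k) (gdy k) = ge k := by
    rw [gx, gdy, glBracket_mk]
    ext i j; fin_cases i <;> fin_cases j <;> simp [ge, CharTwo.neg_eq]
  rw [hb, hd] at h
  simp only [map_zero, LinearMap.zero_apply, sub_zero] at h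
  rw [h, add_sub_cancel]

/-- As matrices [x, y] = x + y'. The term y'e is the braiding correction y'x'. -/
theorem act_gx_gy : M.act (gx k) (M.act (gy k) v) = M.act (gy k) (M.act (gx k) v) +
    M.act (gx k) v + M.act (gdy k) v + M.act (gdy k) (M.act (ge k) v) := by
  have h := M.act_bracket (gx k) (gy k) v
  have hb : glBracket k (gx k) (gy k) = gx k + gdy k := by
    rw [gx, gy, gdy, glBracket_mk]
    ext i j; fin_cases i <;> fin_cases j <;> simp [CharTwo.neg_eq]
  rw [hb, dd_gx, dd_gy, map_add, LinearMap.add_apply] at h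
  rw [add_assoc (M.act (gy k) _), h]
  abel

theorem dd_act_gx : dd k (M.act (gx k) v) = M.act (ge k) v + M.act (gx k) (dd k v) := by
  rw [M.act_d, dd_gx]

theorem dd_act_gy : dd k (M.act (gy k) v) = M.act (gdy k) v + M.act (gy k) (dd k v) := by
  rw [M.act_d, dd_gy]

theorem dd_act_gdy : dd k (M.act (gdy k) v) = M.act (gdy k) (dd k v) := by
  have hd : dd k (gdy k) = 0 := by rw [← dd_gy, dd_dd]
  rw [M.act_d, hd, map_zero, LinearMap.zero_apply, zero_add]

variable {M}

/-- A subspace that is stable under `d`, `x` and `y` is a subrepresentation. -/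
theorem isSub_of_gx_gy {W : Submodule k M.carrier} (hd : ∀ v ∈ W, dd k v ∈ W)
    (hx : ∀ v ∈ W, M.act (gx k) v ∈ W) (hy : ∀ v ∈ W, M.act (gy k) v ∈ W) : M.IsSub W := by
  refine ⟨hd, fun X v hv => ?_⟩
  -- The operators e and y' are the commutators of d with x and with y, so they come for free.
  have he : M.act (ge k) v ∈ W := by
    rw [eq_sub_of_add_eq (dd_act_gx M v).symm]
    exact W.sub_mem (hd _ (hx v hv)) (hx _ (hd v hv))
  have hz : M.act (gdy k) v ∈ W := by
    rw [eq_sub_of_add_eq (dd_act_gy M v).symm]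
    exact W.sub_mem (hd _ (hy v hv)) (hy _ (hd v hv))
  rw [gl_decomp k X]
  simp only [map_add, map_smul, LinearMap.add_apply, LinearMap.smul_apply]
  exact W.add_mem (W.add_mem (W.add_mem (W.smul_mem _ (hx v hv)) (W.smul_mem _ he))
    (W.smul_mem _ (hy v hv))) (W.smul_mem _ hz)

/-- A linear map that is compatible with `d`, `x` and `y` is a homomorphism. -/
theorem map_act_of_gx_gy {M N : GlRep k} {e : M.carrier →ₗ[k] N.carrier}
    (hd : ∀ v, e (dd k v) = dd k (e v)) (hx : ∀ v, e (M.act (gx k) v) = N.act (gx k) (e v))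
    (hy : ∀ v, e (M.act (gy k) v) = N.act (gy k) (e v)) (X : GlP k) (v : M.carrier) :
    e (M.act X v) = N.act X (e v) := by
  have he : e (M.act (ge k) v) = N.act (ge k) (e v) := by
    rw [eq_sub_of_add_eq (dd_act_gx M v).symm, eq_sub_of_add_eq (dd_act_gx N (e v)).symm, map_sub,
      hd, hx, hx, hd]
  have hz : e (M.act (gdy k) v) = N.act (gdy k) (e v) := by
    rw [eq_sub_of_add_eq (dd_act_gy M v).symm, eq_sub_of_add_eq (dd_act_gy N (e v)).symm, map_sub,
      hd, hy, hy, hd]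
  rw [gl_decomp k X]
  simp only [map_add, map_smul, LinearMap.add_apply, LinearMap.smul_apply, he, hz, hx, hy]

end GlRep

end GlRelations

/-! ### The unipotent group on representations of fixed weight. -/

section Unipotent

variable {k : Type u} [Field k] [CharP k 2]

/-- The action of `gl(P)` on a representation of `GL(P)`. -/
noncomputable def lieAct (V : GLRep k) : GlP k →ₗ[k] V.carrier →ₗ[k] V.carrier :=
  V.restrict.act

theorem lieAct_apply (V : GLRep k) (X : GlP k) (v : V.carrier) :
    lieAct V X v = distAct V (dist X) v := rfl

theorem dd_distAct_unip (V : GLRep k) (c : k) (v : V.carrier) :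
    dd k (distAct V (unip k c).toLinearMap v) = distAct V (unip k c).toLinearMap (dd k v) := by
  have h : dualD k (unip k c).toLinearMap = 0 := by ext f; simp [dualD, unip_dd]
  rw [distAct_dd, h]
  simp [distAct]

theorem distAct_unip_add (V : GLRep k) (c c' : k) (v : V.carrier) :
    distAct V (unip k c).toLinearMap (distAct V (unip k c').toLinearMap v) =
      distAct V (unip k (c + c')).toLinearMap v := by
  rw [← distAct_conv, conv_unip_unip]

/-- The unipotent group is the additive group, so in characteristic 2 each of its elements is an
involution; this produces operators of square zero. -/
theorem distAct_unip_self (V : GLRep k) (c : k) (v : V.carrier) :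
    distAct V (unip k c).toLinearMap (distAct V (unip k c).toLinearMap v) = v := by
  have h : unip k 0 = counit k := hom_ext fun x => by cases x <;> simp
  rw [distAct_unip_add, CharTwo.add_self_eq_zero, h, distAct_counit]

theorem distAct_unip_dist (V : GLRep k) (c p q r s : k) (v : V.carrier) :
    distAct V (unip k c).toLinearMap (lieAct V !![p, q; r, s] v) =
      lieAct V !![p + c * q, q; r + c * (p + s) + c ^ 2 * q, s + c * q]
        (distAct V (unip k c).toLinearMap v) := by
  rw [lieAct_apply, ← distAct_conv, conv_unip_dist, distAct_conv]; rfl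

theorem distAct_unip_gx (V : GLRep k) (c : k) (v : V.carrier) :
    distAct V (unip k c).toLinearMap (lieAct V (gx k) v) =
      lieAct V (gx k) (distAct V (unip k c).toLinearMap v) +
      c • lieAct V (ge k) (distAct V (unip k c).toLinearMap v) +
      c ^ 2 • lieAct V (gdy k) (distAct V (unip k c).toLinearMap v) := by
  have h : (!![0 + c * 1, 1; 0 + c * (0 + 0) + c ^ 2 * 1, 0 + c * 1] : GlP k) =
      gx k + c • ge k + c ^ 2 • gdy k := by
    ext i j; fin_cases i <;> fin_cases j <;> simp [gx, ge, gdy]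
  rw [gx, distAct_unip_dist, h]
  simp only [map_add, map_smul, LinearMap.add_apply, LinearMap.smul_apply]
  rfl

theorem distAct_unip_gy (V : GLRep k) (c : k) (v : V.carrier) :
    distAct V (unip k c).toLinearMap (lieAct V (gy k) v) =
      lieAct V (gy k) (distAct V (unip k c).toLinearMap v) +
      c • lieAct V (gdy k) (distAct V (unip k c).toLinearMap v) := by
  have h : (!![1 + c * 0, 0; 0 + c * (1 + 0) + c ^ 2 * 0, 0 + c * 0] : GlP k) =
      gy k + c • gdy k := by
    ext i j; fin_cases i <;> fin_cases j <;> simp [gy, gdy]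
  rw [gy, distAct_unip_dist, h]
  simp only [map_add, map_smul, LinearMap.add_apply, LinearMap.smul_apply]
  rfl

theorem distAct_unip_gdy (V : GLRep k) (c : k) (v : V.carrier) :
    distAct V (unip k c).toLinearMap (lieAct V (gdy k) v) =
      lieAct V (gdy k) (distAct V (unip k c).toLinearMap v) := by
  have h : (!![0 + c * 0, 0; 1 + c * (0 + 0) + c ^ 2 * 0, 0 + c * 0] : GlP k) = gdy k := by
    ext i j; fin_cases i <;> fin_cases j <;> simp [gdy]
  rw [gdy, distAct_unip_dist, h]
  rfl

theorem HasWeight.distAct_weightProj {V : GLRep k} {n : ℤ} (h : HasWeight V n) (v : V.carrier) :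
    distAct V (weightProj n) v = v := by
  have h1 : ∀ t : OGL k ⊗[k] V.carrier, TensorProduct.lid k _ ((weightProj n).rTensor _ t) =
      TensorProduct.lid k _ ((coeffT k n).rTensor _ ((torus k).toLinearMap.rTensor _ t)) :=
    fun t => by rw [← LinearMap.rTensor_comp_apply]; rfl
  refine (h1 _).trans ?_
  rw [h v]
  simp

theorem HasWeight.ltrans_coef {V : GLRep k} {n : ℤ} (h : HasWeight V n)
    (ψ : Module.Dual k V.carrier) (v : V.carrier) :
    ltrans (weightProj n) (coef V ψ v) = coef V ψ v := by
  rw [← coef_distAct, h.distAct_weightProj]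

/-- `e` acts on a representation of weight `n` by `n`. -/
theorem HasWeight.act_ge {V : GLRep k} {n : ℤ} (h : HasWeight V n) (v : V.carrier) :
    lieAct V (ge k) v = (n : k) • v := by
  refine sub_eq_zero.mp ((Module.forall_dual_apply_eq_zero_iff k (_ : V.carrier)).mp fun ψ => ?_)
  refine (map_sub ψ _ _).trans (sub_eq_zero.mpr ?_)
  refine (apply_coef V ψ v (dist (ge k))).symm.trans ?_
  rw [dist_ge, h.torus_coef, map_smul, laurentFun_T, map_smul, smul_eq_mul, smul_eq_mul, mul_comm]

/-- `x²` acts on a representation of weight `n` by `n choose 2`. -/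
theorem HasWeight.act_gx_gx {V : GLRep k} {n : ℤ} (h : HasWeight V n) (v : V.carrier) :
    lieAct V (gx k) (lieAct V (gx k) v) = binomTwo k n • v := by
  refine sub_eq_zero.mp ((Module.forall_dual_apply_eq_zero_iff k (_ : V.carrier)).mp fun ψ => ?_)
  refine (map_sub ψ _ _).trans (sub_eq_zero.mpr ?_)
  have h1 := apply_coef V ψ v (conv k (dist (gx k)) (dist (gx k)))
  rw [distAct_conv] at h1
  refine h1.symm.trans ?_
  rw [conv_dist_gx, h.torus_coef, map_smul, laurentFun_T, map_smul, smul_eq_mul, smul_eq_mul,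
    mul_comm]

/-- A subspace of a representation with a weight is a subrepresentation if it is stable under
`d`, under `gl(P)` and under the unipotent group. -/
theorem HasWeight.isSub [Infinite k] {V : GLRep k} {n : ℤ} (hn : HasWeight V n)
    {W : Submodule k V.carrier} (hd : ∀ v ∈ W, dd k v ∈ W)
    (hx : ∀ v ∈ W, lieAct V (gx k) v ∈ W) (hy : ∀ v ∈ W, lieAct V (gy k) v ∈ W)
    (hu : ∀ c, ∀ v ∈ W, distAct V (unip k c).toLinearMap v ∈ W) : V.IsSub W := by
  refine isSub_of_coef hd fun ψ hψ w hw => ?_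
  have h : ∀ c, ∀ v ∈ W, unip k c (coef V ψ v) = 0 := fun c v hv =>
    (apply_coef V ψ v (unip k c).toLinearMap).trans (hψ _ (hu c v hv))
  -- The derivatives by x, y and xy of a coefficient of w are coefficients of xw, yw and xyw, which
  -- again lie in W.
  refine eq_zero_of_unip (hn.ltrans_coef ψ w) (fun c => h c w hw) (fun c => ?_) (fun c => ?_)
    fun c => ?_
  · rw [← coef_distAct]; exact h c _ (hx w hw)
  · rw [← coef_distAct]; exact h c _ (hy w hw)
  · rw [← coef_distAct, ← coef_distAct]; exact h c _ (hx _ (hy w hw))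

/-- Representations of the same weight are isomorphic if they are isomorphic over `gl(P)` and over
the unipotent group. -/
theorem HasWeight.iso [Infinite k] {V V' : GLRep k} {n : ℤ} (hn : HasWeight V n)
    (hn' : HasWeight V' n) (e : V.carrier ≃ₗ[k] V'.carrier) (hd : ∀ v, e (dd k v) = dd k (e v))
    (hX : ∀ X v, e (lieAct V X v) = lieAct V' X (e v))
    (hu : ∀ c v, e (distAct V (unip k c).toLinearMap v) =
      distAct V' (unip k c).toLinearMap (e v)) : V.Iso V' := by
  refine iso_of_coef e hd fun ψ v => sub_eq_zero.mp ?_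
  have h : ∀ c v, unip k c (coef V (ψ ∘ₗ e.toLinearMap) v - coef V' ψ (e v)) = 0 := fun c v => by
    rw [map_sub, sub_eq_zero]
    refine (apply_coef V _ v (unip k c).toLinearMap).trans
      (Eq.trans ?_ (apply_coef V' ψ (e v) (unip k c).toLinearMap).symm)
    exact congrArg ψ (hu c v)
  have hl : ∀ X v, ltrans (dist X) (coef V (ψ ∘ₗ e.toLinearMap) v - coef V' ψ (e v)) =
      coef V (ψ ∘ₗ e.toLinearMap) (lieAct V X v) - coef V' ψ (e (lieAct V X v)) :=
    fun X v => by
      rw [map_sub, ← coef_distAct, ← coef_distAct, hX]; rfl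
  refine eq_zero_of_unip (n := n) ?_ (fun c => h c v) (fun c => ?_) (fun c => ?_) fun c => ?_
  · rw [map_sub, hn.ltrans_coef, hn'.ltrans_coef]
  · rw [hl]; exact h c _
  · rw [hl]; exact h c _
  · rw [hl, hl]; exact h c _

/-- An operator of square zero on an irreducible representation is zero if its kernel is stable. -/
theorem eq_zero_of_ker_stable [Infinite k] {V : GLRep k} (hV : V.Irreducible) {n : ℤ}
    (hn : HasWeight V n) (S : V.carrier →ₗ[k] V.carrier) (hS : ∀ v, S (S v) = 0)
    (hd : ∀ v, S v = 0 → S (dd k v) = 0) (hx : ∀ v, S v = 0 → S (lieAct V (gx k) v) = 0)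
    (hy : ∀ v, S v = 0 → S (lieAct V (gy k) v) = 0)
    (hu : ∀ c v, S v = 0 → S (distAct V (unip k c).toLinearMap v) = 0) (v : V.carrier) :
    S v = 0 := by
  have hsub : V.IsSub (LinearMap.ker S) := hn.isSub hd hx hy hu
  rcases hV.2 _ hsub with h | h
  -- A zero kernel makes S injective, and then S² = 0 already gives S = 0.
  · have h1 := LinearMap.ker_eq_bot.mp h
    exact h1 ((hS v).trans (map_zero S).symm)
  · exact LinearMap.mem_ker.mp (h ▸ Submodule.mem_top)

end Unipotent

end Ver4

namespace Ver4

universe u v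

open OGL BraidedSq LaurentPolynomial

/-! ### Irreducible representations of GL(P) and their restrictions. -/

section Irreducible

variable {k : Type u} [Field k] [CharP k 2] [Infinite k]

theorem intCast_eq_zero_or_one (n : ℤ) : (n : k) = 0 ∨ (n : k) = 1 := by
  have h2 := CharTwo.two_eq_zero (R := k)
  rcases Int.even_or_odd' n with ⟨m, rfl | rfl⟩
  · left; push_cast; rw [h2, zero_mul]
  · right; push_cast; rw [h2, zero_mul, zero_add]

/-- On an irreducible representation on which `e` is zero, `y'` is zero. -/
theorem lieAct_gdy_eq_zero {V : GLRep k} (hV : V.Irreducible) {n : ℤ} (hn : HasWeight V n)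
    (h0 : (n : k) = 0) (v : V.carrier) : lieAct V (gdy k) v = 0 := by
  have hzz : ∀ v, lieAct V (gdy k) (lieAct V (gdy k) v) = 0 := GlRep.act_gdy_gdy V.restrict
  refine eq_zero_of_ker_stable hV hn (lieAct V (gdy k)) hzz ?_ ?_ ?_ ?_ v
  · intro v hv
    have h : dd k (lieAct V (gdy k) v) = lieAct V (gdy k) (dd k v) :=
      GlRep.dd_act_gdy V.restrict v
    rw [← h, hv, map_zero]
  · intro v hv
    have h : lieAct V (gx k) (lieAct V (gdy k) v) =
      lieAct V (gdy k) (lieAct V (gx k) v) + lieAct V (ge k) v := GlRep.act_gx_gdy V.restrict v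
    -- The kernel of y' is stable under x only because the commutator e of x and y' is zero here.
    have he : lieAct V (ge k) v = (n : k) • v := hn.act_ge v
    rw [hv, map_zero, he, h0, zero_smul, add_zero] at h
    exact h.symm
  · intro v hv
    have h : lieAct V (gy k) (lieAct V (gdy k) v) =
      lieAct V (gdy k) (lieAct V (gy k) v) + lieAct V (gdy k) v := GlRep.act_gy_gdy V.restrict v
    rw [hv, map_zero, add_zero] at h
    exact h.symm
  · intro c v hv
    rw [← distAct_unip_gdy, hv, map_zero]

/-- On an irreducible representation the unipotent group acts by `1 + c y'`. -/
theorem distAct_unip_eq {V : GLRep k} (hV : V.Irreducible) {n : ℤ} (hn : HasWeight V n) (c : k)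
    (v : V.carrier) :
    distAct V (unip k c).toLinearMap v = v + c • lieAct V (gdy k) v := by
  have hUU := distAct_unip_self V c
  have hUd := dd_distAct_unip V c
  have hUx := distAct_unip_gx V c
  have hUy := distAct_unip_gy V c
  have hUz := distAct_unip_gdy V c
  have hU : ∀ c' v, distAct V (unip k c).toLinearMap (distAct V (unip k c').toLinearMap v) =
      distAct V (unip k c').toLinearMap (distAct V (unip k c).toLinearMap v) := fun c' v => by
    rw [distAct_unip_add, distAct_unip_add, add_comm]
  have hU' := fun c' => distAct_unip_gdy V c'
  -- Conjugation by u_c sends x to x + ce + c²y', whereas conjugation by 1 + cy' gives x + ce +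
  -- c²ey'. These agree if e = 1; if e = 0 they agree because y' = 0.
  rcases intCast_eq_zero_or_one (k := k) n with h0 | h1
  · have hz := lieAct_gdy_eq_zero hV hn h0
    have he : ∀ v, lieAct V (ge k) v = 0 := fun v => by rw [hn.act_ge, h0, zero_smul]
    rw [hz, smul_zero, add_zero, ← sub_eq_zero]
    -- As u_c is an involution, u_c - 1 has square zero in characteristic 2.
    refine eq_zero_of_ker_stable hV hn (distAct V (unip k c).toLinearMap - LinearMap.id)
      ?_ ?_ ?_ ?_ ?_ v
    · intro v
      simp only [LinearMap.sub_apply, LinearMap.id_apply, map_sub, hUU]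
      linear_combination (norm := module) add_self_zero k v -
        add_self_zero k (distAct V (unip k c).toLinearMap v)
    · intro v hv
      simp only [LinearMap.sub_apply, LinearMap.id_apply, sub_eq_zero] at hv ⊢
      rw [← hUd, hv]
    · intro v hv
      simp only [LinearMap.sub_apply, LinearMap.id_apply, sub_eq_zero] at hv ⊢
      rw [hUx, hv, he, hz]; simp
    · intro v hv
      simp only [LinearMap.sub_apply, LinearMap.id_apply, sub_eq_zero] at hv ⊢
      rw [hUy, hv, hz]; simp
    · intro c' v hv
      simp only [LinearMap.sub_apply, LinearMap.id_apply, sub_eq_zero] at hv ⊢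
      rw [hU, hv]
  · have he : ∀ v, lieAct V (ge k) v = v := fun v => by rw [hn.act_ge, h1, one_smul]
    have hzz : ∀ v, lieAct V (gdy k) (lieAct V (gdy k) v) = 0 := GlRep.act_gdy_gdy V.restrict
    have hzd : ∀ v, dd k (lieAct V (gdy k) v) = lieAct V (gdy k) (dd k v) :=
      GlRep.dd_act_gdy V.restrict
    have hxz : ∀ v, lieAct V (gx k) (lieAct V (gdy k) v) =
      lieAct V (gdy k) (lieAct V (gx k) v) + lieAct V (ge k) v := GlRep.act_gx_gdy V.restrict
    have hyz : ∀ v, lieAct V (gy k) (lieAct V (gdy k) v) =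
      lieAct V (gdy k) (lieAct V (gy k) v) + lieAct V (gdy k) v := GlRep.act_gy_gdy V.restrict
    simp only [he] at hxz hUx
    have hzx := fun v => eq_sub_of_add_eq (hxz v).symm
    have hzy := fun v => eq_sub_of_add_eq (hyz v).symm
    -- The commuting operators u_c and 1 + cy' are both involutions, so their product minus 1 has
    -- square zero. That product commutes with d, x, y and the unipotent group.
    have key : ∀ v, distAct V (unip k c).toLinearMap (v + c • lieAct V (gdy k) v) - v = 0 := by
      refine eq_zero_of_ker_stable hV hn (distAct V (unip k c).toLinearMap ∘ₗ
        (LinearMap.id + c • lieAct V (gdy k)) - LinearMap.id) ?_ ?_ ?_ ?_ ?_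
      · intro v
        simp only [LinearMap.sub_apply, LinearMap.id_apply, LinearMap.comp_apply,
          LinearMap.add_apply, LinearMap.smul_apply, map_sub, map_add, map_smul, hUU, hUz, hzz,
          smul_zero, add_zero, smul_add, smul_sub]
        linear_combination (norm := module) add_self_zero k v + c • add_self_zero k (lieAct V (gdy k) v) -
          add_self_zero k (distAct V (unip k c).toLinearMap v) -
          c • add_self_zero k (lieAct V (gdy k) (distAct V (unip k c).toLinearMap v))
      · intro v hv
        simp only [LinearMap.sub_apply, LinearMap.id_apply, LinearMap.comp_apply,
          LinearMap.add_apply, LinearMap.smul_apply, map_add, map_smul] at hv ⊢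
        have h := congrArg (dd k) hv
        rw [map_sub, map_add, map_smul, hUd, hUd, hzd, map_zero] at h
        exact h
      · intro v hv
        simp only [LinearMap.sub_apply, LinearMap.id_apply, LinearMap.comp_apply,
          LinearMap.add_apply, LinearMap.smul_apply, map_add, map_smul] at hv ⊢
        have h := congrArg (lieAct V (gx k)) hv
        rw [map_sub, map_add, map_smul, map_zero] at h
        rw [hzx, map_sub, hUx, hUx, ← hUz (lieAct V (gdy k) v), hzz, map_zero, ← hUz]
        linear_combination (norm := module) h +
          c ^ 2 • add_self_zero k (distAct V (unip k c).toLinearMap (lieAct V (gdy k) v))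
      · intro v hv
        simp only [LinearMap.sub_apply, LinearMap.id_apply, LinearMap.comp_apply,
          LinearMap.add_apply, LinearMap.smul_apply, map_add, map_smul] at hv ⊢
        have h := congrArg (lieAct V (gy k)) hv
        rw [map_sub, map_add, map_smul, map_zero] at h
        rw [hzy, map_sub, hUy, hUy, ← hUz (lieAct V (gdy k) v), hzz, map_zero, ← hUz]
        linear_combination (norm := module) h
      · intro c' v hv
        simp only [LinearMap.sub_apply, LinearMap.id_apply, LinearMap.comp_apply,
          LinearMap.add_apply, LinearMap.smul_apply, map_add, map_smul] at hv ⊢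
        have h := congrArg (distAct V (unip k c').toLinearMap) hv
        rw [map_sub, map_add, map_smul, map_zero] at h
        rw [← hU' c', hU, hU]
        exact h
    -- Since 1 + cy' is its own inverse, inserting (1 + cy')v leaves u_c v on one side.
    have h2 := key (v + c • lieAct V (gdy k) v)
    rw [sub_eq_zero] at h2
    rw [← h2]
    congr 1
    simp only [map_add, map_smul, hzz]
    linear_combination (norm := module) -(c • add_self_zero k (lieAct V (gdy k) v))

/-- On an irreducible representation `y² = y`. -/
theorem lieAct_gy_gy {V : GLRep k} (hV : V.Irreducible) {n : ℤ} (hn : HasWeight V n)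
    (v : V.carrier) : lieAct V (gy k) (lieAct V (gy k) v) = lieAct V (gy k) v := by
  refine sub_eq_zero.mp ((Module.forall_dual_apply_eq_zero_iff k _).mp fun ψ => ?_)
  have h1 := apply_coef V ψ v (conv k (dist (gy k)) (dist (gy k)))
  rw [distAct_conv] at h1
  have h2 := apply_coef V ψ v (dist (gy k))
  -- As u_c = 1 + cy', coefficients restrict to polynomials of degree at most one on the unipotent
  -- group. Their c² coefficient, which computes y² + y, is zero.
  have h3 : unipPoly k (coef V ψ v) = Polynomial.C (ψ v) +
      Polynomial.C (ψ (lieAct V (gdy k) v)) * Polynomial.X := Polynomial.funext fun c => by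
    have h := apply_coef V ψ v (unip k c).toLinearMap
    rw [distAct_unip_eq hV hn] at h
    rw [eval_unipPoly]
    refine h.trans ?_
    rw [map_add, map_smul, smul_eq_mul, Polynomial.eval_add, Polynomial.eval_mul, Polynomial.eval_C,
      Polynomial.eval_C, Polynomial.eval_X, mul_comm]
  have h4 := conv_dist_gy (coef V ψ v)
  rw [h3, h1, h2] at h4
  simp only [Polynomial.coeff_add, Polynomial.coeff_C_mul, Polynomial.coeff_C,
    Polynomial.coeff_X] at h4
  rw [map_sub, CharTwo.sub_eq_add]
  refine h4.trans ?_
  simp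

/-- The restriction of an irreducible representation to `gl(P)` is irreducible. -/
theorem restrict_irreducible {V : GLRep k} (hV : V.Irreducible) : V.restrict.Irreducible := by
  obtain ⟨n, hn⟩ := exists_hasWeight hV
  refine ⟨hV.1, fun W hW => hV.2 W (hn.isSub hW.1 (fun v hv => hW.2 _ v hv)
    (fun v hv => hW.2 _ v hv) fun c v hv => ?_)⟩
  -- The unipotent group acts through y', so stability under gl(P) already implies stability under
  -- it.
  rw [distAct_unip_eq hV hn]
  exact Submodule.add_mem (p := (W : Submodule k V.carrier)) hv
    (Submodule.smul_mem (p := (W : Submodule k V.carrier)) c (hW.2 (gdy k) v hv))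

/-- A representation is irreducible if its restriction to `gl(P)` is. -/
theorem irreducible_of_restrict {V : GLRep k} (hV : V.restrict.Irreducible) : V.Irreducible :=
  ⟨hV.1, fun W hW => hV.2 W ⟨hW.1, fun X _ hw => hW.distAct_mem (dist X) hw⟩⟩

/-- Irreducible representations of the same weight are isomorphic if their restrictions are. -/
theorem iso_of_restrict_iso {V V' : GLRep k} (hV : V.Irreducible) (hV' : V'.Irreducible) {n : ℤ}
    (hn : HasWeight V n) (hn' : HasWeight V' n) (h : V.restrict.Iso V'.restrict) : V.Iso V' := by
  obtain ⟨e, hd, hX⟩ := h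
  refine hn.iso hn' e hd hX fun c v => ?_
  rw [distAct_unip_eq hV hn, distAct_unip_eq hV' hn']
  refine (map_add e _ _).trans (congrArg (e v + ·) ((map_smul e _ _).trans ?_))
  exact congrArg (c • ·) (hX (gdy k) v)

end Irreducible

end Ver4

namespace Ver4

universe u v

/-! ### Homomorphisms and models of gl(P)-representations. -/

section GlClassification

variable {k : Type u} [Field k] [CharP k 2]

namespace GlRep

theorem Iso.symm {M N : GlRep k} (h : M.Iso N) : N.Iso M := by
  obtain ⟨e, hd, hX⟩ := h
  refine ⟨e.symm, fun x => ?_, fun X x => ?_⟩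
  · rw [e.symm_apply_eq, hd, e.apply_symm_apply]
  · rw [e.symm_apply_eq, hX, e.apply_symm_apply]

theorem Iso.trans {M N Q : GlRep k} (h : M.Iso N) (h' : N.Iso Q) : M.Iso Q := by
  obtain ⟨e, hd, hX⟩ := h
  obtain ⟨e', hd', hX'⟩ := h'
  exact ⟨e.trans e', fun x => by simp [hd, hd'], fun X x => by simp [hX, hX']⟩

theorem Iso.irreducible {M N : GlRep k} (h : M.Iso N) (hN : N.Irreducible) : M.Irreducible := by
  obtain ⟨e, hd, hX⟩ := h
  refine ⟨@Equiv.nontrivial _ _ e.toEquiv hN.1, fun W hW => ?_⟩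
  have hs : N.IsSub (W.map e.toLinearMap) := by
    constructor
    · rintro _ ⟨x, hx, rfl⟩
      exact ⟨_, hW.1 x hx, hd x⟩
    · rintro X _ ⟨x, hx, rfl⟩
      exact ⟨_, hW.2 X x hx, hX X x⟩
  rcases hN.2 _ hs with h | h
  · exact Or.inl (Submodule.map_eq_bot_iff.mp h)
  · exact Or.inr (Submodule.map_eq_top_iff.mp h)

/-- Schur's lemma. -/
theorem bijective_of_hom {M N : GlRep k} (hM : M.Irreducible) (hN : N.Irreducible)
    (φ : N.carrier →ₗ[k] M.carrier) (hφ : ∃ v, φ v ≠ 0) (hd : ∀ v, φ (dd k v) = dd k (φ v))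
    (hX : ∀ X v, φ (N.act X v) = M.act X (φ v)) : Function.Bijective φ := by
  obtain ⟨v, hv⟩ := hφ
  have hker : LinearMap.ker φ = ⊥ := (hN.2 _ ⟨fun x hx => by
      rw [LinearMap.mem_ker] at hx ⊢; rw [hd, hx, map_zero], fun X x hx => by
      rw [LinearMap.mem_ker] at hx ⊢; rw [hX, hx, map_zero]⟩).resolve_right fun h =>
    hv (LinearMap.mem_ker.mp (h ▸ Submodule.mem_top))
  have hrange : LinearMap.range φ = ⊤ := (hM.2 _ ⟨by
      rintro _ ⟨x, rfl⟩; exact ⟨_, hd x⟩, by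
      rintro X _ ⟨x, rfl⟩; exact ⟨_, hX X x⟩⟩).resolve_left fun h =>
    hv ((Submodule.mem_bot k).mp (h ▸ LinearMap.mem_range_self φ v))
  exact ⟨LinearMap.ker_eq_bot.mp hker, LinearMap.range_eq_top.mp hrange⟩

theorem glLin_gx {A : Type v} [AddCommGroup A] [Module k A] (mx me my mdy : A) :
    glLin mx me my mdy (gx k) = mx := by
  rw [gx, glLin_mk]; simp

theorem glLin_gy {A : Type v} [AddCommGroup A] [Module k A] (mx me my mdy : A) :
    glLin mx me my mdy (gy k) = my := by
  rw [gy, glLin_mk]; simp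

theorem glLin_ge {A : Type v} [AddCommGroup A] [Module k A] (mx me my mdy : A) :
    glLin mx me my mdy (ge k) = me := by
  rw [ge, glLin_mk]; simp

theorem glLin_gdy {A : Type v} [AddCommGroup A] [Module k A] (mx me my mdy : A) :
    glLin mx me my mdy (gdy k) = mdy := by
  rw [gdy, glLin_mk]; simp

section Matrices

variable {n : ℕ} {D mx me my mdy : Matrix (Fin n) (Fin n) k} {hD : D * D = 0}
    {hd : ∀ X : GlP k, D * glLin mx me my mdy X =
      glLin mx me my mdy (dd k X) + glLin mx me my mdy X * D}
    {hb : ∀ X Y : GlP k, glLin mx me my mdy (glBracket k X Y) =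
      glLin mx me my mdy X * glLin mx me my mdy Y - glLin mx me my mdy Y * glLin mx me my mdy X
        - glLin mx me my mdy (dd k Y) * glLin mx me my mdy (dd k X)}
    {M : GlRep k} (f : Fin n → M.carrier)

theorem linearCombination_mulVec {A : Matrix (Fin n) (Fin n) k} {S : M.carrier →ₗ[k] M.carrier}
    (h : ∀ j, S (f j) = ∑ i, A i j • f i) (w : Fin n → k) :
    Fintype.linearCombination k f (A.mulVec w) = S (Fintype.linearCombination k f w) := by
  simp only [Fintype.linearCombination_apply, map_sum, map_smul, h, Matrix.mulVec, dotProduct,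
    Finset.sum_smul, Finset.smul_sum, smul_smul]
  rw [Finset.sum_comm]
  simp only [mul_comm]

theorem linearCombination_act (h1 : ∀ j, dd k (f j) = ∑ i, D i j • f i)
    (h2 : ∀ j, M.act (gx k) (f j) = ∑ i, mx i j • f i)
    (h3 : ∀ j, M.act (gy k) (f j) = ∑ i, my i j • f i) (X : GlP k)
    (w : (ofMatrices D mx me my mdy hD hd hb).carrier) :
    Fintype.linearCombination k f ((ofMatrices D mx me my mdy hD hd hb).act X w) =
      M.act X (Fintype.linearCombination k f w) := by
  refine map_act_of_gx_gy (M := ofMatrices D mx me my mdy hD hd hb)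
    (e := Fintype.linearCombination k f) (linearCombination_mulVec f h1) ?_ ?_ X w
  · exact linearCombination_mulVec f (A := glLin mx me my mdy (gx k)) (by rw [glLin_gx]; exact h2)
  · exact linearCombination_mulVec f (A := glLin mx me my mdy (gy k)) (by rw [glLin_gy]; exact h3)

/-- A representation with a basis on which `d`, `x` and `y` act by given matrices. -/
theorem iso_ofMatrices (hf : Function.Bijective (Fintype.linearCombination k f))
    (h1 : ∀ j, dd k (f j) = ∑ i, D i j • f i) (h2 : ∀ j, M.act (gx k) (f j) = ∑ i, mx i j • f i)
    (h3 : ∀ j, M.act (gy k) (f j) = ∑ i, my i j • f i) :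
    M.Iso (ofMatrices D mx me my mdy hD hd hb) :=
  Iso.symm ⟨LinearEquiv.ofBijective (Fintype.linearCombination k f) hf,
    linearCombination_mulVec f h1, linearCombination_act f h1 h2 h3⟩

/-- An irreducible representation with vectors on which `d`, `x` and `y` act by given matrices. -/
theorem iso_ofMatrices_of_irreducible (hM : M.Irreducible)
    (hN : (ofMatrices D mx me my mdy hD hd hb).Irreducible) (hf : ∃ j, f j ≠ 0)
    (h1 : ∀ j, dd k (f j) = ∑ i, D i j • f i) (h2 : ∀ j, M.act (gx k) (f j) = ∑ i, mx i j • f i)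
    (h3 : ∀ j, M.act (gy k) (f j) = ∑ i, my i j • f i) :
    M.Iso (ofMatrices D mx me my mdy hD hd hb) := by
  refine iso_ofMatrices f (bijective_of_hom hM hN (Fintype.linearCombination k f) ?_
    (linearCombination_mulVec f h1) (linearCombination_act f h1 h2 h3)) h1 h2 h3
  obtain ⟨j, hj⟩ := hf
  refine ⟨(Pi.single j 1 : Fin n → k), ?_⟩
  have h : Fintype.linearCombination k f (Pi.single j 1) = f j := by simp
  exact fun h0 => hj (h.symm.trans h0)

theorem ofMatrices_act_eq_smul {X : GlP k} {s : k}
    (h : glLin mx me my mdy X * glLin mx me my mdy X = s • 1)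
    (w : (ofMatrices D mx me my mdy hD hd hb).carrier) :
    (ofMatrices D mx me my mdy hD hd hb).act X ((ofMatrices D mx me my mdy hD hd hb).act X w) =
      s • w := by
  have key : ∀ w : Fin n → k, (glLin mx me my mdy X : Matrix (Fin n) (Fin n) k).mulVec
      ((glLin mx me my mdy X : Matrix (Fin n) (Fin n) k).mulVec w) = s • w := fun w => by
    rw [Matrix.mulVec_mulVec, h, Matrix.smul_mulVec, Matrix.one_mulVec]
  exact key w

theorem ofMatrices_act_add_eq_smul {X : GlP k} {s : k}
    (h : glLin mx me my mdy X * glLin mx me my mdy X + glLin mx me my mdy X = s • 1)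
    (w : (ofMatrices D mx me my mdy hD hd hb).carrier) :
    (ofMatrices D mx me my mdy hD hd hb).act X ((ofMatrices D mx me my mdy hD hd hb).act X w) +
      (ofMatrices D mx me my mdy hD hd hb).act X w = s • w := by
  have key : ∀ w : Fin n → k, (glLin mx me my mdy X : Matrix (Fin n) (Fin n) k).mulVec
      ((glLin mx me my mdy X : Matrix (Fin n) (Fin n) k).mulVec w) +
      (glLin mx me my mdy X : Matrix (Fin n) (Fin n) k).mulVec w = s • w := fun w => by
    rw [Matrix.mulVec_mulVec, ← Matrix.add_mulVec, h, Matrix.smul_mulVec, Matrix.one_mulVec]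
  exact key w

end Matrices

/-- An operator of square zero on an irreducible representation is zero if its kernel is stable. -/
theorem eq_zero_of_ker_stable {M : GlRep k} (hM : M.Irreducible) (S : M.carrier →ₗ[k] M.carrier)
    (hS : ∀ v, S (S v) = 0) (hd : ∀ v, S v = 0 → S (dd k v) = 0)
    (hx : ∀ v, S v = 0 → S (M.act (gx k) v) = 0) (hy : ∀ v, S v = 0 → S (M.act (gy k) v) = 0)
    (v : M.carrier) : S v = 0 := by
  rcases hM.2 (LinearMap.ker S) (isSub_of_gx_gy hd hx hy) with h | h
  · exact LinearMap.ker_eq_bot.mp h ((hS v).trans (map_zero S).symm)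
  · exact LinearMap.mem_ker.mp (h ▸ Submodule.mem_top)

end GlRep

/-! ### Irreducibility of the L(ε, a, b). -/

section Models

variable (a b : k)

theorem L1_gx (w : Fin 2 → k) : ((L1 k a b).act (gx k) w : Fin 2 → k) = ![w 1, a * w 0] := by
  change (glLin _ _ _ _ (gx k) : Matrix (Fin 2) (Fin 2) k).mulVec w = _
  rw [gx, glLin_mk]
  ext i; fin_cases i <;> simp [Matrix.mulVec, dotProduct, Fin.sum_univ_two]

theorem L1_gy (w : Fin 2 → k) :
    ((L1 k a b).act (gy k) w : Fin 2 → k) = ![b * w 0, (b + 1) * w 1] := by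
  change (glLin _ _ _ _ (gy k) : Matrix (Fin 2) (Fin 2) k).mulVec w = _
  rw [gy, glLin_mk]
  ext i; fin_cases i <;> simp [Matrix.mulVec, dotProduct, Fin.sum_univ_two]

theorem L1_gdy (w : Fin 2 → k) : ((L1 k a b).act (gdy k) w : Fin 2 → k) = ![0, w 0] := by
  change (glLin _ _ _ _ (gdy k) : Matrix (Fin 2) (Fin 2) k).mulVec w = _
  rw [gdy, glLin_mk]
  ext i; fin_cases i <;> simp [Matrix.mulVec, dotProduct, Fin.sum_univ_two]

theorem L0two_gx (w : Fin 2 → k) :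
    ((L0two k a b).act (gx k) w : Fin 2 → k) = ![w 1, a * w 0] := by
  change (glLin _ _ _ _ (gx k) : Matrix (Fin 2) (Fin 2) k).mulVec w = _
  rw [gx, glLin_mk]
  ext i; fin_cases i <;> simp [Matrix.mulVec, dotProduct, Fin.sum_univ_two]

theorem L0two_gy (w : Fin 2 → k) :
    ((L0two k a b).act (gy k) w : Fin 2 → k) = ![b * w 0, (b + 1) * w 1] := by
  change (glLin _ _ _ _ (gy k) : Matrix (Fin 2) (Fin 2) k).mulVec w = _
  rw [gy, glLin_mk]
  ext i; fin_cases i <;> simp [Matrix.mulVec, dotProduct, Fin.sum_univ_two]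

theorem eq_top_of_basis {W : Submodule k (Fin 2 → k)} (h0 : ![1, 0] ∈ W) (h1 : ![0, 1] ∈ W) :
    W = ⊤ := by
  refine eq_top_iff.mpr fun w _ => ?_
  have h : w = w 0 • ![1, 0] + w 1 • ![0, 1] := by ext i; fin_cases i <;> simp
  rw [h]
  exact W.add_mem (W.smul_mem _ h0) (W.smul_mem _ h1)

/-- The operator y' moves the first coordinate to the second, so every nonzero subrepresentation
contains the second basis vector; x maps that vector to the first. -/
theorem L1_irreducible : (L1 k a b).Irreducible := by
  refine ⟨inferInstanceAs (Nontrivial (Fin 2 → k)), fun W hW => ?_⟩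
  change Submodule k (Fin 2 → k) at W
  by_contra hcon
  push Not at hcon
  obtain ⟨w, hw, hw0⟩ := W.ne_bot_iff.mp hcon.1
  have hx : ∀ u : Fin 2 → k, u ∈ W → ![u 1, a * u 0] ∈ W := fun u hu =>
    L1_gx a b u ▸ hW.2 (gx k) u hu
  have hz : ∀ u : Fin 2 → k, u ∈ W → ![0, u 0] ∈ W := fun u hu =>
    L1_gdy a b u ▸ hW.2 (gdy k) u hu
  have h1 : (![0, 1] : Fin 2 → k) ∈ W := by
    by_cases h : w 0 = 0
    · have h1 : w 1 ≠ 0 := fun h1 => hw0 (by ext i; fin_cases i <;> simp [h, h1])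
      have h2 := W.smul_mem (w 1)⁻¹ hw
      convert h2 using 1
      ext i; fin_cases i <;> simp [h, h1]
    · have h2 := W.smul_mem (w 0)⁻¹ (hz w hw)
      simpa [h] using h2
  exact hcon.2 (eq_top_of_basis (by simpa using hx _ h1) h1)

/-- Here y' = 0, but y - b isolates the second coordinate. If that coordinate vanishes, x reaches
the second basis vector because a is invertible. -/
theorem L0two_irreducible (ha : a ≠ 0) : (L0two k a b).Irreducible := by
  refine ⟨inferInstanceAs (Nontrivial (Fin 2 → k)), fun W hW => ?_⟩
  change Submodule k (Fin 2 → k) at W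
  by_contra hcon
  push Not at hcon
  obtain ⟨w, hw, hw0⟩ := W.ne_bot_iff.mp hcon.1
  have hx : ∀ u : Fin 2 → k, u ∈ W → ![u 1, a * u 0] ∈ W := fun u hu =>
    L0two_gx a b u ▸ hW.2 (gx k) u hu
  have hy : ∀ u : Fin 2 → k, u ∈ W → ![b * u 0, (b + 1) * u 1] ∈ W := fun u hu =>
    L0two_gy a b u ▸ hW.2 (gy k) u hu
  have h1 : (![0, 1] : Fin 2 → k) ∈ W := by
    by_cases h : w 1 = 0
    · have h1 : w 0 ≠ 0 := fun h1 => hw0 (by ext i; fin_cases i <;> simp [h, h1])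
      have h2 := W.smul_mem (a * w 0)⁻¹ (hx w hw)
      convert h2 using 1
      ext i; fin_cases i <;> simp [h]
      field_simp
    · have h2 := W.smul_mem (w 1)⁻¹ (W.sub_mem (hy w hw) (W.smul_mem b hw))
      have h3 : (w 1)⁻¹ • (![b * w 0, (b + 1) * w 1] - b • w) = ![0, 1] := by
        ext i; fin_cases i
        · change (w 1)⁻¹ * (b * w 0 - b * w 0) = 0
          rw [sub_self, mul_zero]
        · change (w 1)⁻¹ * ((b + 1) * w 1 - b * w 1) = 1
          field_simp
          ring
      rwa [h3] at h2
  exact hcon.2 (eq_top_of_basis (by simpa using hx _ h1) h1)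

theorem L0one_irreducible : (L0one k b).Irreducible := by
  refine ⟨inferInstanceAs (Nontrivial (Fin 1 → k)), fun W hW => ?_⟩
  have hs : IsSimpleModule k (Fin 1 → k) := by
    rw [isSimpleModule_iff_finrank_eq_one]; simp
  exact eq_bot_or_eq_top (α := Submodule k (Fin 1 → k)) W

theorem L_one : L k 1 a b = L1 k a b := by rw [L, if_pos rfl]

theorem L_zero_zero : L k 0 0 b = L0one k b := by rw [L, if_neg (by simp), if_pos rfl]

theorem L_zero_of_ne {a : k} (ha : a ≠ 0) : L k 0 a b = L0two k a b := by
  rw [L, if_neg (by simp), if_neg ha]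

theorem L_irreducible (ε : Fin 2) : (L k ε a b).Irreducible := by
  unfold L
  split_ifs with h1 h2
  · exact L1_irreducible a b
  · exact L0one_irreducible b
  · exact L0two_irreducible a b h2

end Models

/-! ### Irreducible gl(P)-representations with scalar x² and idempotent y. -/

namespace GlRep

variable {M : GlRep k}

/-- An operator `y` with `y² = y` has an eigenvector in a nonzero stable subspace. -/
theorem exists_eigenvector (hyy : ∀ v, M.act (gy k) (M.act (gy k) v) = M.act (gy k) v)
    {p : M.carrier → Prop} (hp : ∃ v, v ≠ 0 ∧ p v) (hpy : ∀ v, p v → p (M.act (gy k) v)) :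
    ∃ v, v ≠ 0 ∧ p v ∧ ∃ c : k, (c = 0 ∨ c = 1) ∧ M.act (gy k) v = c • v := by
  obtain ⟨v, hv, hpv⟩ := hp
  by_cases h : M.act (gy k) v = 0
  · exact ⟨v, hv, hpv, 0, Or.inl rfl, by rw [h, zero_smul]⟩
  · exact ⟨_, h, hpy v hpv, 1, Or.inr rfl, by rw [hyy, one_smul]⟩

/-- The irreducible representations of `gl(P)` with `e = 1`, `x² = a` and `y² = y`. -/
theorem exists_iso_L1 (hM : M.Irreducible) {a : k} (he : ∀ v, M.act (ge k) v = v)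
    (hxx : ∀ v, M.act (gx k) (M.act (gx k) v) = a • v)
    (hyy : ∀ v, M.act (gy k) (M.act (gy k) v) = M.act (gy k) v) :
    ∃ b : k, (b = 0 ∨ b = 1) ∧ M.Iso (L1 k a b) := by
  have hzx := fun v => eq_sub_of_add_eq (act_gx_gdy M v).symm
  have hzy := fun v => eq_sub_of_add_eq (act_gy_gdy M v).symm
  have hdz : ∀ v, dd k v = M.act (gdy k) v := fun v => by
    -- The commutators of d and of y' with x are both e, and those with y are both y'. So d + y'
    -- commutes with x and y, and it has square zero.
    have h := eq_zero_of_ker_stable hM (dd k + M.act (gdy k)) ?_ ?_ ?_ ?_ v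
    · rw [← neg_self_eq k (M.act (gdy k) v)]
      exact eq_neg_of_add_eq_zero_left h
    · intro v
      simp only [LinearMap.add_apply, map_add, dd_dd, act_gdy_gdy, dd_act_gdy, zero_add, add_zero]
      exact add_self_zero k _
    · intro v hv
      have h := congrArg (dd k) hv
      simp only [LinearMap.add_apply, map_add, dd_dd, dd_act_gdy, zero_add, map_zero] at h ⊢
      exact h
    · intro v hv
      have h := congrArg (M.act (gx k)) hv
      simp only [LinearMap.add_apply, map_add, map_zero] at h ⊢
      rw [dd_act_gx, hzx, ← h]
      abel
    · intro v hv
      have h := congrArg (M.act (gy k)) hv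
      simp only [LinearMap.add_apply, map_add, map_zero] at h ⊢
      rw [dd_act_gy, hzy, ← h]
      abel
  have hker : ∃ v, v ≠ 0 ∧ M.act (gdy k) v = 0 := by
    obtain ⟨u, hu⟩ := @exists_ne _ hM.1 (0 : M.carrier)
    by_cases h : M.act (gdy k) u = 0
    · exact ⟨u, hu, h⟩
    · exact ⟨_, h, act_gdy_gdy M u⟩
  -- The kernel of y' is nonzero since y'² = 0, and y preserves it; v is an eigenvector of y inside
  -- this kernel.
  obtain ⟨v, hv, hz, c, hc, hy⟩ := exists_eigenvector hyy hker fun v hv => by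
    rw [hzy, hv, map_zero, sub_zero]
  have h2 := CharTwo.two_eq_zero (R := k)
  have hyx : M.act (gy k) (M.act (gx k) v) = (c + 1) • M.act (gx k) v := by
    have h := act_gx_gy M v
    rw [he, hy, hz, map_smul, add_zero, add_zero] at h
    rw [add_smul, one_smul, h, add_assoc, add_self_zero k, add_zero]
  have hdv : dd k v = 0 := by rw [hdz, hz]
  have h3 : c + 1 + 1 = c := by linear_combination h2
  -- In the model x sends the second basis vector to the first, so v comes second. Its eigenvalue c
  -- must equal b + 1, that is, b = c + 1. The vector xv has eigenvalue c + 1, and d(xv) = ev = v.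
  refine ⟨c + 1, ?_, iso_ofMatrices_of_irreducible ![M.act (gx k) v, v] hM
    (L1_irreducible a (c + 1)) ⟨1, hv⟩ ?_ ?_ ?_⟩
  · rcases hc with rfl | rfl
    · simp
    · left; exact CharTwo.add_self_eq_zero 1
  · intro j; fin_cases j <;> simp [dP, dd_act_gx, he, hdv]
  · intro j; fin_cases j <;> simp [hxx]
  · intro j; fin_cases j <;> simp [hyx, hy, h3]

/-- The operators e and y' are the commutators of d with x and y. When they vanish, the kernel of d
is stable, and d² = 0. -/
theorem dd_eq_zero (hM : M.Irreducible) (he : ∀ v, M.act (ge k) v = 0)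
    (hz : ∀ v, M.act (gdy k) v = 0) (v : M.carrier) : dd k v = 0 :=
  eq_zero_of_ker_stable hM (dd k) (dd_dd k) (fun v _ => dd_dd k v)
    (fun v hv => by rw [dd_act_gx, he, hv, map_zero, add_zero])
    (fun v hv => by rw [dd_act_gy, hz, hv, map_zero, add_zero]) v

theorem act_gx_gy_of_zero (hz : ∀ v, M.act (gdy k) v = 0) (v : M.carrier) :
    M.act (gx k) (M.act (gy k) v) = M.act (gy k) (M.act (gx k) v) + M.act (gx k) v := by
  rw [act_gx_gy, hz, hz, add_zero, add_zero]

/-- As for e = 1, the vectors xv and v form the model basis and b = c + 1. Any eigenvector of y will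
do, which is why b is not unique. -/
theorem iso_L0two (hM : M.Irreducible) {a : k} (ha : a ≠ 0) (he : ∀ v, M.act (ge k) v = 0)
    (hz : ∀ v, M.act (gdy k) v = 0) (hxx : ∀ v, M.act (gx k) (M.act (gx k) v) = a • v)
    {v : M.carrier} (hv : v ≠ 0) {c : k} (hy : M.act (gy k) v = c • v) :
    M.Iso (L0two k a (c + 1)) := by
  have hd := dd_eq_zero hM he hz
  have hyx : M.act (gy k) (M.act (gx k) v) = (c + 1) • M.act (gx k) v := by
    have h := act_gx_gy_of_zero hz v
    rw [hy, map_smul] at h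
    rw [add_smul, one_smul, h, add_assoc, add_self_zero k, add_zero]
  have h3 : c + 1 + 1 = c := by linear_combination CharTwo.two_eq_zero (R := k)
  refine iso_ofMatrices_of_irreducible ![M.act (gx k) v, v] hM
    (L0two_irreducible a (c + 1) ha) ⟨1, hv⟩ ?_ ?_ ?_
  · intro j; fin_cases j <;> simp [hd]
  · intro j; fin_cases j <;> simp [hxx]
  · intro j; fin_cases j <;> simp [hyx, hy, h3]

/-- The irreducible representations of `gl(P)` with `e = y' = 0`, `x² = a` and `y² = y`. -/
theorem exists_iso_L0 (hM : M.Irreducible) {a : k} (he : ∀ v, M.act (ge k) v = 0)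
    (hz : ∀ v, M.act (gdy k) v = 0)
    (hxx : ∀ v, M.act (gx k) (M.act (gx k) v) = a • v)
    (hyy : ∀ v, M.act (gy k) (M.act (gy k) v) = M.act (gy k) v) :
    ∃ b : k, (b = 0 ∨ b = 1) ∧ M.Iso (L k 0 a b) := by
  have hd := dd_eq_zero hM he hz
  have hxy := act_gx_gy_of_zero hz
  obtain ⟨u, hu⟩ := @exists_ne _ hM.1 (0 : M.carrier)
  obtain ⟨v, hv, -, c, hc, hy⟩ := exists_eigenvector (p := fun _ => True) hyy ⟨u, hu, trivial⟩
    (fun _ _ => trivial)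
  by_cases ha : a = 0
  -- For a = 0 the operator x has square zero and a stable kernel, so it vanishes and one
  -- eigenvector of y spans.
  · have hx : ∀ v, M.act (gx k) v = 0 := eq_zero_of_ker_stable hM (M.act (gx k))
      (fun v => by rw [hxx, ha, zero_smul]) (fun v _ => by rw [hd, map_zero])
      (fun v hv => by rw [hv, map_zero]) (fun v hv => by rw [hxy, hv, map_zero, add_zero])
    subst ha
    refine ⟨c, hc, ?_⟩
    rw [L_zero_zero]
    refine iso_ofMatrices_of_irreducible ![v] hM (L0one_irreducible c) ⟨0, hv⟩ ?_ ?_ ?_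
    · intro j; fin_cases j; simp [hd]
    · intro j; fin_cases j; simp [hx]
    · intro j; fin_cases j; simp [hy]
  · refine ⟨c + 1, ?_, ?_⟩
    · rcases hc with rfl | rfl
      · simp
      · left; exact CharTwo.add_self_eq_zero 1
    · rw [L_zero_of_ne _ ha]
      exact iso_L0two hM ha he hz hxx hv hy

end GlRep

/-- `L(0, 1, 0)` and `L(0, 1, 1)` are isomorphic. -/
theorem L_zero_one_iso : (L k 0 1 0).Iso (L k 0 1 1) := by
  rw [L_zero_of_ne _ one_ne_zero, L_zero_of_ne _ one_ne_zero]
  have key : ∀ {A : Matrix (Fin 2) (Fin 2) k}, A = 0 → ∀ w : Fin 2 → k, A.mulVec w = 0 := by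
    rintro A rfl w
    rw [Matrix.zero_mulVec]
  have h0 : (![0 * (![1, 0] : Fin 2 → k) 0, (0 + 1) * (![1, 0] : Fin 2 → k) 1] : Fin 2 → k) =
      (0 : k) • (![1, 0] : Fin 2 → k) := by
    ext i; fin_cases i <;> simp
  -- The first basis vector of L(0, 1, 0) has y-eigenvalue 0. Taking it as the second vector of the
  -- model gives b = 1.
  have h := GlRep.iso_L0two (k := k) (M := L0two k 1 0) (L0two_irreducible 1 0 one_ne_zero)
    (a := 1) (c := 0) one_ne_zero (key (GlRep.glLin_ge _ _ _ _)) (key (GlRep.glLin_gdy _ _ _ _))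
    (GlRep.ofMatrices_act_eq_smul (by
      rw [GlRep.glLin_gx]
      ext i j; fin_cases i <;> fin_cases j <;> simp))
    (v := (![1, 0] : Fin 2 → k)) (fun h => one_ne_zero (α := k) (congrFun h 0))
    ((L0two_gy 1 0 _).trans h0)
  rwa [zero_add] at h

/-- `x²` and `y² + y` are scalars on `L(ε, a, b)`. -/
theorem L_scalars (ε : Fin 2) (a b : k) (w : (L k ε a b).carrier) :
    (L k ε a b).act (gx k) ((L k ε a b).act (gx k) w) = a • w ∧
    (L k ε a b).act (gy k) ((L k ε a b).act (gy k) w) + (L k ε a b).act (gy k) w =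
      (b * b + b) • w := by
  have h2 := CharTwo.two_eq_zero (R := k)
  have hε : ε = 0 ∨ ε = 1 := by omega
  rcases hε with rfl | rfl
  · by_cases ha : a = 0
    · subst ha
      revert w
      rw [L_zero_zero]
      refine fun w => ⟨GlRep.ofMatrices_act_eq_smul ?_ w, GlRep.ofMatrices_act_add_eq_smul ?_ w⟩
      · rw [GlRep.glLin_gx]; simp
      · rw [GlRep.glLin_gy]
        ext i j; fin_cases i; fin_cases j; simp [Matrix.mul_apply]
    · revert w
      rw [L_zero_of_ne _ ha]
      refine fun w => ⟨GlRep.ofMatrices_act_eq_smul ?_ w, GlRep.ofMatrices_act_add_eq_smul ?_ w⟩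
      · rw [GlRep.glLin_gx]
        ext i j; fin_cases i <;> fin_cases j <;> simp
      · rw [GlRep.glLin_gy]
        ext i j; fin_cases i <;> fin_cases j <;> simp <;> grind
  · revert w
    rw [L_one]
    refine fun w => ⟨GlRep.ofMatrices_act_eq_smul ?_ w, GlRep.ofMatrices_act_add_eq_smul ?_ w⟩
    · rw [GlRep.glLin_gx]
      ext i j; fin_cases i <;> fin_cases j <;> simp
    · rw [GlRep.glLin_gy]
      ext i j; fin_cases i <;> fin_cases j <;> simp <;> grind

/-- The parameters `a` and `b² + b` of `L(ε, a, b)` are invariants. -/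
theorem L_iso_invariants {ε ε' : Fin 2} {a a' b b' : k} (h : (L k ε a b).Iso (L k ε' a' b')) :
    a = a' ∧ b * b + b = b' * b' + b' := by
  obtain ⟨e, -, hX⟩ := h
  obtain ⟨v, hv⟩ := @exists_ne _ (L_irreducible a b ε).1 (0 : (L k ε a b).carrier)
  have hev : e v ≠ 0 := fun h => hv (e.map_eq_zero_iff.mp h)
  -- The eigenvalues b and b + 1 of y have the same b² + b in characteristic 2, so this scalar is
  -- recovered even where b itself is not.
  have h1 := congrArg e (L_scalars ε a b v).1
  have h2 := congrArg e (L_scalars ε a b v).2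
  rw [hX, hX, (L_scalars ε' a' b' (e v)).1, map_smul] at h1
  rw [map_add, hX, hX, (L_scalars ε' a' b' (e v)).2, map_smul] at h2
  exact ⟨(smul_left_injective k hev h1).symm, (smul_left_injective k hev h2).symm⟩

end GlClassification

end Ver4

namespace Ver4

universe u

open OGL LaurentPolynomial

/-! ### Restrictions and weights of the listed representations. -/

section Restrictions

variable {k : Type u} [Field k] [CharP k 2]

theorem GLRep.Iso.restrict {V W : GLRep k} (h : V.Iso W) : V.restrict.Iso W.restrict := by
  obtain ⟨e, hd, hc⟩ := h
  refine ⟨e, hd, fun X v => ?_⟩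
  have key : ∀ t : OGL k ⊗[k] V.carrier, e (TensorProduct.lid k _ ((dist X).rTensor _ t)) =
      TensorProduct.lid k _ ((dist X).rTensor _ (e.toLinearMap.lTensor (OGL k) t)) := fun t => by
    induction t with
    | zero => simp
    | add x y hx hy => simp only [map_add, hx, hy]
    | tmul f x => simp
  exact (key (V.coact v)).trans
    (congrArg (fun t => TensorProduct.lid k _ ((dist X).rTensor _ t)) (hc v).symm)

section Matrices

variable {n : ℕ} {D : Matrix (Fin n) (Fin n) k} {C : Matrix (Fin n) (Fin n) (OGL k)}
  {hD : D * D = 0} {hd : ∀ i j, ∑ l, D l j • C i l = dd k (C i j) + ∑ l, D i l • C l j}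
  {hc : ∀ i j, OGL.counit k (C i j) = if i = j then 1 else 0}
  {hΔ : ∀ i j, OGL.comulHom k (C i j) = ∑ l, BraidedSq.tm k (C l j) (C i l)}

theorem linearCombination_single (w : Fin n → k) :
    Fintype.linearCombination k (fun j => (Pi.single j 1 : Fin n → k)) w = w := by
  rw [Fintype.linearCombination_apply]
  exact (pi_eq_sum_univ' w).symm

theorem distAct_matrixCoact_single (μ : Module.Dual k (OGL k)) (j : Fin n) :
    TensorProduct.lid k _ (μ.rTensor _ (GLRep.matrixCoact C (Pi.single j 1))) =
      ∑ i, μ (C i j) • (Pi.single i 1 : Fin n → k) := by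
  simp only [GLRep.matrixCoact_single, map_sum, LinearMap.rTensor_tmul, TensorProduct.lid_tmul]

theorem mulVec_single_eq_sum (A : Matrix (Fin n) (Fin n) k) (j : Fin n) :
    A.mulVec (Pi.single j 1) = ∑ i, A i j • (Pi.single i 1 : Fin n → k) := by
  rw [Matrix.mulVec_single_one]
  exact pi_eq_sum_univ' _

/-- The restriction of a representation given by a matrix of functions. -/
theorem restrict_ofMatrix_iso {mx me my mdy : Matrix (Fin n) (Fin n) k}
    {hd' : ∀ X : GlP k, D * glLin mx me my mdy X =
      glLin mx me my mdy (dd k X) + glLin mx me my mdy X * D}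
    {hb : ∀ X Y : GlP k, glLin mx me my mdy (glBracket k X Y) =
      glLin mx me my mdy X * glLin mx me my mdy Y - glLin mx me my mdy Y * glLin mx me my mdy X
        - glLin mx me my mdy (dd k Y) * glLin mx me my mdy (dd k X)}
    (hx : ∀ i j, dist (gx k) (C i j) = mx i j) (hy : ∀ i j, dist (gy k) (C i j) = my i j) :
    (GLRep.ofMatrix D C hD hd hc hΔ).restrict.Iso
      (GlRep.ofMatrices D mx me my mdy hD hd' hb) := by
  refine GlRep.iso_ofMatrices (M := (GLRep.ofMatrix D C hD hd hc hΔ).restrict)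
    (fun j => (Pi.single j 1 : Fin n → k)) ?_ (mulVec_single_eq_sum D) (fun j => ?_) fun j => ?_
  · have h : Function.Bijective
        (Fintype.linearCombination k fun j => (Pi.single j 1 : Fin n → k)) := by
      rw [show (Fintype.linearCombination k fun j => (Pi.single j 1 : Fin n → k)) =
        LinearMap.id from LinearMap.ext linearCombination_single]
      exact Function.bijective_id
    exact h
  · refine (distAct_matrixCoact_single (dist (gx k)) j).trans ?_
    simp only [hx]
    rfl
  · refine (distAct_matrixCoact_single (dist (gy k)) j).trans ?_
    simp only [hy]
    rfl

theorem hasWeight_ofMatrix {m : ℤ} (h : ∀ i j, torus k (C i j) = if i = j then T m else 0) :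
    HasWeight (GLRep.ofMatrix D C hD hd hc hΔ) m := by
  have key : ∀ v : Fin n → k, (torus k).toLinearMap.rTensor (Fin n → k) (GLRep.matrixCoact C v) =
      T m ⊗ₜ v := fun v => by
    refine GLRep.pi_hom_ext
      (f := (torus k).toLinearMap.rTensor (Fin n → k) ∘ₗ GLRep.matrixCoact C)
      (g := TensorProduct.mk k k[T;T⁻¹] (Fin n → k) (T m)) (fun j => ?_) v
    simp [h, TensorProduct.ite_tmul]
  exact key

end Matrices

/-- The action of `gl(P)` on a tensor product. -/
theorem lieAct_tensor (V W : GLRep k) (X : GlP k) (v : V.carrier) (w : W.carrier) :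
    lieAct (V.tensor W) X (v ⊗ₜ[k] w) =
      (lieAct V X v ⊗ₜ w + v ⊗ₜ lieAct W X w + dd k v ⊗ₜ lieAct W (dd k X) w :
        V.carrier ⊗[k] W.carrier) := by
  have key : ∀ (p : OGL k ⊗[k] V.carrier) (q : OGL k ⊗[k] W.carrier),
      TensorProduct.lid k _ ((dist X).rTensor _ (coMul k (p ⊗ₜ q))) =
      TensorProduct.lid k _ ((dist X).rTensor _ p) ⊗ₜ
          TensorProduct.lid k _ ((counit k).toLinearMap.rTensor _ q) +
        TensorProduct.lid k _ ((counit k).toLinearMap.rTensor _ p) ⊗ₜ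
          TensorProduct.lid k _ ((dist X).rTensor _ q) +
        dd k (TensorProduct.lid k _ ((counit k).toLinearMap.rTensor _ p)) ⊗ₜ
          TensorProduct.lid k _ ((dist (dd k X)).rTensor _ q) := by
    intro p q
    induction p with
    | zero => simp
    | add x y hx hy =>
      simp only [TensorProduct.add_tmul, map_add, hx, hy]
      abel
    | tmul f x =>
      induction q with
      | zero => simp
      | add x y hx hy =>
        simp only [TensorProduct.tmul_add, map_add, hx, hy]
        abel
      | tmul g y =>
        -- The braiding term of the coaction carries f g', on which X takes the value ε(f)X(g'), and
        -- X(g') is the value of X' at g. This is the third summand.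
        have h := mem_lieGL.mp (dist_mem X)
        simp only [coMul_tmul, map_add, LinearMap.rTensor_tmul, TensorProduct.lid_tmul, h,
          counit_dd, mul_zero, zero_add, ← dualD_dist, AlgHom.toLinearMap_apply, map_smul,
          TensorProduct.smul_tmul_smul, add_smul]
        rfl
  refine (key (V.coact v) (W.coact w)).trans ?_
  rw [V.counit_coact, W.counit_coact]
  rfl

/-- A criterion for an isomorphism from the restriction of a tensor product. -/
theorem tensor_restrict_iso {V W : GLRep k} {M : GlRep k}
    (e : V.carrier ⊗[k] W.carrier ≃ₗ[k] M.carrier)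
    (hd : ∀ v w, e (dd k v ⊗ₜ w + v ⊗ₜ dd k w) = dd k (e (v ⊗ₜ w)))
    (hx : ∀ v w, e (lieAct V (gx k) v ⊗ₜ w + v ⊗ₜ lieAct W (gx k) w +
      dd k v ⊗ₜ lieAct W (ge k) w) = M.act (gx k) (e (v ⊗ₜ w)))
    (hy : ∀ v w, e (lieAct V (gy k) v ⊗ₜ w + v ⊗ₜ lieAct W (gy k) w +
      dd k v ⊗ₜ lieAct W (gdy k) w) = M.act (gy k) (e (v ⊗ₜ w))) :
    (V.tensor W).restrict.Iso M := by
  have h1 : ∀ t, e (dd k t) = dd k (e t) := fun t => by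
    have h : e.toLinearMap ∘ₗ dd k = dd k ∘ₗ e.toLinearMap :=
      TensorProduct.ext' fun v w => (congrArg e (dd_tmul k v w)).trans (hd v w)
    exact DFunLike.congr_fun h t
  have h2 : ∀ X, (∀ v w, e (lieAct V X v ⊗ₜ w + v ⊗ₜ lieAct W X w +
      dd k v ⊗ₜ lieAct W (dd k X) w) = M.act X (e (v ⊗ₜ w))) →
      ∀ t : V.carrier ⊗[k] W.carrier, e (lieAct (V.tensor W) X t) = M.act X (e t) :=
    fun X hX t => by
    have h : e.toLinearMap ∘ₗ (show V.carrier ⊗[k] W.carrier →ₗ[k] V.carrier ⊗[k] W.carrier from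
        lieAct (V.tensor W) X) = M.act X ∘ₗ e.toLinearMap :=
      TensorProduct.ext' fun v w => (congrArg e (lieAct_tensor V W X v w)).trans (hX v w)
    exact DFunLike.congr_fun h t
  exact ⟨e, h1, GlRep.map_act_of_gx_gy (M := (V.tensor W).restrict) (e := e.toLinearMap) h1
    (h2 (gx k) (by rwa [dd_gx])) (h2 (gy k) (by rwa [dd_gy]))⟩

/-- Twisting by a character on which `gl(P)` acts by zero does not change the restriction. -/
theorem tensor_restrict_iso_of_lieAct_eq_zero (V : GLRep k) {W : GLRep k} (η : W.carrier ≃ₗ[k] k)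
    (hd : ∀ w : W.carrier, dd k w = 0) (hX : ∀ X w, lieAct W X w = 0) :
    (V.tensor W).restrict.Iso V.restrict := by
  have he : ∀ v w, ((TensorProduct.congr (LinearEquiv.refl k V.carrier) η).trans
      (TensorProduct.rid k V.carrier)) (v ⊗ₜ w) = η w • v := fun v w => by simp
  refine tensor_restrict_iso (M := V.restrict)
    ((TensorProduct.congr (LinearEquiv.refl k V.carrier) η).trans (TensorProduct.rid k V.carrier))
    (fun v w => ?_) (fun v w => ?_) fun v w => ?_
  · rw [hd, TensorProduct.tmul_zero, add_zero]
    refine (he _ w).trans ?_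
    exact ((congrArg (dd k) (he v w)).trans (map_smul _ _ _)).symm
  · rw [hX, hX, TensorProduct.tmul_zero, TensorProduct.tmul_zero, add_zero, add_zero]
    refine (he _ w).trans ?_
    exact ((congrArg (lieAct V (gx k)) (he v w)).trans (map_smul _ _ _)).symm
  · rw [hX, hX, TensorProduct.tmul_zero, TensorProduct.tmul_zero, add_zero, add_zero]
    refine (he _ w).trans ?_
    exact ((congrArg (lieAct V (gy k)) (he v w)).trans (map_smul _ _ _)).symm

/-- Twisting by a character on which `y` acts by one shifts the parameter `b` by one. -/
theorem tensor_restrict_iso_L1 {V W : GLRep k} (η : W.carrier ≃ₗ[k] k)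
    (hd : ∀ w : W.carrier, dd k w = 0) (hx : ∀ w, lieAct W (gx k) w = 0)
    (hy : ∀ w, lieAct W (gy k) w = w) {a b : k} (h : V.restrict.Iso (L1 k a b)) :
    (W.tensor V).restrict.Iso (L1 k a (b + 1)) := by
  obtain ⟨φ, hφd, hφX⟩ := h
  change V.carrier ≃ₗ[k] (Fin 2 → k) at φ
  have he : ∀ w v, ((TensorProduct.congr η (LinearEquiv.refl k V.carrier)).trans
      ((TensorProduct.lid k V.carrier).trans φ)) (w ⊗ₜ v) = η w • φ v := fun w v => by simp
  -- Among the operators of L(1, a, b) only y depends on b, and the character adds 1 to it.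
  have hL : ∀ u : Fin 2 → k, (![b * u 0, (b + 1) * u 1] : Fin 2 → k) + u =
      ![(b + 1) * u 0, (b + 1 + 1) * u 1] := fun u => by
    ext i; fin_cases i <;> simp [add_mul]
  refine tensor_restrict_iso (M := L1 k a (b + 1))
    ((TensorProduct.congr η (LinearEquiv.refl k V.carrier)).trans
      ((TensorProduct.lid k V.carrier).trans φ)) (fun w v => ?_) (fun w v => ?_) fun w v => ?_
  · rw [hd, TensorProduct.zero_tmul, zero_add]
    refine (he w _).trans ?_
    refine Eq.trans ?_ ((congrArg (dd k (V := (L1 k a (b + 1)).carrier)) (he w v)).trans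
      (map_smul (dd k (V := (L1 k a (b + 1)).carrier)) (η w) (φ v))).symm
    exact congrArg (η w • ·) (hφd v)
  · rw [hd, hx, TensorProduct.zero_tmul, TensorProduct.zero_tmul, zero_add, add_zero]
    refine (he w _).trans ?_
    refine Eq.trans ?_ ((congrArg ((L1 k a (b + 1)).act (gx k)) (he w v)).trans
      (map_smul ((L1 k a (b + 1)).act (gx k)) (η w) (φ v))).symm
    exact congrArg (η w • ·)
      ((hφX (gx k) v).trans ((L1_gx a b (φ v)).trans (L1_gx a (b + 1) (φ v)).symm))
  · rw [hd, hy, TensorProduct.zero_tmul, add_zero, ← TensorProduct.tmul_add]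
    refine (he w _).trans ?_
    refine Eq.trans ?_ ((congrArg ((L1 k a (b + 1)).act (gy k)) (he w v)).trans
      (map_smul ((L1 k a (b + 1)).act (gy k)) (η w) (φ v))).symm
    refine congrArg (η w • ·) ((map_add φ _ _).trans ((add_comm _ _).trans ?_))
    exact (congrArg (· + φ v) ((hφX (gy k) v).trans (L1_gy a b (φ v)))).trans
      ((hL (φ v)).trans (L1_gy a (b + 1) (φ v)).symm)

section Characters

variable {g : OGL k} (hd : dd k g = 0) (hc : counit k g = 1)
  (hΔ : comulHom k g = BraidedSq.tm k g g)

theorem dd_charRep (w : (charRep k g hd hc hΔ).carrier) : dd k w = 0 :=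
  Matrix.zero_mulVec (m := Fin 1) w

theorem lieAct_charRep (X : GlP k) (w : (charRep k g hd hc hΔ).carrier) :
    lieAct (charRep k g hd hc hΔ) X w = dist X g • w := by
  have key : ∀ w : Fin 1 → k, TensorProduct.lid k _ ((dist X).rTensor _
      (GLRep.matrixCoact (fun _ _ => g) w)) = dist X g • w := fun w => by
    refine GLRep.pi_hom_ext (f := (TensorProduct.lid k (Fin 1 → k)).toLinearMap ∘ₗ
      (dist X).rTensor (Fin 1 → k) ∘ₗ GLRep.matrixCoact (fun _ _ => g))
      (g := dist X g • LinearMap.id) (fun j => ?_) w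
    refine (distAct_matrixCoact_single (dist X) j).trans ?_
    rw [Fin.sum_univ_one, Subsingleton.elim j 0]
    rfl
  exact key w

/-- The underlying space of a character is `k`. -/
def charRepEquiv : (charRep k g hd hc hΔ).carrier ≃ₗ[k] k := LinearEquiv.funUnique (Fin 1) k k

theorem charRep_restrict_iso {b : k} (hx : dist (gx k) g = 0) (hy : dist (gy k) g = b) :
    (charRep k g hd hc hΔ).restrict.Iso (L k 0 0 b) := by
  rw [L_zero_zero]
  unfold charRep
  exact restrict_ofMatrix_iso (fun i j => hx)
    (fun i j => by rw [hy]; fin_cases i; fin_cases j; rfl)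

theorem hasWeight_charRep {m : ℤ} (h : torus k g = T m) : HasWeight (charRep k g hd hc hΔ) m := by
  unfold charRep
  exact hasWeight_ofMatrix fun i j => by rw [if_pos (Subsingleton.elim i j), h]

end Characters

section Values

theorem dist_mul (X : GlP k) (f g : OGL k) :
    dist X (f * g) = dist X f * counit k g + counit k f * dist X g :=
  mem_lieGL.mp (dist_mem X) f g

theorem dist_gx : dist (gx k) (A k) = 0 ∧ dist (gx k) (B k) = 0 ∧ dist (gx k) (dA k) = 1 ∧
    dist (gx k) (dB k) = 0 := by
  have h := glToLie_mk_gen k 0 1 0 0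
  rwa [sub_zero] at h

theorem dist_gy : dist (gy k) (A k) = 0 ∧ dist (gy k) (B k) = 0 ∧ dist (gy k) (dA k) = 0 ∧
    dist (gy k) (dB k) = 1 := by
  have h := glToLie_mk_gen k 1 0 0 0
  rwa [sub_zero] at h

/-- The units of counit 1 that X annihilates form a group, so A⁴ suffices, and X(A⁴) = 4X(A) = 0. -/
theorem dist_chi (X : GlP k) (n : ℤ) :
    dist X (((unitA k ^ 4) ^ n : (OGL k)ˣ) : OGL k) = 0 := by
  let H : Subgroup (OGL k)ˣ :=
    { carrier := {g | counit k (g : OGL k) = 1 ∧ dist X (g : OGL k) = 0}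
      one_mem' := by simp [(dist_mem X).1]
      mul_mem' := by
        rintro g h ⟨g1, g2⟩ ⟨h1, h2⟩
        exact ⟨by rw [Units.val_mul, map_mul, g1, h1, one_mul],
          by rw [Units.val_mul, dist_mul, g2, h2, zero_mul, mul_zero, add_zero]⟩
      inv_mem' := by
        rintro g ⟨g1, g2⟩
        have h1 := congrArg (counit k) g.inv_mul
        have h2 := congrArg (dist X) g.inv_mul
        rw [map_mul, g1, mul_one, map_one] at h1
        rw [dist_mul, g1, g2, mul_one, mul_zero, add_zero, (dist_mem X).1] at h2
        exact ⟨h1, h2⟩ }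
  have h : unitA k ^ 4 ∈ H := by
    constructor
    · change counit k (A k ^ 4) = 1
      simp
    · have h2 := CharTwo.two_eq_zero (R := k)
      change dist X (A k ^ 4) = 0
      simp only [pow_succ, pow_zero, one_mul, dist_mul, map_mul, counit_A, mul_one]
      linear_combination (2 * dist X (A k)) * h2
  exact (H.zpow_mem h n).2

end Values

theorem tensor_chi_restrict_iso (V : GLRep k) (n : ℤ) :
    (V.tensor (chi k n)).restrict.Iso V.restrict := by
  unfold chi
  exact tensor_restrict_iso_of_lieAct_eq_zero V (charRepEquiv _ _ _) (dd_charRep _ _ _)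
    fun X w => by rw [lieAct_charRep, dist_chi, zero_smul]

/-- The value 1 of y comes from A³B' alone. The term A²BA' lies in I², so no Lie algebra element
sees it. -/
theorem dist_xi : dist (gx k) (A k ^ 4 + A k ^ 3 * dB k + A k ^ 2 * B k * dA k) = 0 ∧
    dist (gy k) (A k ^ 4 + A k ^ 3 * dB k + A k ^ 2 * B k * dA k) = 1 := by
  obtain ⟨x1, x2, x3, x4⟩ := dist_gx (k := k)
  obtain ⟨y1, y2, y3, y4⟩ := dist_gy (k := k)
  constructor <;>
    simp [pow_succ, dist_mul, x1, x2, x3, x4, y1, y2, y3, y4]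

theorem chi_restrict_iso (n : ℤ) : (chi k n).restrict.Iso (L k 0 0 0) := by
  unfold chi
  exact charRep_restrict_iso _ _ _ (dist_chi _ n) (dist_chi _ n)

theorem xi_restrict_iso : (xi k).restrict.Iso (L k 0 0 1) := by
  unfold xi
  exact charRep_restrict_iso _ _ _ dist_xi.1 dist_xi.2

theorem xi_tensor_restrict_iso {V : GLRep k} {a b : k} (h : V.restrict.Iso (L k 1 a b)) :
    ((xi k).tensor V).restrict.Iso (L k 1 a (b + 1)) := by
  rw [L_one] at h ⊢
  unfold xi
  exact tensor_restrict_iso_L1 (charRepEquiv _ _ _) (dd_charRep _ _ _)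
    (fun w => by rw [lieAct_charRep, dist_xi.1, zero_smul])
    (fun w => by rw [lieAct_charRep, dist_xi.2, one_smul]) h

theorem T1_restrict_iso : (T1 k).restrict.Iso (L k 1 0 0) := by
  obtain ⟨x1, x2, x3, x4⟩ := dist_gx (k := k)
  obtain ⟨y1, y2, y3, y4⟩ := dist_gy (k := k)
  rw [L_one]
  refine restrict_ofMatrix_iso (fun i j => ?_) (fun i j => ?_) <;> fin_cases i <;> fin_cases j <;>
    simp [x1, x2, x3, x4, y1, y2, y3, y4]

theorem T2_restrict_iso : (T2 k).restrict.Iso (L k 0 1 0) := by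
  obtain ⟨x1, x2, x3, x4⟩ := dist_gx (k := k)
  obtain ⟨y1, y2, y3, y4⟩ := dist_gy (k := k)
  rw [L_zero_of_ne _ one_ne_zero]
  refine restrict_ofMatrix_iso (fun i j => ?_) (fun i j => ?_) <;> fin_cases i <;> fin_cases j <;>
    simp [pow_succ, dist_mul, x1, x2, x3, x4, y1, y2, y3, y4]

theorem T3_restrict_iso : (T3 k).restrict.Iso (L k 1 1 0) := by
  obtain ⟨x1, x2, x3, x4⟩ := dist_gx (k := k)
  obtain ⟨y1, y2, y3, y4⟩ := dist_gy (k := k)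
  rw [L_one]
  refine restrict_ofMatrix_iso (fun i j => ?_) (fun i j => ?_) <;> fin_cases i <;> fin_cases j <;>
    simp [pow_succ, dist_mul, x1, x2, x3, x4, y1, y2, y3, y4]

section Weights

theorem hasWeight_chi (n : ℤ) : HasWeight (chi k n) (4 * n) := by
  have h : ∀ m : ℤ, torus k ((unitA k ^ m : (OGL k)ˣ) : OGL k) = T m :=
    val_zpow_unitA_induction (p := fun m f => torus k f = T m) (by simp)
      (fun m f hf => by rw [map_mul, hf, torus_A, T_add])
      (fun m f hf => by rw [map_mul, hf, torus_Ai, sub_eq_add_neg, T_add])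
  unfold chi
  refine hasWeight_charRep _ _ _ ?_
  rw [← h, zpow_mul]
  rfl

theorem hasWeight_xi : HasWeight (xi k) 4 := by
  unfold xi
  exact hasWeight_charRep _ _ _ (by simp [T_pow])

theorem hasWeight_T1 : HasWeight (T1 k) 1 := by
  refine hasWeight_ofMatrix fun i j => ?_
  fin_cases i <;> fin_cases j <;> simp

theorem hasWeight_T2 : HasWeight (T2 k) 2 := by
  refine hasWeight_ofMatrix fun i j => ?_
  fin_cases i <;> fin_cases j <;> simp [T_pow]

theorem hasWeight_T3 : HasWeight (T3 k) 3 := by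
  refine hasWeight_ofMatrix fun i j => ?_
  fin_cases i <;> fin_cases j <;> simp [T_pow]

end Weights

end Restrictions

end Ver4

namespace Ver4

universe u

/-! ### Matching irreducible representations with the list. -/

section Classification

variable {k : Type u} [Field k] [CharP k 2]

theorem xi_T1_restrict_iso : ((xi k).tensor (T1 k)).restrict.Iso (L k 1 0 1) := by
  have h := xi_tensor_restrict_iso (T1_restrict_iso (k := k))
  rwa [zero_add] at h

theorem xi_T3_restrict_iso : ((xi k).tensor (T3 k)).restrict.Iso (L k 1 1 1) := by
  have h := xi_tensor_restrict_iso (T3_restrict_iso (k := k))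
  rwa [zero_add] at h

theorem restrict_tensor_chi {V : GLRep k} {M : GlRep k} (h : V.restrict.Iso M) (n : ℤ) :
    (V.tensor (chi k n)).restrict.Iso M :=
  (tensor_chi_restrict_iso V n).trans h

/-- The number 4q(4q-1)/2 and the cross term 4qr are even. Therefore the restriction sees the weight
only modulo 4, in accordance with the weight 4 of χ. -/
theorem binomTwo_four_mul_add (q r : ℤ) : binomTwo k (4 * q + r) = binomTwo k r := by
  have h2 := CharTwo.two_eq_zero (R := k)
  have h : 4 * q * (4 * q - 1) / 2 = 2 * (q * (4 * q - 1)) := by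
    rw [show 4 * q * (4 * q - 1) = 2 * (2 * (q * (4 * q - 1))) by ring]
    exact Int.mul_ediv_cancel_left _ two_ne_zero
  have h0 : binomTwo k (4 * q) = 0 := by
    rw [binomTwo, h]; push_cast; rw [h2, zero_mul]
  rw [binomTwo_add, h0]
  push_cast
  linear_combination (2 * (q : k) * r) * h2

theorem intCast_four_mul_add (q r : ℤ) : ((4 * q + r : ℤ) : k) = r := by
  push_cast
  linear_combination (2 * (q : k)) * CharTwo.two_eq_zero (R := k)

variable [Infinite k]

/-- The restriction of an irreducible representation of weight `n` is `L(ε, a, b)` with `ε`, `a`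
determined by `n`, and `b ∈ 𝔽₂`. -/
theorem exists_restrict_iso {V : GLRep k} (hV : V.Irreducible) {n : ℤ} (hn : HasWeight V n)
    {ε : Fin 2} (hε : (n : k) = if ε = 1 then 1 else 0) :
    ∃ b : k, (b = 0 ∨ b = 1) ∧ V.restrict.Iso (L k ε (binomTwo k n) b) := by
  have hε' : ε = 0 ∨ ε = 1 := by omega
  rcases hε' with rfl | rfl
  · rw [if_neg (by decide)] at hε
    exact GlRep.exists_iso_L0 (restrict_irreducible hV)
      (fun v => (hn.act_ge v).trans (by rw [hε]; exact zero_smul k _))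
      (lieAct_gdy_eq_zero hV hn hε) hn.act_gx_gx (lieAct_gy_gy hV hn)
  · rw [if_pos rfl] at hε
    simp only [L_one]
    exact GlRep.exists_iso_L1 (restrict_irreducible hV)
      (fun v => (hn.act_ge v).trans (by rw [hε]; exact one_smul k _))
      hn.act_gx_gx (lieAct_gy_gy hV hn)

theorem irreducible_of_restrict_iso_L {V : GLRep k} {ε : Fin 2} {a b : k}
    (h : V.restrict.Iso (L k ε a b)) : V.Irreducible :=
  irreducible_of_restrict (h.irreducible (L_irreducible a b ε))

/-- An irreducible representation is determined by its weight and its restriction. -/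
theorem iso_of_hasWeight {V S : GLRep k} {n m : ℤ} (hn : HasWeight V n) (hm : HasWeight S m)
    (hnm : n = m) {ε : Fin 2} {a b : k} (hV : V.restrict.Iso (L k ε a b))
    (hS : S.restrict.Iso (L k ε a b)) : V.Iso S := by
  subst hnm
  exact iso_of_restrict_iso (irreducible_of_restrict_iso_L hV) (irreducible_of_restrict_iso_L hS)
    hn hm (hV.trans hS.symm)

/-- The residue of the weight modulo 4 gives (ε, a) = (0,0), (1,0), (0,1), (1,1) in turn. Together
with b it selects a member of the list with the same restriction, and the power of χ adjusts the
weight. -/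
theorem exists_iso_of_irreducible {V : GLRep k} (hV : V.Irreducible) : ∃ n : ℤ,
    V.Iso (chi k n) ∨ V.Iso ((T1 k).tensor (chi k n)) ∨ V.Iso ((T2 k).tensor (chi k n)) ∨
    V.Iso ((T3 k).tensor (chi k n)) ∨ V.Iso ((xi k).tensor (chi k n)) ∨
    V.Iso (((xi k).tensor (T1 k)).tensor (chi k n)) ∨
    V.Iso (((xi k).tensor (T3 k)).tensor (chi k n)) := by
  obtain ⟨n, hn⟩ := exists_hasWeight hV
  have h2 := CharTwo.two_eq_zero (R := k)
  obtain ⟨q, r, hr, rfl⟩ : ∃ q r : ℤ, (r = 0 ∨ r = 1 ∨ r = 2 ∨ r = 3) ∧ n = 4 * q + r :=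
    ⟨n / 4, n % 4, by omega, by omega⟩
  have H := fun ε => exists_restrict_iso hV hn (ε := ε)
  rw [binomTwo_four_mul_add, intCast_four_mul_add] at H
  rcases hr with rfl | rfl | rfl | rfl
  · obtain ⟨b, rfl | rfl, h⟩ := H 0 (by simp)
    · refine ⟨q, Or.inl (iso_of_hasWeight hn (hasWeight_chi q) (by ring) h ?_)⟩
      simpa [binomTwo] using chi_restrict_iso q
    -- Since ξ itself has weight 4, a factor ξ takes the place of one factor χ.
    · refine ⟨q - 1, .inr <| .inr <| .inr <| .inr <| .inl <| iso_of_hasWeight hn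
        (hasWeight_xi.tensor (hasWeight_chi (q - 1))) (by ring) h ?_⟩
      simpa [binomTwo] using restrict_tensor_chi (xi_restrict_iso (k := k)) (q - 1)
  · obtain ⟨b, rfl | rfl, h⟩ := H 1 (by simp)
    · refine ⟨q, .inr <| .inl <| iso_of_hasWeight hn
        (hasWeight_T1.tensor (hasWeight_chi q)) (by ring) h ?_⟩
      simpa [binomTwo] using restrict_tensor_chi (T1_restrict_iso (k := k)) q
    · refine ⟨q - 1, .inr <| .inr <| .inr <| .inr <| .inr <| .inl <| iso_of_hasWeight hn
        ((hasWeight_xi.tensor hasWeight_T1).tensor (hasWeight_chi (q - 1))) (by ring) h ?_⟩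
      simpa [binomTwo] using restrict_tensor_chi (xi_T1_restrict_iso (k := k)) (q - 1)
  · have h1 : binomTwo k 2 = 1 := by simp [binomTwo]
    obtain ⟨b, hb, h⟩ := H 0 (by simp [h2])
    -- For residue 2 both values of b give the same module, so no twist by ξ is needed.
    have h' : V.restrict.Iso (L k 0 1 0) := by
      rw [h1] at h
      rcases hb with rfl | rfl
      · exact h
      · exact h.trans L_zero_one_iso.symm
    exact ⟨q, .inr <| .inr <| .inl <| iso_of_hasWeight hn
      (hasWeight_T2.tensor (hasWeight_chi q)) (by ring) h' (restrict_tensor_chi T2_restrict_iso q)⟩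
  · have h1 : binomTwo k 3 = 1 := by
      have h3 : (3 * (3 - 1) / 2 : ℤ) = 3 := by norm_num
      rw [binomTwo, h3]
      push_cast
      linear_combination h2
    rw [h1] at H
    obtain ⟨b, rfl | rfl, h⟩ := H 1 (by push_cast; linear_combination h2)
    · exact ⟨q, .inr <| .inr <| .inr <| .inl <| iso_of_hasWeight hn
        (hasWeight_T3.tensor (hasWeight_chi q)) (by ring) h
        (restrict_tensor_chi T3_restrict_iso q)⟩
    · exact ⟨q - 1, .inr <| .inr <| .inr <| .inr <| .inr <| .inr <| iso_of_hasWeight hn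
        ((hasWeight_xi.tensor hasWeight_T3).tensor (hasWeight_chi (q - 1))) (by ring) h
        (restrict_tensor_chi xi_T3_restrict_iso (q - 1))⟩

/-- The representations `L(ε, a, b)` with `a, b ∈ 𝔽₂` are restrictions. -/
theorem exists_restrict_iso_L (ε : Fin 2) {a b : k} (ha : a = 0 ∨ a = 1) (hb : b = 0 ∨ b = 1) :
    ∃ V : GLRep k, V.restrict.Iso (L k ε a b) := by
  have hε : ε = 0 ∨ ε = 1 := by omega
  rcases hε with rfl | rfl <;> rcases ha with rfl | rfl <;> rcases hb with rfl | rfl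
  · exact ⟨_, chi_restrict_iso 0⟩
  · exact ⟨_, xi_restrict_iso⟩
  · exact ⟨_, T2_restrict_iso⟩
  · exact ⟨_, T2_restrict_iso.trans L_zero_one_iso⟩
  · exact ⟨_, T1_restrict_iso⟩
  · exact ⟨_, xi_T1_restrict_iso⟩
  · exact ⟨_, T3_restrict_iso⟩
  · exact ⟨_, xi_T3_restrict_iso⟩

theorem exists_iso_L_of_irreducible {V : GLRep k} (hV : V.Irreducible) :
    ∃ (ε : Fin 2) (a b : k), (a = 0 ∨ a = 1) ∧ (b = 0 ∨ b = 1) ∧ V.restrict.Iso (L k ε a b) := by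
  obtain ⟨n, hn⟩ := exists_hasWeight hV
  obtain ⟨ε, hε⟩ : ∃ ε : Fin 2, (n : k) = if ε = 1 then 1 else 0 := by
    rcases intCast_eq_zero_or_one (k := k) n with h | h
    · exact ⟨0, by simpa using h⟩
    · exact ⟨1, by simpa using h⟩
  obtain ⟨b, hb, h⟩ := exists_restrict_iso hV hn hε
  -- The parameter a is the image of the integer n(n-1)/2, hence lies in 𝔽₂.
  exact ⟨ε, _, b, intCast_eq_zero_or_one _, hb, h⟩

end Classification

end Ver4

/-! ### The classification theorem. -/

theorem mainTheorem12 {k : Type*} [Field k] [IsAlgClosed k] [CharP k 2] :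
    -- the list of irreducible representations of `GL(P)`
    (∀ V : Ver4.GLRep k, V.Irreducible ↔ ∃ n : ℤ,
      V.Iso (Ver4.chi k n) ∨
      V.Iso ((Ver4.T1 k).tensor (Ver4.chi k n)) ∨
      V.Iso ((Ver4.T2 k).tensor (Ver4.chi k n)) ∨
      V.Iso ((Ver4.T3 k).tensor (Ver4.chi k n)) ∨
      V.Iso ((Ver4.xi k).tensor (Ver4.chi k n)) ∨
      V.Iso (((Ver4.xi k).tensor (Ver4.T1 k)).tensor (Ver4.chi k n)) ∨
      V.Iso (((Ver4.xi k).tensor (Ver4.T3 k)).tensor (Ver4.chi k n))) ∧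
    -- their restrictions to `gl(P)`
    (∀ n : ℤ,
      (Ver4.chi k n).restrict.Iso (Ver4.L k 0 0 0) ∧
      ((Ver4.T1 k).tensor (Ver4.chi k n)).restrict.Iso (Ver4.L k 1 0 0) ∧
      ((Ver4.T2 k).tensor (Ver4.chi k n)).restrict.Iso (Ver4.L k 0 1 0) ∧
      ((Ver4.T3 k).tensor (Ver4.chi k n)).restrict.Iso (Ver4.L k 1 1 0) ∧
      ((Ver4.xi k).tensor (Ver4.chi k n)).restrict.Iso (Ver4.L k 0 0 1) ∧
      (((Ver4.xi k).tensor (Ver4.T1 k)).tensor (Ver4.chi k n)).restrict.Iso (Ver4.L k 1 0 1) ∧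
      (((Ver4.xi k).tensor (Ver4.T3 k)).tensor (Ver4.chi k n)).restrict.Iso (Ver4.L k 1 1 1)) ∧
    (Ver4.L k 0 1 0).Iso (Ver4.L k 0 1 1) ∧
    -- every `L(ε, a, b)` is irreducible
    (∀ (ε : Fin 2) (a b : k), (Ver4.L k ε a b).Irreducible) ∧
    -- the restrictions are exactly the `L(ε, a, b)` with `a, b ∈ 𝔽₂`
    (∀ M : Ver4.GlRep k, (∃ V : Ver4.GLRep k, V.Irreducible ∧ V.restrict.Iso M) ↔
      ∃ (ε : Fin 2) (a b : k), (a = 0 ∨ a = 1) ∧ (b = 0 ∨ b = 1) ∧ M.Iso (Ver4.L k ε a b)) ∧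
    (∀ (ε : Fin 2) (a b : k),
      (∃ V : Ver4.GLRep k, V.Irreducible ∧ V.restrict.Iso (Ver4.L k ε a b)) ↔
        (a = 0 ∨ a = 1) ∧ (b = 0 ∨ b = 1)) := by
  have hR : ∀ n : ℤ, _ ∧ _ ∧ _ ∧ _ ∧ _ ∧ _ ∧ _ := fun n =>
    ⟨Ver4.chi_restrict_iso (k := k) n, Ver4.restrict_tensor_chi (k := k) Ver4.T1_restrict_iso n,
      Ver4.restrict_tensor_chi (k := k) Ver4.T2_restrict_iso n,
      Ver4.restrict_tensor_chi (k := k) Ver4.T3_restrict_iso n,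
      Ver4.restrict_tensor_chi (k := k) Ver4.xi_restrict_iso n,
      Ver4.restrict_tensor_chi (k := k) Ver4.xi_T1_restrict_iso n,
      Ver4.restrict_tensor_chi (k := k) Ver4.xi_T3_restrict_iso n⟩
  refine ⟨fun V => ⟨Ver4.exists_iso_of_irreducible, ?_⟩, hR, Ver4.L_zero_one_iso,
    fun ε a b => Ver4.L_irreducible a b ε, fun M => ⟨?_, ?_⟩, fun ε a b => ⟨?_, ?_⟩⟩
  · rintro ⟨n, h⟩
    obtain ⟨h1, h2, h3, h4, h5, h6, h7⟩ := hR n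
    rcases h with h | h | h | h | h | h | h
    · exact Ver4.irreducible_of_restrict_iso_L (h.restrict.trans h1)
    · exact Ver4.irreducible_of_restrict_iso_L (h.restrict.trans h2)
    · exact Ver4.irreducible_of_restrict_iso_L (h.restrict.trans h3)
    · exact Ver4.irreducible_of_restrict_iso_L (h.restrict.trans h4)
    · exact Ver4.irreducible_of_restrict_iso_L (h.restrict.trans h5)
    · exact Ver4.irreducible_of_restrict_iso_L (h.restrict.trans h6)
    · exact Ver4.irreducible_of_restrict_iso_L (h.restrict.trans h7)
  · rintro ⟨V, hV, h⟩
    obtain ⟨ε, a, b, ha, hb, hL⟩ := Ver4.exists_iso_L_of_irreducible hV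
    exact ⟨ε, a, b, ha, hb, h.symm.trans hL⟩
  · rintro ⟨ε, a, b, ha, hb, h⟩
    obtain ⟨V, hV⟩ := Ver4.exists_restrict_iso_L ε ha hb
    exact ⟨V, Ver4.irreducible_of_restrict_iso_L hV, hV.trans h.symm⟩
  · rintro ⟨V, hV, h⟩
    obtain ⟨ε', a', b', ha, hb, hL⟩ := Ver4.exists_iso_L_of_irreducible hV
    obtain ⟨rfl, h2⟩ := Ver4.L_iso_invariants (h.symm.trans hL)
    refine ⟨ha, ?_⟩
    -- The invariant b² + b equals b'² + b' with b' in 𝔽₂, which is zero; this forces b into 𝔽₂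
    -- without requiring b = b'.
    have h0 : b * (b + 1) = 0 := by
      have h3 := CharTwo.two_eq_zero (R := k)
      rcases hb with rfl | rfl
      · linear_combination h2
      · linear_combination h2 + h3
    rcases mul_eq_zero.mp h0 with hb | hb
    · exact Or.inl hb
    · exact Or.inr (CharTwo.add_eq_zero.mp hb)
  · rintro ⟨ha, hb⟩
    obtain ⟨V, hV⟩ := Ver4.exists_restrict_iso_L ε ha hb
    exact ⟨V, Ver4.irreducible_of_restrict_iso_L hV, hV⟩
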